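/- Let $H=L_2(\Omega,\mathcal F,\mathsf P;\mathbb C)$ be infinite dimensional, let $T>0$, $P\ge 0$, and let $d\ge 0$, $\tau\ge 1$ be integers. For $\xi:\mathbb R\to H$ put $\xi^{(d)}(t,\tau T)=\sum_{l=0}^d(-1)^l\binom dl\,\xi(t-l\tau T)$. Let $\widetilde e_k(u)=T^{-1/2}e^{2\pi i(-1)^k[k/2]u/T}$, $k=1,2,\dots$, be the Fourier basis of $L_2([0,T))$ and, for $j\in\mathbb Z$, let $$\xi^{(d)}_j(u)=\xi^{(d)}(u+jT,\tau T)\ (0\le u<T),\qquad \xi^{(d)}_{kj}=\langle \xi^{(d)}_j,\widetilde e_k\rangle=\int_0^T \xi^{(d)}_j(u)\,\overline{\widetilde e_k(u)}\,du ,\qquad \vec\xi^{\,(d)}_j=(\xi^{(d)}_{kj})_{k\ge1}.$$ Let $\mathbf Y$ be the class of all $\xi$ whose increments $\xi^{(d)}(t,\tau T)$ are measurable in $t$ as an $H$-valued function, satisfy $\mathsf E\,\xi^{(d)}(t,\tau T)=0$ for all $t$, are periodically correlated, i.e. $\mathsf E\,\xi^{(d)}(t+T,\tau T)\overline{\xi^{(d)}(s+T,\tau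 T)}=\mathsf E\,\xi^{(d)}(t,\tau T)\overline{\xi^{(d)}(s,\tau T)}$ for all $t,s$, and satisfy $\|\xi^{(d)}_j\|_H^2=\int_0^T\mathsf E|\xi^{(d)}_j(u)|^2du\le P$ (this does not depend on $j$). Let $\mathbf Y_R\subset\mathbf Y$ consist of those $\xi$ for which the generated sequence is regular, $\bigcap_{j}\overline{\mathrm{span}}\{\xi^{(d)}_{kl}:k\ge1,\,l\le j\}=\{0\}$, and $\mathbf Y_C\subset\mathbf Y$ of those whose increments are mean-square continuous in $t$. Let $b:[0,\infty)\to\mathbb C$ be square integrable on every $[jT,(j+1)T)$, $b_j(u)=b(u+jT)$, and let $b_{kj}=\int_0^T b_j(u)\widetilde e_k(u)\,du$, $\vec b_j=(b_{kj})_{k\ge 1}$. Thus $\int_0^T b_j(u)\xi^{(d)}_j(u)\,du=\sum_k b_{kj}\xi^{(d)}_{kj}$, and $\vec b_j$ is the sequence of Fourier coefficients $\langle b_j,\widetilde e_k\rangle$ taken in the order $k=1,3,2,5,4,\dots$ Suppose that, with $\|\vec b_j\|^2=\sum_k|b_{kj}|^2$, $$\sum_{j\ge0}\|\vec b_j\|<\infty,\qquad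 \sum_{j\ge0}(j+1)\|\vec b_j\|<\infty .$$ Consider $B\xi=\int_0^\infty b(t)\,\xi^{(d)}(t,\tau T)\,dt$. Let $\Lambda$ be the set of linear estimates of $B\xi$ from the past of the increments: an element $\widehat B$ of $\Lambda$ is a sequence of finite linear rules $\xi\mapsto\sum_{k\ge1,\,j<0}c^{(n)}_{kj}\xi^{(d)}_{kj}$ with coefficients not depending on $\xi$, $\widehat B\xi$ is the mean-square limit of their values, and $\Delta(\xi,\widehat B)=\mathsf E|B\xi-\widehat B\xi|^2$, with $\Delta(\xi,\widehat B)=\infty$ if the limit does not exist. Then the following holds. 1. For every $\xi\in\mathbf Y$ the integral defining $B\xi$ converges absolutely (as a Bochner integral) in $H$. 2. The matrix with entries $$Q_{kn}(p,q)=\sum_{s=0}^\infty b_{k,s+p}\,\overline{b_{n,s+q}},\qquad k,n\ge1,\ p,q\ge0,$$ determines a compact self-adjoint operator $Q$ in $\ell_2$ (square summable families indexed by $(p,k)$), and $Q$ has a greatest eigenvalue, which is of the form $\nu^2$ with $\nu\in\mathbb R$. 3. $\Delta$ has a saddle point on $\mathbf Y\times\Lambda$ and on $\mathbf Y_R\times\Lambda$: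 for $\mathbf X=\mathbf Y$ and for $\mathbf X=\mathbf Y_R$ there are $\xi_0\in\mathbf X$, $\widehat B_0\in\Lambda$ with $\Delta(\xi,\widehat B_0)\le\Delta(\xi_0,\widehat B_0)\le\Delta(\xi_0,\widehat B)$ for all $\xi\in\mathbf X$, $\widehat B\in\Lambda$, and $$\min_{\widehat B\in\Lambda}\ \sup_{\xi\in\mathbf X}\Delta(\xi,\widehat B)=\max_{\xi\in\mathbf X}\ \min_{\widehat B\in\Lambda}\Delta(\xi,\widehat B)=\Delta(\xi_0,\widehat B_0)=P\nu^2 .$$ Over $\mathbf Y_C$ both values are $P\nu^2$ as well, with $\max_\xi$ replaced by $\sup_\xi$. 4. The least favorable sequences (those $\xi\in\mathbf Y$ at which $\max_{\xi\in\mathbf Y}\min_{\widehat B\in\Lambda}\Delta(\xi,\widehat B)$ is attained) are one-sided moving averages $$\vec\xi^{\,(d)}_j=\sum_{s=-\infty}^{j}g(j-s)\,\vec\varepsilon(s),\qquad g(p)=\{g_{km}(p)\}_{k\ge1}^{1\le m\le M},\qquad \sum_{p\ge0}\|g(p)\|^2=P,\tag{$*$}$$ where $\|g(p)\|^2=\sum_{k,m}|g_{km}(p)|^2$,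 $\vec\varepsilon(s)=(\varepsilon_m(s))_{m=1}^M$ is an orthonormal sequence with mean zero, $\mathsf E\,\varepsilon_m(s)\overline{\varepsilon_n(r)}=\delta_{mn}\delta_{sr}$, and every column $g_m=(g_{km}(p))_{p,k}$ satisfies $g_m^\top Q=\nu^2g_m^\top$ (equivalently, $Q\,\overline{g_m}=\nu^2\,\overline{g_m}$). Precisely: some $\xi\in\mathbf Y_R$ has the form $(*)$ with $M=1$; every $\xi\in\mathbf Y$ of the form $(*)$ with some finite $M$ is least favorable in $\mathbf Y$; and if $\nu\neq0$, every least favorable $\xi\in\mathbf Y$ has the form $(*)$ with some finite $M$. -/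

import Mathlib

open MeasureTheory Filter Topology Set
open scoped ENNReal ComplexConjugate

noncomputable section

namespace PCIncr

/-! ### The Fourier basis of `L²([0,T))` -/

/-- The frequency `(-1)^k [k/2]` of the `k`-th basis function, `k = 1, 2, 3, …`. -/
def freq (k : ℕ+) : ℤ := (-1) ^ (k : ℕ) * (((k : ℕ) / 2 : ℕ) : ℤ)

/-- The basis function `ẽ_k(u) = T^{-1/2} exp (2πi (-1)^k [k/2] u / T)`. -/
def basisFun (T : ℝ) (k : ℕ+) (u : ℝ) : ℂ :=
  ((Real.sqrt T)⁻¹ : ℝ) * Complex.exp (2 * Real.pi * Complex.I * (freq k : ℂ) * u / T)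

/-- The coefficient `⟨x, ẽ_k⟩ = ∫_0^T x(v) conj (ẽ_k(v)) dv` of a function with values in a
complex Banach space (scalars for weight functions, random variables for processes). -/
def fourierCoef {E : Type*} [NormedAddCommGroup E] [NormedSpace ℂ E]
    (T : ℝ) (x : ℝ → E) (k : ℕ+) : E :=
  ∫ v in (0 : ℝ)..T, conj (basisFun T k v) • x v

/-- The permutation of the indices that fixes `1` and exchanges `2l` and `2l + 1`. -/
def swapIdx (k : ℕ+) : ℕ+ :=
  if k = 1 then 1 else if Even (k : ℕ) then k + 1 else k - 1

/-- `swapIdx k` is the index whose frequency is opposite to that of `k`. -/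
theorem freq_swapIdx (k : ℕ+) : freq (swapIdx k) = -freq k := by
  unfold swapIdx
  split_ifs with h1 h2
  · subst h1; simp [freq]
  · have e : ((k + 1 : ℕ+) : ℕ) / 2 = (k : ℕ) / 2 := by
      rw [PNat.add_coe]; obtain ⟨m, hm⟩ := h2; rw [hm]; simp; omega
    unfold freq
    rw [e, PNat.add_coe, PNat.one_coe, pow_succ]; ring
  · have hk : 1 < k := lt_of_le_of_ne one_le (Ne.symm h1)
    obtain ⟨m, hm⟩ := Nat.not_even_iff_odd.1 h2
    have e : ((k - 1 : ℕ+) : ℕ) = 2 * m := by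
      rw [PNat.sub_coe, if_pos hk, hm]; simp
    have e2 : (2 * m + 1) / 2 = m := by omega
    unfold freq
    rw [e, hm, e2, pow_succ]
    simp

/-! ### The weight function of the functional and its coefficients -/

/-- The component `k` of the vector `b⃗_j = (b_{1j}, b_{3j}, b_{2j}, b_{5j}, b_{4j}, …)ᵀ`, where
`b_{kj} = ⟨b_j, ẽ_k⟩` and `b_j(u) = b(u + jT)`. In this order of the components the functional
is `∑_j ∑_k (b⃗_j)_k ξ_{kj}`. -/
def bVec (T : ℝ) (b : ℝ → ℂ) (j : ℕ) (k : ℕ+) : ℂ :=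
  fourierCoef T (fun u => b (u + j * T)) (swapIdx k)

/-- `‖b⃗_j‖`. -/
def bNorm (T : ℝ) (b : ℝ → ℂ) (j : ℕ) : ℝ := Real.sqrt (∑' k : ℕ+, ‖bVec T b j k‖ ^ 2)

/-- The summability condition on the coefficients. -/
structure CoefCondition (T : ℝ) (b : ℝ → ℂ) : Prop where
  sq_summable : ∀ j : ℕ, Summable fun k : ℕ+ => ‖bVec T b j k‖ ^ 2
  summable : Summable fun j : ℕ => bNorm T b j
  weighted_summable : Summable fun j : ℕ => ((j : ℝ) + 1) * bNorm T b j

/-- The space `ℓ₂` of square summable families indexed by `(p, k)`, `p = 0, 1, …`,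
`k = 1, 2, …`. -/
abbrev Ell2 : Type := lp (fun _ : ℕ × ℕ+ => ℂ) 2

/-- The bounded operator `Q` on `ℓ₂` has the matrix
`Q_{kn}(p,q) = ∑_s (b⃗_{s+p})_k conj ((b⃗_{s+q})_n)`, all these series being convergent. -/
def HasBlockMatrix (T : ℝ) (b : ℝ → ℂ) (Q : Ell2 →L[ℂ] Ell2) : Prop :=
  ∀ (p q : ℕ) (k n : ℕ+),
    HasSum (fun s : ℕ => bVec T b (s + p) k * conj (bVec T b (s + q) n))
      (Q (lp.single 2 (q, n) (1 : ℂ)) (p, k))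

/-! ### Processes with periodically correlated increments -/

variable {Ω : Type*} [MeasurableSpace Ω] {μ : Measure Ω}

/-- The increment `ξ^{(d)}(t, s) = ∑_{l=0}^d (-1)^l C(d,l) ξ(t - l s)` with step `s`. -/
def increment (d : ℕ) (s : ℝ) (ξ : ℝ → Lp ℂ 2 μ) (t : ℝ) : Lp ℂ 2 μ :=
  ∑ l ∈ Finset.range (d + 1), ((-1 : ℂ) ^ l * (d.choose l : ℂ)) • ξ (t - l * s)

/-- The component `ξ^{(d)}_{kj} = ⟨ξ^{(d)}_j, ẽ_k⟩` of the generated vector sequence, where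
`ξ^{(d)}_j(u) = ξ^{(d)}(u + jT, τT)`, `u ∈ [0,T)`. -/
def gen (d τ : ℕ) (T : ℝ) (ξ : ℝ → Lp ℂ 2 μ) (k : ℕ+) (j : ℤ) : Lp ℂ 2 μ :=
  fourierCoef T (fun u => increment d (τ * T) ξ (u + j * T)) k

/-- The class of processes whose increments `ξ^{(d)}(t, τT)` have mean zero, are periodically
correlated with period `T`, and satisfy `‖ξ^{(d)}_j‖²_H = ∫_0^T E|ξ^{(d)}(u + jT, τT)|² du ≤ P`
(by periodicity this quantity does not depend on `j`). -/
structure MemY (d τ : ℕ) (T P : ℝ) (ξ : ℝ → Lp ℂ 2 μ) : Prop where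
  aesm : AEStronglyMeasurable (increment d (τ * T) ξ) volume
  mean_zero : ∀ t : ℝ, ∫ ω, (increment d (τ * T) ξ t : Ω → ℂ) ω ∂μ = 0
  periodic : ∀ t s : ℝ,
    inner ℂ (increment d (τ * T) ξ (s + T)) (increment d (τ * T) ξ (t + T)) =
      inner ℂ (increment d (τ * T) ξ s) (increment d (τ * T) ξ t)
  bound : ∫⁻ u in Ico (0 : ℝ) T, ‖increment d (τ * T) ξ u‖ₑ ^ 2 ≤ ENNReal.ofReal P

/-- The closed linear span of `ξ^{(d)}_{kl}`, `k ≥ 1`, `l ≤ j`. -/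
def pastSpace (d τ : ℕ) (T : ℝ) (ξ : ℝ → Lp ℂ 2 μ) (j : ℤ) : Submodule ℂ (Lp ℂ 2 μ) :=
  (Submodule.span ℂ {x | ∃ (k : ℕ+) (l : ℤ), l ≤ j ∧ x = gen d τ T ξ k l}).topologicalClosure

/-- The generated sequence is regular: its remote past is trivial. -/
def IsRegular (d τ : ℕ) (T : ℝ) (ξ : ℝ → Lp ℂ 2 μ) : Prop :=
  ⨅ j : ℤ, pastSpace d τ T ξ j = ⊥

/-- The class `Y`. -/
def classY (μ : Measure Ω) (d τ : ℕ) (T P : ℝ) : Set (ℝ → Lp ℂ 2 μ) :=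
  {ξ | MemY d τ T P ξ}

/-- The class `Y_R` of the elements of `Y` with regular generated sequence. -/
def classYR (μ : Measure Ω) (d τ : ℕ) (T P : ℝ) : Set (ℝ → Lp ℂ 2 μ) :=
  {ξ | MemY d τ T P ξ ∧ IsRegular d τ T ξ}

/-- The elements of `Y` whose increment process is mean-square continuous. -/
def classYC (μ : Measure Ω) (d τ : ℕ) (T P : ℝ) : Set (ℝ → Lp ℂ 2 μ) :=
  {ξ | MemY d τ T P ξ ∧ Continuous (increment d (τ * T) ξ)}

/-- The functional `Bξ = ∫_0^∞ b(t) ξ^{(d)}(t, τT) dt` (a Bochner integral in `L²`). -/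
def functionalB (d τ : ℕ) (T : ℝ) (b : ℝ → ℂ) (ξ : ℝ → Lp ℂ 2 μ) : Lp ℂ 2 μ :=
  ∫ t in Ioi (0 : ℝ), b t • increment d (τ * T) ξ t

/-! ### Linear estimates and their mean-square errors -/

/-- A finite linear rule: finitely many coefficients `c_{kj}`, `k ≥ 1`, `j < 0`. -/
abbrev FiniteRule : Type := (ℕ+ × {j : ℤ // j < 0}) →₀ ℂ

/-- The value `∑ c_{kj} ξ^{(d)}_{kj}` of a finite linear rule. -/
def FiniteRule.apply (d τ : ℕ) (T : ℝ) (c : FiniteRule) (ξ : ℝ → Lp ℂ 2 μ) : Lp ℂ 2 μ :=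
  c.sum fun i x => x • gen d τ T ξ i.1 i.2

/-- The set `Λ` of linear estimates: a linear estimate is a mean-square limit of finite linear
rules, the rules not depending on the process to which they are applied. -/
abbrev LinearEstimate : Type := ℕ → FiniteRule

/-- `Z` is the value of the linear estimate `h` at the process `ξ`. -/
def LinearEstimate.IsValue (d τ : ℕ) (T : ℝ) (h : LinearEstimate) (ξ : ℝ → Lp ℂ 2 μ)
    (Z : Lp ℂ 2 μ) : Prop :=
  Tendsto (fun n => FiniteRule.apply d τ T (h n) ξ) atTop (𝓝 Z)

/-- The mean-square error `Δ(ξ, h) = E|Bξ - Z|²`, where `Z` is the value of `h` at `ξ`. There is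
at most one such `Z`; the error is `∞` if the estimate is not defined at `ξ`. -/
def mse (d τ : ℕ) (T : ℝ) (b : ℝ → ℂ) (ξ : ℝ → Lp ℂ 2 μ) (h : LinearEstimate) : ℝ≥0∞ :=
  ⨅ (Z : Lp ℂ 2 μ) (_ : LinearEstimate.IsValue d τ T h ξ Z), ‖functionalB d τ T b ξ - Z‖ₑ ^ 2

/-- `inf_h Δ(ξ, h)`, the error of the optimal linear estimate at `ξ`. -/
def minMse (d τ : ℕ) (T : ℝ) (b : ℝ → ℂ) (ξ : ℝ → Lp ℂ 2 μ) : ℝ≥0∞ :=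
  ⨅ h : LinearEstimate, mse d τ T b ξ h

/-- `sup_{ξ ∈ Y} Δ(ξ, h)`, the worst error of the linear estimate `h` over a class. -/
def maxMse (d τ : ℕ) (T : ℝ) (b : ℝ → ℂ) (Y : Set (ℝ → Lp ℂ 2 μ)) (h : LinearEstimate) : ℝ≥0∞ :=
  ⨆ ξ ∈ Y, mse d τ T b ξ h

/-- The mean-square error has a saddle point on `Y × Λ`, with value `v = min max = max min`. -/
structure HasSaddleValue (d τ : ℕ) (T : ℝ) (b : ℝ → ℂ) (Y : Set (ℝ → Lp ℂ 2 μ)) (v : ℝ≥0∞) :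
    Prop where
  saddle : ∃ ξ₀ ∈ Y, ∃ h₀ : LinearEstimate, mse d τ T b ξ₀ h₀ = v ∧
    (∀ ξ ∈ Y, mse d τ T b ξ h₀ ≤ mse d τ T b ξ₀ h₀) ∧
    (∀ h : LinearEstimate, mse d τ T b ξ₀ h₀ ≤ mse d τ T b ξ₀ h)
  min_attained : ∀ ξ ∈ Y, ∃ h : LinearEstimate, mse d τ T b ξ h = minMse d τ T b ξ
  min_max : IsLeast (range (maxMse d τ T b Y)) v
  max_min : IsGreatest (minMse d τ T b '' Y) v

/-- `ξ` is least favorable in `Y` for the optimal linear estimate of the functional. -/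
def IsLeastFavorable (d τ : ℕ) (T : ℝ) (b : ℝ → ℂ) (Y : Set (ℝ → Lp ℂ 2 μ))
    (ξ : ℝ → Lp ℂ 2 μ) : Prop :=
  ξ ∈ Y ∧ ∀ ξ' ∈ Y, minMse d τ T b ξ' ≤ minMse d τ T b ξ

/-- The generated sequence of `ξ` is the one-sided moving average
`ξ^{(d)}_{kj} = ∑_{p ≥ 0} ∑_{m=1}^M g_{km}(p) ε_m(j - p)`, where `ε` is an `M`-dimensional
orthonormal sequence with mean zero, `∑_m ‖g_m‖² = P`, and the columns `g_m = (g_{km}(p))_{p,k}`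
are left eigenvectors of `Q` for the eigenvalue `v`: `g_mᵀ Q = v g_mᵀ`, that is,
`Q (conj g_m) = v conj g_m` for self-adjoint `Q`. -/
def IsEigenMovingAverage (d τ : ℕ) (T P : ℝ) (Q : Ell2 →L[ℂ] Ell2) (v : ℝ) (M : ℕ)
    (ξ : ℝ → Lp ℂ 2 μ) : Prop :=
  ∃ (g : Fin M → Ell2) (ε : ℤ → Fin M → Lp ℂ 2 μ),
    (∀ m, Q (star (g m)) = (v : ℂ) • star (g m)) ∧
    ∑ m, ‖g m‖ ^ 2 = P ∧
    Orthonormal ℂ (fun i : ℤ × Fin M => ε i.1 i.2) ∧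
    (∀ s m, ∫ ω, (ε s m : Ω → ℂ) ω ∂μ = 0) ∧
    ∀ (k : ℕ+) (j : ℤ),
      HasSum (fun i : ℕ × Fin M => (g i.2 : ℕ × ℕ+ → ℂ) (i.1, k) • ε (j - i.1) i.2)
        (gen d τ T ξ k j)

end PCIncr

end

set_option linter.unusedSectionVars false

noncomputable section

namespace PCIncr

/-! ### Auxiliary facts on `ℓ²` spaces -/

section LpTwo

variable {ι : Type*} {G : ι → Type*} [∀ i, NormedAddCommGroup (G i)]

/-! Everything is governed by the Hankel operator `Γ = hankel β`, `(Γ v)_p = ∑_s v_s β_{s+p}`, of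
the coefficient vectors `β_j = b⃗_j`. The weighted summability makes `Γ` compact. Up to re-indexing,
`Q = Γ Γ†`, so `ν = ‖Γ‖` and `ν²` is the greatest eigenvalue. Fourier expansion over each period
turns the functional into the transfer function `β(z) = ∑ z^j β_j` evaluated at a stationary array
of total power at most `P`, and such an evaluation is bounded by `√P` times the supremum norm over
the circle (`norm_formEval_sq_le`, obtained from Parseval on finite cyclic groups instead of a
spectral measure).

Upper bound: a Nehari theorem with continuous approximant (`exists_negTrig_norm_sub_le`) gives `F`,
a uniform limit of trigonometric polynomials with negative frequencies, such that `‖β(z) - F(z)‖ ≤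
ν` on the circle. The approximating polynomials form one linear estimate, the same for all
processes, with error at most `P ν²`. To build `F`, let `Γ†Γ v = ν² v`, `w(z) = ∑ v_s z^{-s}` and
`g(z) = ∑ z^p (Γ v)_p`. The difference `w β - g` has negative frequencies only, and equality of
autocorrelations gives `‖g‖ = ν |w|` pointwise. If `1/w` lies in the closed algebra generated by
`z^{-1}`, then `F = (w β - g)/w` works, because `β - F = g/w`. Invertibility follows by Gelfand
theory from a maximizing `v` whose power series has no zero in the closed disc
(`exists_mem_hankelMax_zero_free`); the reproducing vector of the coordinate `0` in the space of
maximizing vectors is one.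

Lower bound: for a moving average with coefficients `g`, the inner products of the prediction error
with the innovations at times `s ≥ 0` are, up to conjugation, the coordinates of `Γ† (star g)`.
Bessel's inequality bounds the squared error below by `ν² ‖g‖² = P ν²` when `star g` is an
eigenvector. Such a process exists because every path is the increment of some process. Paths
vanishing at the ends of each period approximate it by continuous ones.

Converse: at a least favorable process every inequality above is an equality. Projecting onto the
span of shifted innovations splits the array into two stationary parts, each obeying the same bound,
so equality holds in each part (`IsExtremal.norm_sq_spanProj`). Hence every innovation has an
eigenvector of `Q` as coefficient family, compactness makes the innovation space finite dimensional,
and the part orthogonal to the innovations carries no error, hence no power. -/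

theorem lp_two_hasSum_norm_sq (f : lp G 2) : HasSum (fun i => ‖f i‖ ^ 2) (‖f‖ ^ 2) := by
  have h := lp.hasSum_norm (p := 2) (by norm_num) f
  simpa using h

theorem memlp_two_iff {f : ∀ i, G i} : Memℓp f 2 ↔ Summable fun i => ‖f i‖ ^ 2 := by
  have h := memℓp_gen_iff (p := 2) (by norm_num) (f := f)
  simpa using h

/-- The element of `ℓ²` with given square summable components. -/
def lpTwoMk (f : ∀ i, G i) (hf : Summable fun i => ‖f i‖ ^ 2) : lp G 2 :=
  ⟨f, memlp_two_iff.2 hf⟩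

@[simp] theorem lpTwoMk_apply (f : ∀ i, G i) (hf : Summable fun i => ‖f i‖ ^ 2) (i : ι) :
    lpTwoMk f hf i = f i := rfl

end LpTwo

theorem summable_sq_of_summable {ι : Type*} {a : ι → ℝ} (ha : ∀ i, 0 ≤ a i) (h : Summable a) :
    Summable fun i => a i ^ 2 := by
  have h1 : Memℓp a 1 := by
    rw [memℓp_gen_iff (by norm_num)]
    simpa [abs_of_nonneg (ha _)] using h
  have h2 := memlp_two_iff.1 (h1.of_exponent_ge (by norm_num : (1 : ℝ≥0∞) ≤ 2))
  simpa using h2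

/-- The antidiagonal of pairs with sum `n` has `n + 1` elements, which is exactly the weight. -/
theorem summable_add_index {a : ℕ → ℝ} (ha : ∀ j, 0 ≤ a j)
    (h : Summable fun j : ℕ => ((j : ℝ) + 1) * a j) :
    Summable fun i : ℕ × ℕ => a (i.1 + i.2) := by
  rw [← (Equiv.sigmaFiberEquiv fun i : ℕ × ℕ => i.1 + i.2).summable_iff]
  refine (summable_sigma_of_nonneg fun _ => ha _).2 ?_
  have hf : ∀ n : ℕ, {i : ℕ × ℕ // i.1 + i.2 = n} ≃ Finset.HasAntidiagonal.antidiagonal n := fun n =>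
    Equiv.subtypeEquivRight fun i => by simp
  have hfin : ∀ n : ℕ, Finite {i : ℕ × ℕ // i.1 + i.2 = n} := fun n => Finite.of_equiv _ (hf n).symm
  refine ⟨fun n => Summable.of_finite, h.congr fun n => ?_⟩
  have := Fintype.ofFinite {i : ℕ × ℕ // i.1 + i.2 = n}
  have h1 : ∀ i : {i : ℕ × ℕ // i.1 + i.2 = n},
      a (((Equiv.sigmaFiberEquiv fun i : ℕ × ℕ => i.1 + i.2) ⟨n, i⟩).1 +
        ((Equiv.sigmaFiberEquiv fun i : ℕ × ℕ => i.1 + i.2) ⟨n, i⟩).2) = a n := by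
    rintro ⟨i, hi⟩
    simp [Equiv.sigmaFiberEquiv, hi]
  rw [tsum_fintype]
  rw [Finset.sum_congr rfl fun i _ => h1 i, Finset.sum_const, Finset.card_univ,
    Fintype.card_congr (hf n), Fintype.card_coe, Finset.Nat.card_antidiagonal, nsmul_eq_mul]
  push_cast
  rfl

/-! ### Hankel operators with vector coefficients -/

section Hankel

/-- The space of square summable complex sequences. -/
abbrev SeqTwo : Type := lp (fun _ : ℕ => ℂ) 2

/-- The `n`-th vector of the standard basis. -/
abbrev stdVec (n : ℕ) : SeqTwo := lp.single 2 n (1 : ℂ)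

variable {V : Type*} [NormedAddCommGroup V] [InnerProductSpace ℂ V]

/-- The weighted summability of the coefficients of the symbol of a Hankel operator. -/
def IsSmoothSymbol (β : ℕ → V) : Prop := Summable fun j : ℕ => ((j : ℝ) + 1) * ‖β j‖

theorem IsSmoothSymbol.summable_prod {β : ℕ → V} (hβ : IsSmoothSymbol β) :
    Summable fun i : ℕ × ℕ => ‖β (i.1 + i.2)‖ :=
  summable_add_index (fun _ => norm_nonneg _) hβ

theorem IsSmoothSymbol.summable {β : ℕ → V} (hβ : IsSmoothSymbol β) :
    Summable fun j : ℕ => ‖β j‖ := by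
  refine Summable.of_nonneg_of_le (fun _ => norm_nonneg _) (fun j => ?_) hβ
  nlinarith [norm_nonneg (β j), (Nat.cast_nonneg j : (0 : ℝ) ≤ j)]

variable [CompleteSpace V]

/-- The Hankel operator `(Γ v)_p = ∑_s v_s β_{s+p}`. -/
def hankel (β : ℕ → V) : SeqTwo →L[ℂ] lp (fun _ : ℕ => V) 2 :=
  ∑' i : ℕ × ℕ, InnerProductSpace.rankOne ℂ (lp.single 2 i.2 (β (i.1 + i.2))) (stdVec i.1)

/-- The rank-one terms have norms `‖β (s + p)‖`, so the series converges in operator norm. This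
makes the `tsum` in the definition meaningful and the limit compact. -/
theorem hankel_hasSum {β : ℕ → V} (hβ : IsSmoothSymbol β) :
    HasSum (fun i : ℕ × ℕ => InnerProductSpace.rankOne ℂ
      (lp.single 2 i.2 (β (i.1 + i.2)) : lp (fun _ : ℕ => V) 2) (stdVec i.1)) (hankel β) := by
  refine (Summable.of_norm ?_).hasSum
  refine hβ.summable_prod.congr fun i => ?_
  rw [InnerProductSpace.norm_rankOne, lp.norm_single (by norm_num), lp.norm_single (by norm_num)]
  simp

theorem isCompactOperator_rankOne {E F : Type*} [NormedAddCommGroup E] [InnerProductSpace ℂ E]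
    [NormedAddCommGroup F] [InnerProductSpace ℂ F] (x : E) (y : F) :
    IsCompactOperator (InnerProductSpace.rankOne ℂ x y) := by
  rw [InnerProductSpace.rankOne_def']
  exact (isCompactOperator_of_locallyCompactSpace_rng
    (ContinuousLinearMap.toSpanSingleton ℂ x)).comp_clm (innerSL ℂ y)

theorem hankel_isCompactOperator {β : ℕ → V} (hβ : IsSmoothSymbol β) :
    IsCompactOperator (hankel β) := by
  refine isCompactOperator_of_tendsto (hankel_hasSum hβ) (Eventually.of_forall fun s => ?_)
  have hm : (∑ i ∈ s, InnerProductSpace.rankOne ℂ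
      (lp.single 2 i.2 (β (i.1 + i.2)) : lp (fun _ : ℕ => V) 2) (stdVec i.1)) ∈
      compactOperator (RingHom.id ℂ) SeqTwo (lp (fun _ : ℕ => V) 2) :=
    Submodule.sum_mem _ fun i _ => isCompactOperator_rankOne _ _
  exact hm

theorem hankel_hasSum_apply {β : ℕ → V} (hβ : IsSmoothSymbol β) (v : SeqTwo) (p : ℕ) :
    HasSum (fun s => v s • β (s + p)) (hankel β v p) := by
  have h := ((hankel_hasSum hβ).mapL
    (ContinuousLinearMap.apply ℂ (lp (fun _ : ℕ => V) 2) v)).mapL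
    (lp.evalCLM ℂ (fun _ : ℕ => V) 2 p)
  have hinj : Function.Injective (fun s : ℕ => (s, p)) := fun a b h => (Prod.mk.inj h).1
  rw [← hinj.hasSum_iff] at h
  · refine h.congr_fun ?_
    intro s
    simp [lp.inner_single_left, lp.evalCLM]
  · rintro ⟨s, q⟩ hq
    have hne : p ≠ q := fun h => hq ⟨s, by simp [h]⟩
    simp [lp.evalCLM, lp.single_apply, hne]

theorem hankel_stdVec_apply {β : ℕ → V} (hβ : IsSmoothSymbol β) (n p : ℕ) :
    hankel β (stdVec n) p = β (n + p) := by
  have h := hankel_hasSum_apply hβ (stdVec n) p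
  have h2 : HasSum (fun s => (stdVec n : SeqTwo) s • β (s + p)) (β (n + p)) := by
    convert hasSum_single n ?_ using 1
    · simp
    · intro s hs
      simp [lp.single_apply, hs]
  exact h.unique h2

/-- The right shift of a square summable sequence. -/
def shiftRight (w : SeqTwo) : SeqTwo :=
  lpTwoMk (fun n => Nat.casesOn n 0 fun m => w m) (by
    rw [← summable_nat_add_iff 1]
    exact (lp_two_hasSum_norm_sq w).summable)

/-- The left shift of a square summable sequence. -/
def shiftLeft (w : SeqTwo) : SeqTwo :=
  lpTwoMk (fun n => w (n + 1)) (by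
    have h := (lp_two_hasSum_norm_sq w).summable
    rwa [← summable_nat_add_iff 1] at h)

@[simp] theorem shiftRight_zero (w : SeqTwo) : shiftRight w 0 = 0 := rfl

@[simp] theorem shiftRight_succ (w : SeqTwo) (n : ℕ) : shiftRight w (n + 1) = w n := rfl

@[simp] theorem shiftLeft_apply (w : SeqTwo) (n : ℕ) : shiftLeft w n = w (n + 1) := rfl

theorem shiftRight_shiftLeft {w : SeqTwo} (hw : w 0 = 0) : shiftRight (shiftLeft w) = w := by
  apply lp.ext
  funext n
  cases n <;> simp [hw]

theorem inner_stdVec (n : ℕ) (w : SeqTwo) : inner ℂ (stdVec n) w = w n := by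
  rw [lp.inner_single_left]; simp

theorem norm_shiftRight (w : SeqTwo) : ‖shiftRight w‖ = ‖w‖ := by
  have h1 := lp_two_hasSum_norm_sq (shiftRight w)
  rw [← hasSum_nat_add_iff' 1] at h1
  have h2 := h1.unique (lp_two_hasSum_norm_sq w)
  simp at h2
  exact h2

/-- The Hankel structure: a right shift of the argument is a left shift of the value, so only the
coordinate `0` of the value is lost. -/
theorem hankel_shiftRight {β : ℕ → V} (hβ : IsSmoothSymbol β) (w : SeqTwo) (p : ℕ) :
    hankel β (shiftRight w) p = hankel β w (p + 1) := by
  have h1 := hankel_hasSum_apply hβ (shiftRight w) p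
  rw [← hasSum_nat_add_iff' 1] at h1
  have h2 := hankel_hasSum_apply hβ w (p + 1)
  have h3 := h1.unique (h2.congr_fun fun s => by
    rw [shiftRight_succ, add_right_comm s 1 p, add_assoc])
  simpa using h3

theorem inner_hankel_shiftRight {β : ℕ → V} (hβ : IsSmoothSymbol β) (v w : SeqTwo) :
    inner ℂ (hankel β v) (hankel β w) = inner ℂ (hankel β v 0) (hankel β w 0) +
      inner ℂ (hankel β (shiftRight v)) (hankel β (shiftRight w)) := by
  have h1 := lp.hasSum_inner (𝕜 := ℂ) (hankel β v) (hankel β w)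
  rw [← hasSum_nat_add_iff' 1] at h1
  have h2 := lp.hasSum_inner (𝕜 := ℂ) (hankel β (shiftRight v)) (hankel β (shiftRight w))
  simp only [hankel_shiftRight hβ] at h2
  have h3 := h1.unique h2
  rw [← h3]; simp

theorem shiftRight_stdVec (n : ℕ) : shiftRight (stdVec n) = stdVec (n + 1) := by
  apply lp.ext
  funext m
  cases m with
  | zero => simp [lp.single_apply]
  | succ m => simp [lp.single_apply, Pi.single_apply]

end Hankel

/-! ### Maximizing vectors of an operator -/

section Maximizing

variable {E F : Type*} [NormedAddCommGroup E] [InnerProductSpace ℂ E] [CompleteSpace E]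
  [NormedAddCommGroup F] [InnerProductSpace ℂ F] [CompleteSpace F]

/-- Expanding `‖A†A u - ‖A‖² u‖²` and using `‖A†A u‖ ≤ ‖A‖² ‖u‖` leaves a quantity at most `0`. -/
theorem adjoint_apply_eq_of_norm_eq (A : E →L[ℂ] F) {u : E} (h : ‖A u‖ = ‖A‖ * ‖u‖) :
    A.adjoint (A u) = ((‖A‖ : ℂ) ^ 2) • u := by
  rw [← sub_eq_zero, ← norm_eq_zero, ← sq_eq_zero_iff]
  refine le_antisymm ?_ (sq_nonneg _)
  rw [@norm_sub_sq ℂ, inner_smul_right, ContinuousLinearMap.adjoint_inner_left,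
    inner_self_eq_norm_sq_to_K, norm_smul]
  have h1 : ‖A.adjoint (A u)‖ ≤ ‖A‖ * ‖A u‖ := by
    simpa using A.adjoint.le_opNorm (A u)
  have h2 : ‖A.adjoint (A u)‖ ^ 2 ≤ (‖A‖ * ‖A u‖) ^ 2 :=
    pow_le_pow_left₀ (norm_nonneg _) h1 2
  have h3 : RCLike.re ((‖A‖ : ℂ) ^ 2 * ((‖A u‖ : ℝ) : ℂ) ^ 2) = ‖A‖ ^ 2 * ‖A u‖ ^ 2 := by
    rw [← Complex.ofReal_pow, ← Complex.ofReal_pow, ← Complex.ofReal_mul]; rfl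
  have h4 : ‖((‖A‖ : ℂ) ^ 2)‖ = ‖A‖ ^ 2 := by simp
  erw [h3]
  rw [h4]
  rw [h] at h2 ⊢
  nlinarith

theorem norm_eq_of_adjoint_apply_eq (A : E →L[ℂ] F) {u : E} {r : ℝ} (hr : 0 ≤ r)
    (h : A.adjoint (A u) = ((r : ℂ) ^ 2) • u) : ‖A u‖ = r * ‖u‖ := by
  have h1 : inner ℂ u (A.adjoint (A u)) = inner ℂ (A u) (A u) :=
    ContinuousLinearMap.adjoint_inner_right _ _ _
  rw [h, inner_smul_right, inner_self_eq_norm_sq_to_K, inner_self_eq_norm_sq_to_K] at h1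
  have h2 : r ^ 2 * ‖u‖ ^ 2 = ‖A u‖ ^ 2 := by
    apply Complex.ofReal_injective
    push_cast
    exact h1
  rw [← mul_pow] at h2
  exact ((pow_left_inj₀ (by positivity) (by positivity) two_ne_zero).1 h2).symm

/-- The self-adjoint operator `A†A` has spectral radius `‖A‖²`. A spectral value of that modulus is
nonzero, hence an eigenvalue by compactness. -/
theorem exists_norm_eq_of_isCompactOperator (A : E →L[ℂ] F) (hA : A ≠ 0)
    (hc : IsCompactOperator (A.adjoint ∘L A)) : ∃ u : E, u ≠ 0 ∧ ‖A u‖ = ‖A‖ * ‖u‖ := by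
  have hn : 0 < ‖A‖ := norm_pos_iff.2 hA
  have : Nontrivial E := by
    by_contra hE
    rw [not_nontrivial_iff_subsingleton] at hE
    exact hA (Subsingleton.elim _ _)
  set T : E →L[ℂ] E := A.adjoint ∘L A with hT
  have hsa : IsSelfAdjoint T := by
    rw [ContinuousLinearMap.isSelfAdjoint_iff', hT, ContinuousLinearMap.adjoint_comp,
      ContinuousLinearMap.adjoint_adjoint]
  have hnT : ‖T‖ = ‖A‖ * ‖A‖ := ContinuousLinearMap.norm_adjoint_comp_self A
  obtain ⟨k, hk, hk2⟩ := spectrum.exists_nnnorm_eq_spectralRadius T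
  rw [hsa.spectralRadius_eq_nnnorm] at hk2
  have hk3 : ‖k‖ = ‖A‖ * ‖A‖ := by
    rw [← hnT]; exact congrArg NNReal.toReal (ENNReal.coe_inj.1 hk2)
  have hk0 : k ≠ 0 := by rw [← norm_pos_iff, hk3]; positivity
  have hev := (IsCompactOperator.hasEigenvalue_iff_mem_spectrum hc hk0).2 hk
  obtain ⟨u, hu⟩ := hev.exists_hasEigenvector
  refine ⟨u, hu.2, ?_⟩
  have h0 : A.adjoint (A u) = k • u := hu.apply_eq_smul
  have h1 : inner ℂ u (A.adjoint (A u)) = inner ℂ (A u) (A u) :=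
    ContinuousLinearMap.adjoint_inner_right _ _ _
  rw [h0, inner_smul_right] at h1
  -- Only the modulus of the eigenvalue `k` is known, so norms are compared.
  have h2 := congrArg norm h1
  rw [norm_mul, inner_self_eq_norm_sq_to_K, inner_self_eq_norm_sq_to_K, hk3] at h2
  simp only [norm_pow, RCLike.norm_ofReal, abs_norm] at h2
  have h3 : (‖A‖ * ‖u‖) ^ 2 = ‖A u‖ ^ 2 := by rw [← h2]; ring
  exact ((pow_left_inj₀ (by positivity) (by positivity) two_ne_zero).1 h3).symm

end Maximizing

/-! ### Maximizing vectors of Hankel operators -/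

section HankelMax

variable {V : Type*} [NormedAddCommGroup V] [InnerProductSpace ℂ V] [CompleteSpace V]

/-- The space of maximizing vectors of a Hankel operator. -/
def hankelMax (β : ℕ → V) : Submodule ℂ SeqTwo :=
  LinearMap.ker ((((‖hankel β‖ : ℂ) ^ 2) • ContinuousLinearMap.id ℂ SeqTwo -
    (hankel β).adjoint ∘L hankel β : SeqTwo →L[ℂ] SeqTwo) : SeqTwo →ₗ[ℂ] SeqTwo)

theorem mem_hankelMax_iff {β : ℕ → V} {v : SeqTwo} :
    v ∈ hankelMax β ↔ (hankel β).adjoint (hankel β v) = ((‖hankel β‖ : ℂ) ^ 2) • v := by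
  simp only [hankelMax, LinearMap.mem_ker, ContinuousLinearMap.coe_coe,
    sub_apply, smul_apply, ContinuousLinearMap.id_apply,
    ContinuousLinearMap.comp_apply, sub_eq_zero]
  exact eq_comm

theorem mem_hankelMax_iff_norm {β : ℕ → V} {v : SeqTwo} :
    v ∈ hankelMax β ↔ ‖hankel β v‖ = ‖hankel β‖ * ‖v‖ :=
  ⟨fun h => norm_eq_of_adjoint_apply_eq _ (norm_nonneg (hankel β)) (mem_hankelMax_iff.1 h),
    fun h => mem_hankelMax_iff.2 (adjoint_apply_eq_of_norm_eq _ h)⟩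

theorem isClosed_hankelMax (β : ℕ → V) : IsClosed (hankelMax β : Set SeqTwo) :=
  ContinuousLinearMap.isClosed_ker (((‖hankel β‖ : ℂ) ^ 2) • ContinuousLinearMap.id ℂ SeqTwo -
    (hankel β).adjoint ∘L hankel β)

theorem hankelMax_ne_bot {β : ℕ → V} (hβ : IsSmoothSymbol β) (h0 : hankel β ≠ 0) :
    hankelMax β ≠ ⊥ := by
  have hc : IsCompactOperator ((hankel β).adjoint ∘L hankel β) :=
    (hankel_isCompactOperator hβ).clm_comp (hankel β).adjoint
  obtain ⟨u, hu, hu2⟩ := exists_norm_eq_of_isCompactOperator _ h0 hc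
  exact (Submodule.ne_bot_iff _).2 ⟨u, mem_hankelMax_iff_norm.2 hu2, hu⟩

theorem norm_sq_hankel {β : ℕ → V} (hβ : IsSmoothSymbol β) (w : SeqTwo) :
    ‖hankel β w‖ ^ 2 = ‖hankel β w 0‖ ^ 2 + ‖hankel β (shiftRight w)‖ ^ 2 := by
  have h := inner_hankel_shiftRight hβ w w
  simp only [inner_self_eq_norm_sq_to_K] at h
  apply Complex.ofReal_injective
  push_cast
  exact h

/-- When `u 0 = 0`, deleting that coordinate keeps `‖u‖` and can only enlarge `‖Γ u‖`, by the extra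
coordinate `0` in `norm_sq_hankel`. -/
theorem shiftLeft_mem_hankelMax {β : ℕ → V} (hβ : IsSmoothSymbol β) {u : SeqTwo}
    (hu : u ∈ hankelMax β) (h0 : u 0 = 0) : shiftLeft u ∈ hankelMax β := by
  rw [mem_hankelMax_iff_norm] at hu ⊢
  have h1 := norm_sq_hankel hβ (shiftLeft u)
  have h2 : ‖shiftLeft u‖ = ‖u‖ := by rw [← norm_shiftRight, shiftRight_shiftLeft h0]
  rw [shiftRight_shiftLeft h0, hu, ← h2] at h1
  have h3 := (hankel β).le_opNorm (shiftLeft u)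
  refine le_antisymm h3 ?_
  refine le_of_sq_le_sq ?_ (norm_nonneg _)
  nlinarith [sq_nonneg ‖hankel β (shiftLeft u) 0‖]

/-- If all coordinates `0` vanished, repeated left shifts would make every coordinate vanish. -/
theorem exists_mem_hankelMax_zero_ne {β : ℕ → V} (hβ : IsSmoothSymbol β)
    (hE : hankelMax β ≠ ⊥) : ∃ u ∈ hankelMax β, u 0 ≠ 0 := by
  by_contra! hcon
  have h : ∀ n : ℕ, ∀ u ∈ hankelMax β, u n = 0 := by
    intro n
    induction n with
    | zero => exact hcon
    | succ n ih => exact fun u hu => ih _ (shiftLeft_mem_hankelMax hβ hu (hcon u hu))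
  refine hE ((Submodule.eq_bot_iff _).2 fun u hu => ?_)
  apply lp.ext
  funext n
  exact h n u hu

/-- The defect `ν² - Γ†Γ` of a Hankel operator. -/
def hankelDefect (β : ℕ → V) (w : SeqTwo) : SeqTwo :=
  ((‖hankel β‖ : ℂ) ^ 2) • w - (hankel β).adjoint (hankel β w)

theorem inner_hankelDefect (β : ℕ → V) (v w : SeqTwo) :
    inner ℂ v (hankelDefect β w) =
      (‖hankel β‖ : ℂ) ^ 2 * inner ℂ v w - inner ℂ (hankel β v) (hankel β w) := by
  rw [hankelDefect, inner_sub_right, inner_smul_right, ContinuousLinearMap.adjoint_inner_right]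

theorem hankelDefect_inner (β : ℕ → V) (v w : SeqTwo) :
    inner ℂ (hankelDefect β v) w = inner ℂ v (hankelDefect β w) := by
  rw [inner_hankelDefect, hankelDefect, inner_sub_left, inner_smul_left,
    ContinuousLinearMap.adjoint_inner_left]
  simp

/-- With `D = ν² - Γ†Γ ≥ 0`, `S` the right shift and `D w = α D S w`, the Hankel identity gives
`⟨Sw, D S w⟩ = ⟨w, D w⟩ + ‖(Γ w)_0‖²`. Since `|α| ≥ 1` this forces `(Γ w)_0 = 0`, and then `D w`
satisfies a recursion incompatible with square summability unless it is zero. In terms of power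
series, a factor `1 - α z` with root in the closed disc may be divided out of a maximizing vector.
-/
theorem mem_hankelMax_of_sub_smul_shiftRight {β : ℕ → V} (hβ : IsSmoothSymbol β) {w : SeqTwo}
    {α : ℂ} (hα : 1 ≤ ‖α‖) (hw : w - α • shiftRight w ∈ hankelMax β) : w ∈ hankelMax β := by
  have hD : hankelDefect β w = α • hankelDefect β (shiftRight w) := by
    have h := mem_hankelMax_iff.1 hw
    simp only [map_sub, map_smul, smul_sub] at h
    simp only [hankelDefect, smul_sub]
    rw [smul_comm α]
    rw [sub_eq_sub_iff_add_eq_add] at h ⊢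
    rw [add_comm _ ((hankel β).adjoint (hankel β w)), h]
  have hq : ∀ x : SeqTwo, inner ℂ x (hankelDefect β x) =
      ((‖hankel β‖ ^ 2 * ‖x‖ ^ 2 - ‖hankel β x‖ ^ 2 : ℝ) : ℂ) := by
    intro x
    rw [inner_hankelDefect, inner_self_eq_norm_sq_to_K, inner_self_eq_norm_sq_to_K]
    push_cast; rfl
  have h1 : inner ℂ w (hankelDefect β w) =
      α * conj α * inner ℂ (shiftRight w) (hankelDefect β (shiftRight w)) := by
    rw [hD, inner_smul_right, ← hankelDefect_inner, hD, inner_smul_left, hankelDefect_inner]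
    ring
  rw [hq, hq, Complex.mul_conj, Complex.normSq_eq_norm_sq, ← Complex.ofReal_mul,
    Complex.ofReal_inj, norm_shiftRight] at h1
  have h2 := norm_sq_hankel hβ w
  have h3 : ‖hankel β w‖ ^ 2 ≤ ‖hankel β‖ ^ 2 * ‖w‖ ^ 2 := by
    rw [← mul_pow]; exact pow_le_pow_left₀ (norm_nonneg _) ((hankel β).le_opNorm w) 2
  have h4 : 1 ≤ ‖α‖ ^ 2 := one_le_pow₀ hα
  have h5 : ‖hankel β w 0‖ ^ 2 = 0 := by
    nlinarith [sq_nonneg ‖hankel β w 0‖, sq_nonneg ‖hankel β (shiftRight w)‖]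
  have h6 : hankel β w 0 = 0 := norm_eq_zero.1 (sq_eq_zero_iff.1 h5)
  -- As `(Γ w)_0 = 0`, the defect commutes with the right shift at `w`, apart from the coordinate
  -- `0`; combined with `hD` this is a geometric recursion.
  have h7 : ∀ n, hankelDefect β w (n + 1) = α * hankelDefect β w n := by
    intro n
    have h8 : hankelDefect β w (n + 1) = α * hankelDefect β (shiftRight w) (n + 1) := by
      conv_lhs => rw [hD]
      simp
    rw [h8, ← inner_stdVec (n + 1), ← inner_stdVec n, inner_hankelDefect, inner_hankelDefect,
      inner_hankel_shiftRight hβ (stdVec n) w, h6, shiftRight_stdVec, inner_stdVec, inner_stdVec]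
    simp
  have h9 : hankelDefect β w = 0 := by
    apply lp.ext
    funext n
    -- The moduli do not decrease along the recursion, but they tend to `0`.
    have h10 : ∀ m, ‖hankelDefect β w n‖ ≤ ‖hankelDefect β w (m + n)‖ := by
      intro m
      induction m with
      | zero => simp
      | succ m ih =>
        rw [add_right_comm, h7, norm_mul]
        nlinarith [norm_nonneg (hankelDefect β w (m + n))]
    have h11 := (lp_two_hasSum_norm_sq (hankelDefect β w)).summable.tendsto_atTop_zero
    have h12 := (tendsto_add_atTop_iff_nat n).2 h11
    have h13 : ‖hankelDefect β w n‖ ^ 2 ≤ 0 :=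
      ge_of_tendsto' h12 fun m => pow_le_pow_left₀ (norm_nonneg _) (h10 m) 2
    have h14 : ‖hankelDefect β w n‖ = 0 := by nlinarith [norm_nonneg (hankelDefect β w n)]
    simpa using h14
  rw [mem_hankelMax_iff]
  rw [hankelDefect, sub_eq_zero] at h9
  exact h9.symm

/-! ### Smoothness of the maximizing vectors -/

/-- Pairing `Γ†Γ v = ν² v` with a standard basis vector expresses `v s` through `β`, so that the
decay of `β` passes to `v`. -/
theorem mul_coord_of_mem_hankelMax {β : ℕ → V} (hβ : IsSmoothSymbol β) {v : SeqTwo}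
    (hv : v ∈ hankelMax β) (s : ℕ) :
    HasSum (fun p => inner ℂ (β (s + p)) (hankel β v p)) ((‖hankel β‖ : ℂ) ^ 2 * v s) := by
  have h := lp.hasSum_inner (𝕜 := ℂ) (hankel β (stdVec s)) (hankel β v)
  rw [← ContinuousLinearMap.adjoint_inner_right, mem_hankelMax_iff.1 hv, inner_smul_right,
    inner_stdVec] at h
  simpa only [hankel_stdVec_apply hβ] using h

theorem summable_hankel_apply {β : ℕ → V} (hβ : IsSmoothSymbol β) (v : SeqTwo) :
    Summable fun p => ‖hankel β v p‖ := by
  have h1 : Summable fun i : ℕ × ℕ => ‖v i.1 • β (i.1 + i.2)‖ := by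
    refine Summable.of_nonneg_of_le (fun _ => norm_nonneg _) (fun i => ?_)
      (hβ.summable_prod.mul_left ‖v‖)
    rw [norm_smul]
    exact mul_le_mul_of_nonneg_right (lp.norm_apply_le_norm (by norm_num) v i.1) (norm_nonneg _)
  have h2 := ((Equiv.prodComm ℕ ℕ).summable_iff.2 h1).prod
  refine Summable.of_nonneg_of_le (fun _ => norm_nonneg _) (fun p => ?_) h2
  rw [← (hankel_hasSum_apply hβ v p).tsum_eq]
  exact norm_tsum_le_tsum_norm (((Equiv.prodComm ℕ ℕ).summable_iff.2 h1).prod_factor p)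

/-- In `ν² v_s = ∑_p ⟨β_{s+p}, (Γ v)_p⟩` the values `(Γ v)_p` are absolutely summable, and the
weight `s + 1` is at most the weight `s + p + 1` of `β_{s+p}`. -/
theorem summable_weighted_coord {β : ℕ → V} (hβ : IsSmoothSymbol β) (h0 : hankel β ≠ 0)
    {v : SeqTwo} (hv : v ∈ hankelMax β) : Summable fun s : ℕ => ((s : ℝ) + 1) * ‖v s‖ := by
  have hν : 0 < ‖hankel β‖ := norm_pos_iff (a := hankel β).2 h0
  have hg := summable_hankel_apply hβ v
  set a : ℕ → ℝ := fun j => ((j : ℝ) + 1) * ‖β j‖ with ha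
  have ha0 : ∀ j, 0 ≤ a j := fun j => by positivity
  have ha1 : Summable a := hβ
  have h1 : Summable fun i : ℕ × ℕ => ‖hankel β v i.1‖ * a i.2 :=
    Summable.mul_of_nonneg hg ha1 (fun p => norm_nonneg (hankel β v p)) ha0
  -- The product series restricted to the pairs `(p, s + p)`.
  have h2 : Summable fun i : ℕ × ℕ => ‖hankel β v i.1‖ * a (i.2 + i.1) := by
    have hinj : Function.Injective (fun i : ℕ × ℕ => (i.1, i.2 + i.1)) := by
      rintro ⟨p, s⟩ ⟨q, t⟩ h
      simp only [Prod.mk.injEq] at h ⊢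
      omega
    have h := h1.comp_injective hinj
    simpa only [Function.comp_def] using h
  have h3 := (((Equiv.prodComm ℕ ℕ).summable_iff.2 h2).prod).mul_left ((‖hankel β‖ ^ 2)⁻¹)
  refine Summable.of_nonneg_of_le (fun _ => by positivity) (fun s => ?_) h3
  have h4 := mul_coord_of_mem_hankelMax hβ hv s
  have h5 : Summable fun p => ‖hankel β v p‖ * a (s + p) :=
    ((Equiv.prodComm ℕ ℕ).summable_iff.2 h2).prod_factor s
  have h6 : ∀ p, ((s : ℝ) + 1) * ‖inner ℂ (β (s + p)) (hankel β v p)‖ ≤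
      ‖hankel β v p‖ * a (s + p) := by
    intro p
    have h7 := norm_inner_le_norm (𝕜 := ℂ) (β (s + p)) (hankel β v p)
    calc ((s : ℝ) + 1) * ‖inner ℂ (β (s + p)) (hankel β v p)‖
        ≤ ((s : ℝ) + p + 1) * (‖β (s + p)‖ * ‖hankel β v p‖) := by
          gcongr
          linarith [(Nat.cast_nonneg p : (0 : ℝ) ≤ p)]
      _ = _ := by simp only [ha]; push_cast; ring
  have h7 : Summable fun p => ((s : ℝ) + 1) * ‖inner ℂ (β (s + p)) (hankel β v p)‖ :=
    Summable.of_nonneg_of_le (fun _ => by positivity) h6 h5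
  have h8 : Summable fun p => ‖inner ℂ (β (s + p)) (hankel β v p)‖ :=
    (summable_mul_left_iff (by positivity)).1 h7
  have h9 : ‖hankel β‖ ^ 2 * ‖v s‖ ≤ ∑' p, ‖inner ℂ (β (s + p)) (hankel β v p)‖ := by
    have h10 := norm_tsum_le_tsum_norm h8
    rw [h4.tsum_eq] at h10
    simpa using h10
  have h11 : ((s : ℝ) + 1) * ∑' p, ‖inner ℂ (β (s + p)) (hankel β v p)‖ ≤
      ∑' p, ‖hankel β v p‖ * a (s + p) := by
    rw [← tsum_mul_left]
    exact h7.tsum_le_tsum h6 h5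
  rw [inv_mul_eq_div, le_div_iff₀ (by positivity)]
  calc ((s : ℝ) + 1) * ‖v s‖ * ‖hankel β‖ ^ 2 = ((s : ℝ) + 1) * (‖hankel β‖ ^ 2 * ‖v s‖) := by ring
    _ ≤ ((s : ℝ) + 1) * ∑' p, ‖inner ℂ (β (s + p)) (hankel β v p)‖ := by gcongr
    _ ≤ _ := h11

/-! ### A maximizing vector without zeros in the closed disc -/

/-- Division of the power series of `v` by `1 - z/a` at a zero `a`. Since `a` may lie on the unit
circle, square summability of the quotient needs the weighted summability of `v`. -/
theorem exists_sub_smul_shiftRight {v : SeqTwo}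
    (hv : Summable fun s : ℕ => ((s : ℝ) + 1) * ‖v s‖) {a : ℂ} (ha : ‖a‖ ≤ 1) (ha0 : a ≠ 0)
    (hz : ∑' s, a ^ s * v s = 0) : ∃ w : SeqTwo, v = w - a⁻¹ • shiftRight w := by
  have h1 : Summable fun i : ℕ × ℕ => ‖v (i.1 + i.2)‖ := summable_add_index (fun _ => norm_nonneg _) hv
  have hs : ∀ n, Summable fun i => ‖v (n + i)‖ := fun n => h1.prod_factor n
  have hle : ∀ n i, ‖a ^ i * v (n + i)‖ ≤ ‖v (n + i)‖ := by
    intro n i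
    rw [norm_mul, norm_pow]
    exact mul_le_of_le_one_left (norm_nonneg _) (pow_le_one₀ (norm_nonneg _) ha)
  have hs2 : ∀ n, Summable fun i => a ^ i * v (n + i) := fun n =>
    Summable.of_norm_bounded (hs n) (hle n)
  set t : ℕ → ℂ := fun n => ∑' i, a ^ i * v (n + i) with ht
  have ht1 : ∀ n, t n = v n + a * t (n + 1) := by
    intro n
    simp only [ht]
    rw [(hs2 n).tsum_eq_zero_add, ← tsum_mul_left]
    simp only [pow_zero, one_mul, add_zero]
    congr 1
    refine tsum_congr fun i => ?_
    rw [pow_succ, add_right_comm n 1 i]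
    rw [← add_assoc]; ring
  have ht0 : t 0 = 0 := by
    simpa [ht] using hz
  have hts : Summable fun n => ‖t n‖ := by
    refine Summable.of_nonneg_of_le (fun _ => norm_nonneg _) (fun n => ?_) h1.prod
    exact (norm_tsum_le_tsum_norm ((hs n).of_nonneg_of_le (fun _ => norm_nonneg _) (hle n))).trans
      (((hs n).of_nonneg_of_le (fun _ => norm_nonneg _) (hle n)).tsum_le_tsum (hle n) (hs n))
  have hts2 : Summable fun n => ‖-(a * t (n + 1))‖ ^ 2 := by
    refine summable_sq_of_summable (fun _ => norm_nonneg _) ?_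
    simp only [norm_neg, norm_mul]
    exact ((summable_nat_add_iff 1).2 hts).mul_left _
  refine ⟨lpTwoMk (fun n => -(a * t (n + 1))) hts2, ?_⟩
  apply lp.ext
  funext n
  cases n with
  | zero =>
    have := ht1 0
    rw [ht0] at this
    simp only [lp.coeFn_sub, lp.coeFn_smul, Pi.sub_apply, Pi.smul_apply, shiftRight_zero,
      lpTwoMk_apply, smul_eq_mul]
    linear_combination -this
  | succ n =>
    have := ht1 (n + 1)
    simp only [lp.coeFn_sub, lp.coeFn_smul, Pi.sub_apply, Pi.smul_apply, shiftRight_succ,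
      lpTwoMk_apply, smul_eq_mul]
    field_simp
    linear_combination -this

/-- The witness represents the coordinate `0` on the space of maximizing vectors. A zero `a` would
give `v = w - a⁻¹ S w` with `S` the right shift and both `w` and `a⁻¹ S w` maximizing. The latter
has coordinate `0` equal to zero, hence is orthogonal to `v`, and Pythagoras gives `‖w‖² = ‖v‖² +
|a|⁻² ‖w‖²`, impossible for `|a| ≤ 1`. -/
theorem exists_mem_hankelMax_zero_free {β : ℕ → V} (hβ : IsSmoothSymbol β)
    (h0 : hankel β ≠ 0) : ∃ v ∈ hankelMax β, ∀ a : ℂ, ‖a‖ ≤ 1 → ∑' s, a ^ s * v s ≠ 0 := by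
  have hcl := isClosed_hankelMax β
  have : CompleteSpace (hankelMax β) := hcl.completeSpace_coe
  set v : SeqTwo := (hankelMax β).starProjection (stdVec 0) with hv
  have hvm : v ∈ hankelMax β := Submodule.starProjection_apply_mem _ _
  have hvu : ∀ u ∈ hankelMax β, inner ℂ v u = u 0 := by
    intro u hu
    rw [hv, Submodule.inner_starProjection_left_eq_right,
      Submodule.starProjection_eq_self_iff.2 hu, inner_stdVec]
  have hv0 : v 0 = ((‖v‖ ^ 2 : ℝ) : ℂ) := by
    rw [← hvu v hvm, inner_self_eq_norm_sq_to_K]; push_cast; rfl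
  have hvne : v ≠ 0 := by
    intro hz
    obtain ⟨u, hu, hu0⟩ := exists_mem_hankelMax_zero_ne hβ (hankelMax_ne_bot hβ h0)
    apply hu0
    rw [← hvu u hu, hz, inner_zero_left]
  refine ⟨v, hvm, fun a ha hz => ?_⟩
  rcases eq_or_ne a 0 with rfl | ha0
  · rw [tsum_eq_single 0 (by intro s hs; simp [hs])] at hz
    rw [pow_zero, one_mul, hv0] at hz
    exact hvne (by simpa using hz)
  · obtain ⟨w, hw⟩ := exists_sub_smul_shiftRight (summable_weighted_coord hβ h0 hvm) ha ha0 hz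
    have hα : 1 ≤ ‖a⁻¹‖ := by
      rw [norm_inv]; exact (one_le_inv₀ (norm_pos_iff.2 ha0)).2 ha
    have hwm : w ∈ hankelMax β := mem_hankelMax_of_sub_smul_shiftRight hβ hα (hw ▸ hvm)
    have hSm : a⁻¹ • shiftRight w ∈ hankelMax β := by
      have : a⁻¹ • shiftRight w = w - v := by rw [hw]; abel
      rw [this]; exact Submodule.sub_mem _ hwm hvm
    have h1 : inner ℂ v (a⁻¹ • shiftRight w) = 0 := by
      rw [hvu _ hSm]; simp
    have h2 : ‖w‖ ^ 2 = ‖v‖ ^ 2 + ‖a⁻¹ • shiftRight w‖ ^ 2 := by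
      have h3 : w = v + a⁻¹ • shiftRight w := by
        conv_lhs => rw [← sub_add_cancel w (a⁻¹ • shiftRight w), ← hw]
      conv_lhs => rw [h3]
      have := norm_add_sq_eq_norm_sq_add_norm_sq_of_inner_eq_zero (𝕜 := ℂ) v (a⁻¹ • shiftRight w) h1
      rw [sq, sq, sq]; exact this
    rw [norm_smul, norm_shiftRight, mul_pow] at h2
    have h4 : 1 ≤ ‖a⁻¹‖ ^ 2 := one_le_pow₀ hα
    have h5 : 0 < ‖v‖ ^ 2 := by have := norm_pos_iff.2 hvne; positivity
    nlinarith [sq_nonneg ‖w‖]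

end HankelMax

/-! ### Absolutely convergent trigonometric series on the circle -/

section Trig

variable {V : Type*} [NormedAddCommGroup V] [InnerProductSpace ℂ V]

theorem conj_zpow_mul_zpow (z : Circle) (n m : ℤ) :
    conj ((z : ℂ) ^ n) * (z : ℂ) ^ m = (z : ℂ) ^ (m - n) := by
  rw [map_zpow₀, ← Circle.coe_inv_eq_conj, Circle.coe_inv, inv_zpow, ← zpow_neg,
    ← zpow_add₀ (Circle.coe_ne_zero z)]
  congr 1; ring

theorem norm_zpow_circle (z : Circle) (n : ℤ) : ‖(z : ℂ) ^ n‖ = 1 := by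
  rw [norm_zpow, Circle.norm_coe, one_zpow]

/-- The trigonometric monomial `z ↦ z ^ n • a` on the circle. -/
def trigMono (n : ℤ) (a : V) : C(Circle, V) where
  toFun z := (z : ℂ) ^ n • a
  continuous_toFun := by
    refine Continuous.smul ?_ continuous_const
    exact continuous_iff_continuousAt.2 fun z =>
      (continuous_subtype_val.continuousAt (x := z)).zpow₀ n (Or.inl (Circle.coe_ne_zero z))

@[simp] theorem trigMono_apply (n : ℤ) (a : V) (z : Circle) :
    trigMono n a z = (z : ℂ) ^ n • a := rfl

theorem norm_trigMono (n : ℤ) (a : V) : ‖trigMono n a‖ = ‖a‖ := by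
  refine le_antisymm ((ContinuousMap.norm_le _ (norm_nonneg _)).2 fun z => ?_) ?_
  · rw [trigMono_apply, norm_smul, norm_zpow_circle, one_mul]
  · have := ContinuousMap.norm_coe_le_norm (trigMono n a) 1
    simpa using this

theorem trigMono_add (n : ℤ) (a b : V) : trigMono n (a + b) = trigMono n a + trigMono n b := by
  ext z; simp [smul_add]

theorem trigMono_smul (n : ℤ) (c : ℂ) (a : V) : trigMono n (c • a) = c • trigMono n a := by
  ext z; exact smul_comm _ _ _

/-- The trigonometric monomial as a continuous linear function of its coefficient. -/
def trigMonoL (n : ℤ) : V →L[ℂ] C(Circle, V) :=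
  LinearMap.mkContinuous
    { toFun := trigMono n
      map_add' := trigMono_add n
      map_smul' := trigMono_smul n } 1 fun a => by
        rw [one_mul]; exact (norm_trigMono n a).le

@[simp] theorem trigMonoL_apply (n : ℤ) (a : V) : trigMonoL n a = trigMono n a := rfl

/-- The uniform limits of trigonometric polynomials with strictly negative frequencies. -/
def negTrig (V : Type*) [NormedAddCommGroup V] [InnerProductSpace ℂ V] :
    Submodule ℂ C(Circle, V) :=
  (Submodule.span ℂ {f | ∃ n : ℤ, n < 0 ∧ ∃ a : V, f = trigMono n a}).topologicalClosure

theorem trigMono_mem_negTrig {n : ℤ} (hn : n < 0) (a : V) : trigMono n a ∈ negTrig V :=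
  Submodule.le_topologicalClosure _ (Submodule.subset_span ⟨n, hn, a, rfl⟩)

theorem isClosed_negTrig : IsClosed (negTrig V : Set C(Circle, V)) :=
  Submodule.isClosed_topologicalClosure _

theorem HasSum.mem_negTrig {ι : Type*} {f : ι → C(Circle, V)} {F : C(Circle, V)}
    (h : HasSum f F) (hf : ∀ i, f i ∈ negTrig V) : F ∈ negTrig V :=
  isClosed_negTrig.mem_of_tendsto h
    (Eventually.of_forall fun _ => Submodule.sum_mem _ fun i _ => hf i)

/-- The pointwise product of a scalar function and a vector function on the circle. -/
def circleSMul : C(Circle, ℂ) →L[ℂ] C(Circle, V) →L[ℂ] C(Circle, V) :=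
  LinearMap.mkContinuous₂
    (LinearMap.mk₂ ℂ (fun (u : C(Circle, ℂ)) (f : C(Circle, V)) =>
        (⟨fun z => u z • f z, by fun_prop⟩ : C(Circle, V)))
      (fun u w f => by ext z; exact add_smul _ _ _)
      (fun c u f => by ext z; exact smul_assoc c (u z) (f z))
      (fun u f g => by ext z; exact smul_add _ _ _)
      (fun c u f => by ext z; exact smul_comm _ _ _)) 1 fun u f => by
    refine (ContinuousMap.norm_le _ (by positivity)).2 fun z => ?_
    rw [one_mul]
    refine (norm_smul_le (u z) (f z)).trans ?_
    exact mul_le_mul (u.norm_coe_le_norm z) (f.norm_coe_le_norm z) (norm_nonneg _) (norm_nonneg _)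

@[simp] theorem circleSMul_apply (u : C(Circle, ℂ)) (f : C(Circle, V)) (z : Circle) :
    circleSMul u f z = u z • f z := rfl

theorem circleSMul_trigMono (n m : ℤ) (c : ℂ) (a : V) :
    circleSMul (trigMono n c) (trigMono m a) = trigMono (n + m) (c • a) := by
  ext z
  simp only [circleSMul_apply, trigMono_apply, smul_eq_mul, smul_smul]
  rw [zpow_add₀ (Circle.coe_ne_zero z)]
  congr 1; ring

/-- The multipliers that preserve `negTrig` form a closed subalgebra containing `z⁻¹`, hence the
whole closed algebra it generates. -/
theorem circleSMul_mem_negTrig {u : C(Circle, ℂ)}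
    (hu : u ∈ Algebra.elemental ℂ (trigMono (-1) (1 : ℂ))) {f : C(Circle, V)}
    (hf : f ∈ negTrig V) : circleSMul u f ∈ negTrig V := by
  let S : Subalgebra ℂ C(Circle, ℂ) :=
    { carrier := {u | ∀ f ∈ negTrig V, circleSMul u f ∈ negTrig V}
      mul_mem' := fun {u w} hu hw f hf => by
        have : circleSMul (u * w) f = circleSMul u (circleSMul w f) := by
          ext z; exact mul_smul _ _ _
        rw [this]; exact hu _ (hw _ hf)
      add_mem' := fun {u w} hu hw f hf => by
        rw [map_add]; exact Submodule.add_mem _ (hu _ hf) (hw _ hf)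
      algebraMap_mem' := fun c f hf => by
        have : circleSMul (algebraMap ℂ C(Circle, ℂ) c) f = c • f := by
          ext z; simp
        rw [this]; exact Submodule.smul_mem _ _ hf }
  have hS : IsClosed (S : Set C(Circle, ℂ)) := by
    have : (S : Set C(Circle, ℂ)) =
        ⋂ f : negTrig V, (fun u => circleSMul u (f : C(Circle, V))) ⁻¹' (negTrig V : Set _) := by
      ext u; simp [S]
    rw [this]
    exact isClosed_iInter fun f => isClosed_negTrig.preimage (by fun_prop)
  have hx : trigMono (-1) (1 : ℂ) ∈ S := by
    intro f hf
    have hle : negTrig V ≤ (negTrig V).comap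
        ((circleSMul (trigMono (-1) (1 : ℂ)) : C(Circle, V) →L[ℂ] C(Circle, V)) :
          C(Circle, V) →ₗ[ℂ] C(Circle, V)) := by
      refine Submodule.topologicalClosure_minimal _ ?_
        (isClosed_negTrig.preimage (circleSMul (trigMono (-1) (1 : ℂ))).continuous)
      rw [Submodule.span_le]
      rintro _ ⟨n, hn, a, rfl⟩
      change circleSMul (trigMono (-1) (1 : ℂ)) (trigMono n a) ∈ negTrig V
      rw [circleSMul_trigMono]
      exact trigMono_mem_negTrig (by omega) _
    exact hle hf
  exact Algebra.elemental.le_of_mem hS hx hu f hf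

theorem hasSum_trigMono [CompleteSpace V] {ι : Type*} {e : ι → ℤ} {h : ι → V}
    (hh : Summable fun p => ‖h p‖) :
    HasSum (fun p => trigMono (e p) (h p)) (∑' p, trigMono (e p) (h p)) :=
  (Summable.of_norm (by simpa only [norm_trigMono] using hh)).hasSum

theorem hasSum_trigMono_apply {ι : Type*} {f : ι → C(Circle, V)} {F : C(Circle, V)}
    (h : HasSum f F) (z : Circle) : HasSum (fun p => f p z) (F z) :=
  h.mapL (ContinuousMap.evalCLM ℂ z)

/-! ### Autocorrelations -/

/-- The double sum is split by the sign of the difference of the indices and then summed along the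
parallels to the diagonal. -/
theorem tsum_prod_eq_upper_add_lower {f : ℕ × ℕ → ℂ} (hfs : Summable f) :
    ∑' i, f i = ∑' n, ∑' p, f (p, p + n) + ∑' n, ∑' p, f (p + (n + 1), p) := by
  have hr1 : range (fun i : ℕ × ℕ => (i.1, i.1 + i.2)) = {i | i.1 ≤ i.2} := by
    ext ⟨p, q⟩
    simp only [mem_range, Prod.mk.injEq, Prod.exists, mem_ofPred_eq]
    exact ⟨by rintro ⟨a, b, rfl, rfl⟩; omega, fun h => ⟨p, q - p, rfl, by omega⟩⟩
  have hr2 : range (fun i : ℕ × ℕ => (i.1 + (i.2 + 1), i.1)) = {i | i.1 ≤ i.2}ᶜ := by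
    ext ⟨p, q⟩
    simp only [mem_range, Prod.mk.injEq, Prod.exists, mem_ofPred_eq, mem_compl_iff, not_le]
    exact ⟨by rintro ⟨a, b, rfl, rfl⟩; omega, fun h => ⟨q, p - q - 1, by omega, rfl⟩⟩
  have hi1 : Function.Injective (fun i : ℕ × ℕ => (i.1, i.1 + i.2)) := by
    rintro ⟨p, s⟩ ⟨q, t⟩ h
    simp only [Prod.mk.injEq] at h ⊢; omega
  have hi2 : Function.Injective (fun i : ℕ × ℕ => (i.1 + (i.2 + 1), i.1)) := by
    rintro ⟨p, s⟩ ⟨q, t⟩ h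
    simp only [Prod.mk.injEq] at h ⊢; omega
  have hs1 : Summable fun i : ℕ × ℕ => f (i.1, i.1 + i.2) := by
    simpa only [Function.comp_def] using hfs.comp_injective hi1
  have hs2 : Summable fun i : ℕ × ℕ => f (i.1 + (i.2 + 1), i.1) := by
    simpa only [Function.comp_def] using hfs.comp_injective hi2
  have hs1' : Summable fun i : ℕ × ℕ => f (i.2, i.2 + i.1) := (Equiv.prodComm ℕ ℕ).summable_iff.2 hs1
  have hs2' : Summable fun i : ℕ × ℕ => f (i.2 + (i.1 + 1), i.2) :=
    (Equiv.prodComm ℕ ℕ).summable_iff.2 hs2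
  rw [← hfs.tsum_subtype_add_tsum_subtype_compl {i | i.1 ≤ i.2}, ← hr2, tsum_range f hi2, ← hr1,
    tsum_range f hi1, ← (Equiv.prodComm ℕ ℕ).tsum_eq, ← (Equiv.prodComm ℕ ℕ).tsum_eq
      (fun i : ℕ × ℕ => f (i.1 + (i.2 + 1), i.1))]
  simp only [Equiv.prodComm_apply, Prod.fst_swap, Prod.snd_swap]
  rw [hs1'.tsum_prod, hs2'.tsum_prod]

theorem norm_sq_tsum_eq_autocorrelation [CompleteSpace V] {h : ℕ → V}
    (hh : Summable fun p => ‖h p‖) (z : Circle) :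
    ((‖∑' p : ℕ, (z : ℂ) ^ (p : ℤ) • h p‖ ^ 2 : ℝ) : ℂ) =
      ∑' n : ℕ, (z : ℂ) ^ (n : ℤ) * ∑' p, inner ℂ (h p) (h (p + n)) +
      ∑' n : ℕ, conj ((z : ℂ) ^ ((n + 1 : ℕ) : ℤ) * ∑' p, inner ℂ (h p) (h (p + (n + 1)))) := by
  set k : ℕ → V := fun p => (z : ℂ) ^ (p : ℤ) • h p with hk
  have hkn : ∀ p, ‖k p‖ = ‖h p‖ := fun p => by rw [hk]; simp only; rw [norm_smul, norm_zpow_circle, one_mul]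
  have hks : Summable k := Summable.of_norm (by simpa only [hkn] using hh)
  set f : ℕ × ℕ → ℂ := fun i => inner ℂ (k i.1) (k i.2) with hf
  have hfs : Summable f := by
    refine Summable.of_norm_bounded (hh.mul_of_nonneg hh (fun _ => norm_nonneg _)
      (fun _ => norm_nonneg _)) fun i => ?_
    rw [← hkn, ← hkn]; exact norm_inner_le_norm _ _
  have h1 : ((‖∑' p, k p‖ ^ 2 : ℝ) : ℂ) = ∑' i, f i := by
    rw [hfs.tsum_prod]
    have h2 : ∀ x : V, inner ℂ x (∑' p, k p) = ∑' p, inner ℂ x (k p) := fun x =>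
      (hks.hasSum.mapL (innerSL ℂ x)).tsum_eq.symm
    have h3 : ∀ x : V, inner ℂ (∑' p, k p) x = ∑' p, inner ℂ (k p) x := fun x => by
      rw [← inner_conj_symm, h2, Complex.conj_tsum]
      simp only [inner_conj_symm]
    have h4 : ∀ p, ∑' q, f (p, q) = inner ℂ (k p) (∑' q, k q) := fun p => (h2 (k p)).symm
    simp only [h4]
    rw [← h3, inner_self_eq_norm_sq_to_K]
    push_cast
    rfl
  have hval : ∀ p n : ℕ, f (p, p + n) = (z : ℂ) ^ (n : ℤ) * inner ℂ (h p) (h (p + n)) := by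
    intro p n
    simp only [hf, hk, inner_smul_left, inner_smul_right]
    rw [← mul_assoc, mul_comm (_ ^ _) (conj _), conj_zpow_mul_zpow]
    congr 2; push_cast; ring
  rw [h1, tsum_prod_eq_upper_add_lower hfs]
  congr 1
  · refine tsum_congr fun n => ?_
    rw [← tsum_mul_left]
    exact tsum_congr fun p => hval p n
  · refine tsum_congr fun n => ?_
    rw [← tsum_mul_left, Complex.conj_tsum]
    refine tsum_congr fun p => ?_
    rw [← hval]
    simp only [hf, inner_conj_symm]

/-- The autocorrelations at lags `n ≥ 0` determine the squared norm of an absolutely convergent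
series at each point of the circle. The two spaces may differ, which allows comparing a vector
function with a scalar one. -/
theorem norm_sq_tsum_eq_of_autocorrelation_eq [CompleteSpace V] {W : Type*} [NormedAddCommGroup W]
    [InnerProductSpace ℂ W] [CompleteSpace W] {h : ℕ → V} {k : ℕ → W}
    (hh : Summable fun p => ‖h p‖) (hk : Summable fun p => ‖k p‖) (c : ℝ)
    (hc : ∀ n, ∑' p, inner ℂ (h p) (h (p + n)) = (c : ℂ) * ∑' p, inner ℂ (k p) (k (p + n)))
    (z : Circle) :
    ‖∑' p : ℕ, (z : ℂ) ^ (p : ℤ) • h p‖ ^ 2 = c * ‖∑' p : ℕ, (z : ℂ) ^ (p : ℤ) • k p‖ ^ 2 := by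
  apply Complex.ofReal_injective
  rw [Complex.ofReal_mul, norm_sq_tsum_eq_autocorrelation hh, norm_sq_tsum_eq_autocorrelation hk,
    mul_add, ← tsum_mul_left, ← tsum_mul_left]
  simp only [hc, map_mul, Complex.conj_ofReal]
  congr 1 <;> exact tsum_congr fun n => by ring

end Trig

/-! ### Approximation of the symbol of a Hankel operator -/

section Nehari

variable {V : Type*} [NormedAddCommGroup V] [InnerProductSpace ℂ V] [CompleteSpace V]

theorem hankel_shiftRight_iterate {β : ℕ → V} (hβ : IsSmoothSymbol β) (v : SeqTwo) (n p : ℕ) :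
    hankel β (shiftRight^[n] v) p = hankel β v (p + n) := by
  induction n generalizing v with
  | zero => rfl
  | succ n ih => rw [Function.iterate_succ_apply, ih, hankel_shiftRight hβ, add_assoc]

theorem shiftRight_iterate_add (v : SeqTwo) (n s : ℕ) : shiftRight^[n] v (s + n) = v s := by
  induction n generalizing v with
  | zero => rfl
  | succ n ih => rw [Function.iterate_succ_apply', ← add_assoc, shiftRight_succ, ih]

theorem shiftRight_iterate_lt (v : SeqTwo) {n s : ℕ} (hs : s < n) : shiftRight^[n] v s = 0 := by
  induction n generalizing s with
  | zero => omega
  | succ n ih =>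
    rw [Function.iterate_succ_apply']
    cases s with
    | zero => rfl
    | succ s => exact ih (by omega)

/-- The lag-`n` autocorrelation of `Γ v` is `⟨Γ v, Γ Sⁿ v⟩ = ν² ⟨v, Sⁿ v⟩`, `S` being the right
shift. The conjugates convert `⟨v, Sⁿ v⟩` into an autocorrelation with the same orientation of the
lag. -/
theorem autocorrelation_hankel {β : ℕ → V} (hβ : IsSmoothSymbol β) {v : SeqTwo}
    (hv : v ∈ hankelMax β) (n : ℕ) :
    ∑' p, inner ℂ (hankel β v p) (hankel β v (p + n)) =
      ((‖hankel β‖ ^ 2 : ℝ) : ℂ) * ∑' s, inner ℂ (conj (v s)) (conj (v (s + n))) := by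
  have h1 := lp.hasSum_inner (𝕜 := ℂ) (hankel β v) (hankel β (shiftRight^[n] v))
  have h2 := lp.hasSum_inner (𝕜 := ℂ) v (shiftRight^[n] v)
  rw [← ContinuousLinearMap.adjoint_inner_left, mem_hankelMax_iff.1 hv, inner_smul_left] at h1
  simp only [hankel_shiftRight_iterate hβ] at h1
  rw [h1.tsum_eq]
  rw [← hasSum_nat_add_iff' n, Finset.sum_eq_zero, sub_zero] at h2
  · have h3 : ∀ s, inner ℂ (conj (v s)) (conj (v (s + n))) =
        inner ℂ (v (s + n)) (shiftRight^[n] v (s + n)) := by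
      intro s
      rw [shiftRight_iterate_add]
      simp [mul_comm]
    simp only [h3]
    rw [h2.tsum_eq]
    simp
  · intro s hs
    rw [shiftRight_iterate_lt _ (Finset.mem_range.1 hs), inner_zero_right]

/-- The symbol `∑_j z ^ j • β_j`. -/
def symbol (β : ℕ → V) : C(Circle, V) := ∑' j : ℕ, trigMono (j : ℤ) (β j)

/-- A non-unit is killed by some character `φ`. But `φ x` lies in the closed unit disc and `φ` maps
the series to the numerical power series at `φ x`. -/
theorem isUnit_tsum_smul_pow {A : Type*} [NormedCommRing A] [NormedAlgebra ℂ A] [CompleteSpace A]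
    [NormOneClass A] {v : ℕ → ℂ} (hz : ∀ a : ℂ, ‖a‖ ≤ 1 → ∑' s, a ^ s * v s ≠ 0) {x : A}
    (hx : ‖x‖ ≤ 1) (hs : Summable fun s => v s • x ^ s) : IsUnit (∑' s, v s • x ^ s) := by
  by_contra hcon
  obtain ⟨φ, hφ⟩ := WeakDual.CharacterSpace.exists_apply_eq_zero hcon
  have h1 : HasSum (fun s => φ (v s • x ^ s)) (φ (∑' s, v s • x ^ s)) :=
    hs.hasSum.map φ (map_continuous φ)
  rw [hφ] at h1
  refine hz (φ x) ?_ ?_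
  · exact (spectrum.norm_le_norm_of_mem (AlgHom.apply_mem_spectrum
      (WeakDual.CharacterSpace.toAlgHom φ) x)).trans hx
  · rw [← h1.tsum_eq]
    refine tsum_congr fun s => ?_
    rw [map_smul, map_pow, smul_eq_mul, mul_comm]

theorem exists_isUnit_elemental {v : ℕ → ℂ} (hv : Summable fun s => ‖v s‖)
    (hz : ∀ a : ℂ, ‖a‖ ≤ 1 → ∑' s, a ^ s * v s ≠ 0) :
    ∃ w u : C(Circle, ℂ), HasSum (fun s : ℕ => trigMono (-s : ℤ) (v s)) w ∧
      u ∈ Algebra.elemental ℂ (trigMono (-1) (1 : ℂ)) ∧ u * w = 1 := by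
  set X : C(Circle, ℂ) := trigMono (-1) (1 : ℂ) with hX
  have hXn : ∀ s : ℕ, ∀ c : ℂ, c • X ^ s = trigMono (-s : ℤ) c := by
    intro s c
    ext z
    simp [hX, zpow_neg, mul_comm]
  have hXs : HasSum (fun s => v s • X ^ s) (∑' s, v s • X ^ s) := by
    refine (Summable.of_norm ?_).hasSum
    simpa only [hXn, norm_trigMono] using hv
  -- The inverse is sought inside the closed algebra generated by `z⁻¹`, not in all continuous
  -- functions, so that it again has no positive frequencies.
  set x : Algebra.elemental ℂ X := ⟨X, Algebra.elemental.self_mem ℂ X⟩ with hx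
  have hxn : ‖x‖ ≤ 1 := by
    have h4 : ‖x‖ = ‖X‖ := rfl
    rw [h4, hX, norm_trigMono, norm_one]
  have hs : Summable fun s => v s • x ^ s := by
    refine Summable.of_norm ?_
    have h1 : ∀ s, ‖v s • x ^ s‖ = ‖v s‖ := fun s => by
      have h2 : ‖v s • x ^ s‖ = ‖v s • X ^ s‖ := rfl
      rw [h2, hXn, norm_trigMono]
    simpa only [h1] using hv
  have : NormOneClass (Algebra.elemental ℂ X) := ⟨by
    have h4 : ‖(1 : Algebra.elemental ℂ X)‖ = ‖(1 : C(Circle, ℂ))‖ := rfl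
    rw [h4, norm_one]⟩
  obtain ⟨y, hy⟩ := (isUnit_tsum_smul_pow hz hxn hs).exists_left_inv
  have h1 : HasSum (fun s => v s • X ^ s)
      ((∑' s, v s • x ^ s : Algebra.elemental ℂ X) : C(Circle, ℂ)) :=
    hs.hasSum.map (Algebra.elemental ℂ X).val continuous_subtype_val
  refine ⟨_, (y : C(Circle, ℂ)), ?_, y.2, congrArg Subtype.val hy⟩
  simpa only [hXn] using h1

/-- Multiplication by `z^{-s}` makes exactly the terms with `j < s` negative in frequency; the
remainder carries the shifted coefficients `β_{s+p}`. -/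
theorem circleSMul_symbol_eq {β : ℕ → V} (hβ : IsSmoothSymbol β) (c : ℂ) (s : ℕ) :
    circleSMul (trigMono (-s : ℤ) c) (symbol β) =
      ∑ j ∈ Finset.range s, trigMono ((j : ℤ) - s) (c • β j) +
        ∑' p : ℕ, trigMono (p : ℤ) (c • β (s + p)) := by
  have h4 : HasSum (fun j : ℕ => trigMono ((j : ℤ) - s) (c • β j))
      (circleSMul (trigMono (-s : ℤ) c) (symbol β)) := by
    have h5 := (hasSum_trigMono (e := fun j : ℕ => (j : ℤ)) hβ.summable).mapL
      (circleSMul (trigMono (-s : ℤ) c))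
    refine h5.congr_fun fun j => ?_
    rw [circleSMul_trigMono, neg_add_eq_sub]
  rw [← h4.tsum_eq, ← h4.summable.sum_add_tsum_nat_add s]
  congr 1
  refine tsum_congr fun p => ?_
  rw [add_comm p s]
  congr 1; push_cast; ring

/-- Summed over `s`, the coefficients at frequency `p ≥ 0` of `w β` are `∑_s v_s β_{s+p} = (Γ v)_p`.
This is how the Hankel operator describes the nonnegative frequencies of the product. -/
theorem circleSMul_symbol_sub_mem_negTrig {β : ℕ → V} (hβ : IsSmoothSymbol β) (v : SeqTwo)
    {w : C(Circle, ℂ)} (hw : HasSum (fun s : ℕ => trigMono (-s : ℤ) (v s)) w)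
    {g : C(Circle, V)} (hg : HasSum (fun p : ℕ => trigMono (p : ℤ) (hankel β v p)) g) :
    circleSMul w (symbol β) - g ∈ negTrig V := by
  have hsum : Summable fun i : ℕ × ℕ => trigMono (i.2 : ℤ) (v i.1 • β (i.1 + i.2)) := by
    refine Summable.of_norm_bounded (hβ.summable_prod.mul_left ‖v‖) fun i => ?_
    rw [norm_trigMono, norm_smul]
    exact mul_le_mul_of_nonneg_right (lp.norm_apply_le_norm (by norm_num) v i.1) (norm_nonneg _)
  have h1 : HasSum (fun s : ℕ => ∑' p : ℕ, trigMono (p : ℤ) (v s • β (s + p))) g := by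
    have h2 := hsum.hasSum.prod_fiberwise fun s => (hsum.prod_factor s).hasSum
    convert h2 using 1
    have h3 : Summable (Function.uncurry fun s p : ℕ => trigMono (p : ℤ) (v s • β (s + p))) := hsum
    rw [hsum.tsum_prod]
    refine Eq.trans ?_ h3.tsum_comm
    rw [← hg.tsum_eq]
    refine tsum_congr fun p => ?_
    exact ((hankel_hasSum_apply hβ v p).mapL (trigMonoL (p : ℤ))).tsum_eq.symm
  have h2 : HasSum (fun s : ℕ => circleSMul (trigMono (-s : ℤ) (v s)) (symbol β))
      (circleSMul w (symbol β)) :=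
    hw.mapL ((circleSMul : C(Circle, ℂ) →L[ℂ] C(Circle, V) →L[ℂ] C(Circle, V)).flip (symbol β))
  refine HasSum.mem_negTrig (h2.sub h1) fun s => ?_
  rw [circleSMul_symbol_eq hβ, add_sub_cancel_right]
  refine Submodule.sum_mem _ fun j hj => trigMono_mem_negTrig ?_ _
  have := Finset.mem_range.1 hj
  omega

/-- Nehari's theorem for a smooth vector symbol, with an approximant that is a uniform limit of
trigonometric polynomials; this is what makes it usable as a linear estimate. -/
theorem exists_negTrig_norm_sub_le {β : ℕ → V} (hβ : IsSmoothSymbol β) :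
    ∃ F ∈ negTrig V, ∀ z, ‖symbol β z - F z‖ ≤ ‖hankel β‖ := by
  -- For `Γ = 0` every `β j` is a value of `Γ`, hence zero; the smoothness of maximizing vectors
  -- below needs `ν ≠ 0`.
  by_cases h0 : hankel β = 0
  · refine ⟨0, Submodule.zero_mem _, fun z => ?_⟩
    have hβ0 : ∀ j, β j = 0 := by
      intro j
      have := hankel_stdVec_apply hβ 0 j
      rw [h0, zero_add] at this
      rw [← this]; rfl
    have : symbol β = 0 := by
      rw [symbol]
      convert tsum_zero with j
      ext z; simp [hβ0]
    rw [this, sub_self, norm_zero]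
    exact norm_nonneg (hankel β)
  obtain ⟨v, hvm, hvz⟩ := exists_mem_hankelMax_zero_free hβ h0
  have hvs : Summable fun s => ‖v s‖ := by
    refine Summable.of_nonneg_of_le (fun _ => norm_nonneg _) (fun j => ?_)
      (summable_weighted_coord hβ h0 hvm)
    nlinarith [norm_nonneg (v j), (Nat.cast_nonneg j : (0 : ℝ) ≤ j)]
  obtain ⟨w, u, hw, hu, huw⟩ := exists_isUnit_elemental hvs hvz
  have hgs := summable_hankel_apply hβ v
  set g : C(Circle, V) := ∑' p : ℕ, trigMono (p : ℤ) (hankel β v p) with hg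
  have hgS : HasSum (fun p : ℕ => trigMono (p : ℤ) (hankel β v p)) g := hasSum_trigMono hgs
  -- Equal autocorrelations up to the factor `ν²`. The conjugate of `w` is a series in nonnegative
  -- powers of `z`, as the comparison requires.
  have hnorm : ∀ z, ‖g z‖ = ‖hankel β‖ * ‖w z‖ := by
    intro z
    have h1 := norm_sq_tsum_eq_of_autocorrelation_eq hgs (k := fun s => conj (v s))
      (by simpa using hvs) (‖hankel β‖ ^ 2) (autocorrelation_hankel hβ hvm) z
    have h2 : ∑' p : ℕ, (z : ℂ) ^ (p : ℤ) • hankel β v p = g z :=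
      (hasSum_trigMono_apply hgS z).tsum_eq
    have h3 : ∑' s : ℕ, (z : ℂ) ^ (s : ℤ) • conj (v s) = conj (w z) := by
      rw [← (hasSum_trigMono_apply hw z).tsum_eq, Complex.conj_tsum]
      refine tsum_congr fun s => ?_
      simp only [trigMono_apply, smul_eq_mul, map_mul]
      have := conj_zpow_mul_zpow z (-s) 0
      simp only [zpow_zero, mul_one, zero_sub, neg_neg] at this
      rw [this]
    rw [h2, h3, RCLike.norm_conj, ← mul_pow] at h1
    exact (pow_left_inj₀ (norm_nonneg _) (mul_nonneg (norm_nonneg (hankel β)) (norm_nonneg _))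
      two_ne_zero).1 h1
  have hN := circleSMul_symbol_sub_mem_negTrig hβ v hw hgS
  -- Since `u w = 1`, subtracting this function from the symbol leaves `u g`, whose norm is `ν` at
  -- every point.
  refine ⟨circleSMul u (circleSMul w (symbol β) - g), circleSMul_mem_negTrig hu hN, fun z => ?_⟩
  have huz : u z * w z = 1 := DFunLike.congr_fun huw z
  have h1 : symbol β z - (circleSMul u (circleSMul w (symbol β) - g)) z = u z • g z := by
    rw [circleSMul_apply, ContinuousMap.sub_apply, circleSMul_apply, smul_sub, smul_smul, huz,
      one_smul, sub_sub_cancel]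
  rw [h1, norm_smul, hnorm]
  have h2 : ‖u z‖ * ‖w z‖ = 1 := by rw [← norm_mul, huz, norm_one]
  rw [mul_left_comm, h2, mul_one]

end Nehari

/-! ### Parseval's formula on a finite cyclic group -/

section Stationary

variable {H : Type*} [NormedAddCommGroup H] [InnerProductSpace ℂ H]

theorem norm_sq_sum_eq {ι : Type*} (s : Finset ι) (f : ι → H) :
    ((‖∑ i ∈ s, f i‖ ^ 2 : ℝ) : ℂ) = ∑ i ∈ s, ∑ j ∈ s, inner ℂ (f i) (f j) := by
  have h := inner_self_eq_norm_sq_to_K (𝕜 := ℂ) (∑ i ∈ s, f i)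
  rw [sum_inner] at h
  simp only [inner_sum] at h
  rw [h]; push_cast; rfl

theorem parseval_zmod (L : ℕ) [NeZero L] (a : ZMod L → H) :
    ∑ t : ZMod L, ‖∑ n : ZMod L, (ZMod.stdAddChar (-(n * t)) : ℂ) • a n‖ ^ 2 =
      L * ∑ n : ZMod L, ‖a n‖ ^ 2 := by
  apply Complex.ofReal_injective
  push_cast
  have h1 : ∀ t : ZMod L, ((‖∑ n : ZMod L, (ZMod.stdAddChar (-(n * t)) : ℂ) • a n‖ : ℂ)) ^ 2 =
      ∑ n : ZMod L, ∑ m : ZMod L, (ZMod.stdAddChar (t * (n - m)) : ℂ) * inner ℂ (a n) (a m) := by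
    intro t
    have h2 := norm_sq_sum_eq Finset.univ fun n : ZMod L => (ZMod.stdAddChar (-(n * t)) : ℂ) • a n
    push_cast at h2
    rw [h2]
    refine Finset.sum_congr rfl fun n _ => Finset.sum_congr rfl fun m _ => ?_
    rw [inner_smul_left, inner_smul_right, ← mul_assoc, ← AddChar.map_neg_eq_conj,
      ← AddChar.map_add_eq_mul]
    congr 2; ring
  simp only [h1]
  rw [Finset.sum_comm, Finset.mul_sum]
  refine Finset.sum_congr rfl fun n _ => ?_
  rw [Finset.sum_comm]
  simp only [← Finset.sum_mul]
  have h3 : ∀ m : ZMod L, ∑ t : ZMod L, (ZMod.stdAddChar (t * (n - m)) : ℂ) =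
      if n = m then (L : ℂ) else 0 := by
    intro m
    rw [AddChar.sum_mulShift _ (ZMod.isPrimitive_stdAddChar L), ZMod.card]
    simp only [sub_eq_zero]
    split_ifs <;> simp
  simp only [h3, ite_mul, zero_mul, Finset.sum_ite_eq, Finset.mem_univ, if_true]
  rw [inner_self_eq_norm_sq_to_K]; rfl

/-! ### Stationary arrays -/

variable {κ : Type*}

/-- The array `x` is stationary in its second index and has a finite total power. -/
structure IsStationary (x : κ → ℤ → H) : Prop where
  inner_succ : ∀ k n j l, inner ℂ (x k (j + 1)) (x n (l + 1)) = inner ℂ (x k j) (x n l)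
  summable : Summable fun k => ‖x k 0‖ ^ 2

/-- The total power of an array. -/
def power (x : κ → ℤ → H) : ℝ := ∑' k, ‖x k 0‖ ^ 2

theorem power_nonneg (x : κ → ℤ → H) : 0 ≤ power x := tsum_nonneg fun _ => sq_nonneg _

theorem IsStationary.inner_add_nat {x : κ → ℤ → H} (hx : IsStationary x) (k n : κ) (j l : ℤ)
    (m : ℕ) : inner ℂ (x k (j + m)) (x n (l + m)) = inner ℂ (x k j) (x n l) := by
  induction m with
  | zero => simp
  | succ m ih =>
    have h := hx.inner_succ k n (j + m) (l + m)
    rw [ih, add_assoc, add_assoc] at h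
    exact_mod_cast h

theorem IsStationary.inner_add {x : κ → ℤ → H} (hx : IsStationary x) (k n : κ) (j l m : ℤ) :
    inner ℂ (x k (j + m)) (x n (l + m)) = inner ℂ (x k j) (x n l) := by
  obtain ⟨m, rfl | rfl⟩ := m.eq_nat_or_neg
  · exact hx.inner_add_nat k n j l m
  · have h := hx.inner_add_nat k n (j + -m) (l + -m) m
    simpa using h.symm

theorem IsStationary.norm_eq {x : κ → ℤ → H} (hx : IsStationary x) (k : κ) (j : ℤ) :
    ‖x k j‖ = ‖x k 0‖ := by
  have h := hx.inner_add k k 0 0 j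
  rw [zero_add, inner_self_eq_norm_sq_to_K, inner_self_eq_norm_sq_to_K] at h
  have h2 : ‖x k j‖ ^ 2 = ‖x k 0‖ ^ 2 := by
    apply Complex.ofReal_injective; push_cast; exact h
  exact (pow_left_inj₀ (norm_nonneg _) (norm_nonneg _) two_ne_zero).1 h2

/-- The value of a finitely supported linear form at an array. -/
def formEval (x : κ → ℤ → H) : (κ × ℤ →₀ ℂ) →ₗ[ℂ] H :=
  Finsupp.linearCombination ℂ fun i : κ × ℤ => x i.1 i.2

theorem formEval_apply (x : κ → ℤ → H) (c : κ × ℤ →₀ ℂ) :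
    formEval x c = ∑ i ∈ c.support, c i • x i.1 i.2 := by
  rw [formEval, Finsupp.linearCombination_apply, Finsupp.sum]

theorem norm_formEval_shift {x : κ → ℤ → H} (hx : IsStationary x) (c : κ × ℤ →₀ ℂ) (m : ℤ) :
    ‖∑ i ∈ c.support, c i • x i.1 (i.2 + m)‖ = ‖formEval x c‖ := by
  have h : ‖∑ i ∈ c.support, c i • x i.1 (i.2 + m)‖ ^ 2 = ‖formEval x c‖ ^ 2 := by
    apply Complex.ofReal_injective
    rw [formEval_apply, norm_sq_sum_eq, norm_sq_sum_eq]
    simp only [inner_smul_left, inner_smul_right, hx.inner_add]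
  exact (pow_left_inj₀ (norm_nonneg _) (norm_nonneg _) two_ne_zero).1 h

variable [DecidableEq κ]

/-- The transfer function of a finitely supported linear form. -/
def formSymbol : (κ × ℤ →₀ ℂ) →ₗ[ℂ] C(Circle, lp (fun _ : κ => ℂ) 2) :=
  Finsupp.linearCombination ℂ fun i : κ × ℤ => trigMono i.2 (lp.single 2 i.1 (1 : ℂ))

theorem formSymbol_apply_apply (c : κ × ℤ →₀ ℂ) (z : Circle) (k : κ) :
    formSymbol c z k = ∑ i ∈ c.support with i.1 = k, c i * (z : ℂ) ^ i.2 := by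
  rw [formSymbol, Finsupp.linearCombination_apply, Finsupp.sum, ContinuousMap.coe_sum,
    Finset.sum_apply, lp.coeFn_sum, Finset.sum_apply, Finset.sum_filter]
  refine Finset.sum_congr rfl fun i _ => ?_
  simp only [ContinuousMap.smul_apply, trigMono_apply, lp.coeFn_smul, Pi.smul_apply, smul_eq_mul,
    lp.single_apply, Pi.single_apply]
  by_cases h : i.1 = k
  · simp [h]
  · simp [h, Ne.symm h]

theorem norm_sum_smul_sq_le {ι : Type*} (s : Finset ι) (f : ι → ℂ) (a : ι → H) :
    ‖∑ i ∈ s, f i • a i‖ ^ 2 ≤ (∑ i ∈ s, ‖f i‖ ^ 2) * ∑ i ∈ s, ‖a i‖ ^ 2 := by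
  refine le_trans (pow_le_pow_left₀ (norm_nonneg _) (norm_sum_le _ _) 2) ?_
  simp only [norm_smul]
  exact Finset.sum_mul_sq_le_sq_mul_sq s _ _

/-- A window of length `L` of the array is wrapped around the cyclic group. There the discrete
Fourier transform turns the form into multiplication by its transfer function at the `L`-th roots of
unity, and Parseval with Cauchy-Schwarz gives the bound. -/
theorem formEval_zmod_bound {x : κ → ℤ → H} (hx : IsStationary x) (c : κ × ℤ →₀ ℂ) (L : ℕ)
    [NeZero L] :
    ∑ n : ZMod L, ‖∑ i ∈ c.support, c i • x i.1 ((n + (i.2 : ZMod L)).val : ℤ)‖ ^ 2 ≤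
      L * (‖formSymbol c‖ ^ 2 * power x) := by
  have hL : (0 : ℝ) < L := Nat.cast_pos.2 (NeZero.pos L)
  set a : κ → ZMod L → H := fun k t => ∑ n : ZMod L, (ZMod.stdAddChar (-(n * t)) : ℂ) •
    x k (n.val : ℤ) with ha
  set K := c.support.image Prod.fst with hK
  have h1 : ∀ t : ZMod L, ∑ n : ZMod L, (ZMod.stdAddChar (-(n * t)) : ℂ) •
      ∑ i ∈ c.support, c i • x i.1 ((n + (i.2 : ZMod L)).val : ℤ) =
      ∑ k ∈ K, formSymbol c (ZMod.toCircle t) k • a k t := by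
    intro t
    have h2 : ∀ i : κ × ℤ, ∑ n : ZMod L, (ZMod.stdAddChar (-(n * t)) : ℂ) •
        x i.1 ((n + (i.2 : ZMod L)).val : ℤ) = ((ZMod.toCircle t : ℂ) ^ i.2) • a i.1 t := by
      intro i
      simp only [ha]
      -- A cyclic translation by `i.2` becomes the factor `z ^ i.2` after the transform.
      rw [Finset.smul_sum, ← Equiv.sum_comp (Equiv.addRight (i.2 : ZMod L)) fun n : ZMod L =>
        ((ZMod.toCircle t : ℂ) ^ i.2) • (ZMod.stdAddChar (-(n * t)) : ℂ) • x i.1 (n.val : ℤ)]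
      refine Finset.sum_congr rfl fun n _ => ?_
      rw [Equiv.coe_addRight, smul_smul]
      congr 1
      have h3 : ((ZMod.toCircle t : ℂ) ^ i.2) = ZMod.stdAddChar ((i.2 : ZMod L) * t) := by
        rw [ZMod.stdAddChar_apply, ← zsmul_eq_mul, AddChar.map_zsmul_eq_zpow]
        simp
      rw [h3, ← AddChar.map_add_eq_mul]
      congr 1; ring
    simp only [Finset.smul_sum]
    rw [Finset.sum_comm]
    simp only [formSymbol_apply_apply, Finset.sum_smul]
    rw [Finset.sum_congr rfl fun i _ => by
      simp only [smul_comm _ (c i)]; rw [← Finset.smul_sum, h2 i, smul_smul]]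
    rw [← Finset.sum_fiberwise_of_maps_to (t := K) (g := Prod.fst)
      (fun i hi => Finset.mem_image_of_mem _ hi)]
    refine Finset.sum_congr rfl fun k _ => Finset.sum_congr rfl fun i hi => ?_
    rw [(Finset.mem_filter.1 hi).2]
  have h4 := parseval_zmod L fun n => ∑ i ∈ c.support, c i • x i.1 ((n + (i.2 : ZMod L)).val : ℤ)
  simp only [h1] at h4
  have h5 : ∀ t : ZMod L, ‖∑ k ∈ K, formSymbol c (ZMod.toCircle t) k • a k t‖ ^ 2 ≤
      ‖formSymbol c‖ ^ 2 * ∑ k ∈ K, ‖a k t‖ ^ 2 := by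
    intro t
    refine (norm_sum_smul_sq_le _ _ _).trans
      (mul_le_mul_of_nonneg_right ?_ (Finset.sum_nonneg fun _ _ => sq_nonneg _))
    refine (sum_le_hasSum K (fun _ _ => sq_nonneg _)
      (lp_two_hasSum_norm_sq (formSymbol c (ZMod.toCircle t)))).trans ?_
    exact pow_le_pow_left₀ (norm_nonneg _) ((formSymbol c).norm_coe_le_norm _) 2
  have h6 : ∑ t : ZMod L, ∑ k ∈ K, ‖a k t‖ ^ 2 ≤ L * (L * power x) := by
    rw [Finset.sum_comm]
    simp only [ha, parseval_zmod, hx.norm_eq, Finset.sum_const, Finset.card_univ, ZMod.card,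
      nsmul_eq_mul, ← Finset.mul_sum]
    gcongr
    exact hx.summable.sum_le_tsum K fun _ _ => sq_nonneg _
  have h7 : (L : ℝ) * ∑ n : ZMod L,
      ‖∑ i ∈ c.support, c i • x i.1 ((n + (i.2 : ZMod L)).val : ℤ)‖ ^ 2 ≤
      L * (L * (‖formSymbol c‖ ^ 2 * power x)) := by
    rw [← h4]
    refine (Finset.sum_le_sum fun t _ => h5 t).trans ?_
    rw [← Finset.mul_sum]
    refine (mul_le_mul_of_nonneg_left h6 (sq_nonneg _)).trans (le_of_eq ?_)
    ring
  exact le_of_mul_le_mul_left h7 hL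

/-- Away from the ends of a long window wrapping has no effect, and by stationarity each translate
of the form has the same norm. The boundary effect, of fixed width `2 D`, disappears on dividing by
the length of the window. -/
theorem norm_formEval_sq_le {x : κ → ℤ → H} (hx : IsStationary x) (c : κ × ℤ →₀ ℂ) :
    ‖formEval x c‖ ^ 2 ≤ ‖formSymbol c‖ ^ 2 * power x := by
  obtain ⟨D, hD⟩ : ∃ D : ℕ, ∀ i ∈ c.support, |i.2| ≤ D := by
    refine ⟨c.support.sup fun i => i.2.natAbs, fun i hi => ?_⟩
    rw [Int.abs_eq_natAbs]
    exact_mod_cast Finset.le_sup (f := fun i : κ × ℤ => i.2.natAbs) hi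
  set S := ‖formSymbol c‖ ^ 2 * power x with hS
  set y := ‖formEval x c‖ ^ 2 with hy
  have hy0 : 0 ≤ y := sq_nonneg _
  have key : ∀ N : ℕ, ((N + 1 : ℕ) : ℝ) * y ≤ ((N + 1 : ℕ) + 2 * D) * S := by
    intro N
    set L := N + 1 + 2 * D with hL
    have : NeZero L := ⟨by omega⟩
    have h1 := formEval_zmod_bound hx c L
    -- For these `m` all `m + i.2` lie in `[0, L)`, so reduction modulo `L` changes nothing.
    have h2 : ∀ m ∈ Finset.Ico D (D + (N + 1)),
        ‖∑ i ∈ c.support, c i • x i.1 ((((m : ℤ) : ZMod L) + (i.2 : ZMod L)).val : ℤ)‖ ^ 2 = y := by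
      intro m hm
      rw [Finset.mem_Ico] at hm
      rw [hy, ← norm_formEval_shift hx c m]
      congr 2
      refine Finset.sum_congr rfl fun i hi => ?_
      congr 2
      rw [← Int.cast_add, ZMod.val_intCast, add_comm (i.2)]
      have h3 := abs_le.1 (hD i hi)
      refine Int.emod_eq_of_lt ?_ ?_ <;> push_cast [hL] <;> omega
    have hinj : Set.InjOn (fun m : ℕ => ((m : ℤ) : ZMod L)) (Finset.Ico D (D + (N + 1))) := by
      intro m hm m' hm' h
      simp only [Finset.coe_Ico, Set.mem_Ico] at hm hm'
      simp only [Int.cast_natCast] at h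
      have h4 := congrArg ZMod.val h
      rwa [ZMod.val_cast_of_lt (by omega), ZMod.val_cast_of_lt (by omega)] at h4
    have h5 : ((N + 1 : ℕ) : ℝ) * y ≤ ∑ n : ZMod L,
        ‖∑ i ∈ c.support, c i • x i.1 ((n + (i.2 : ZMod L)).val : ℤ)‖ ^ 2 := by
      calc ((N + 1 : ℕ) : ℝ) * y = ∑ m ∈ Finset.Ico D (D + (N + 1)), y := by
            rw [Finset.sum_const, Nat.card_Ico, nsmul_eq_mul]; simp
        _ = ∑ n ∈ (Finset.Ico D (D + (N + 1))).image (fun m : ℕ => ((m : ℤ) : ZMod L)),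
            ‖∑ i ∈ c.support, c i • x i.1 ((n + (i.2 : ZMod L)).val : ℤ)‖ ^ 2 := by
            rw [Finset.sum_image hinj]
            exact (Finset.sum_congr rfl h2).symm
        _ ≤ _ := Finset.sum_le_sum_of_subset_of_nonneg (Finset.subset_univ _)
            fun _ _ _ => sq_nonneg _
    refine h5.trans (h1.trans (le_of_eq ?_))
    rw [hL]; push_cast; ring
  by_contra! hcon
  -- For such `N`, `(N + 1) (y - S)` exceeds `2 D S`, against `key N`.
  obtain ⟨N, hN⟩ := exists_nat_gt (2 * D * S / (y - S))
  have h1 := key N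
  rw [div_lt_iff₀ (by linarith)] at hN
  push_cast at h1
  nlinarith

/-! ### Evaluation of transfer functions at a stationary array -/

/-- The uniform limits of transfer functions of finitely supported linear forms. -/
def trigSpace (κ : Type*) [DecidableEq κ] : Submodule ℂ C(Circle, lp (fun _ : κ => ℂ) 2) :=
  (LinearMap.range (formSymbol (κ := κ))).topologicalClosure

/-- `formSymbol` with values in `trigSpace`. -/
def formSymbolR : (κ × ℤ →₀ ℂ) →ₗ[ℂ] trigSpace κ :=
  (formSymbol (κ := κ)).codRestrict _ fun c =>
    Submodule.le_topologicalClosure _ (LinearMap.mem_range_self _ c)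

theorem denseRange_formSymbolR : DenseRange (formSymbolR (κ := κ)) := by
  intro f
  rw [closure_subtype]
  have h := f.2
  change (f : C(Circle, lp (fun _ : κ => ℂ) 2)) ∈
    closure (LinearMap.range (formSymbol (κ := κ)) : Set C(Circle, lp (fun _ : κ => ℂ) 2)) at h
  convert h using 2
  ext g
  constructor
  · rintro ⟨_, ⟨c, rfl⟩, rfl⟩; exact ⟨c, rfl⟩
  · rintro ⟨c, rfl⟩; exact ⟨_, ⟨c, rfl⟩, rfl⟩

variable [CompleteSpace H]

/-- The continuous extension of the evaluation of linear forms at an array. -/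
def trigEval (x : κ → ℤ → H) : trigSpace κ →L[ℂ] H := (formEval x).extendOfNorm formSymbolR

theorem norm_formEval_le {x : κ → ℤ → H} (hx : IsStationary x) (c : κ × ℤ →₀ ℂ) :
    ‖formEval x c‖ ≤ Real.sqrt (power x) * ‖formSymbolR c‖ := by
  have h := Real.sqrt_le_sqrt (norm_formEval_sq_le hx c)
  rw [Real.sqrt_sq (norm_nonneg _), Real.sqrt_mul (sq_nonneg _), Real.sqrt_sq (norm_nonneg _)] at h
  rw [mul_comm]
  exact h

theorem trigEval_formSymbolR {x : κ → ℤ → H} (hx : IsStationary x) (c : κ × ℤ →₀ ℂ) :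
    trigEval x (formSymbolR c) = formEval x c :=
  LinearMap.extendOfNorm_eq denseRange_formSymbolR ⟨_, norm_formEval_le hx⟩ c

theorem norm_trigEval_le {x : κ → ℤ → H} (hx : IsStationary x) (f : trigSpace κ) :
    ‖trigEval x f‖ ≤ Real.sqrt (power x) * ‖f‖ :=
  LinearMap.norm_extendOfNorm_apply_le denseRange_formSymbolR _ (norm_formEval_le hx) f

/-- Evaluation commutes with bounded operators applied to the array. This later evaluates the same
transfer function at the two parts of a decomposed array. -/
theorem trigEval_map {x y : κ → ℤ → H} (hx : IsStationary x) (hy : IsStationary y)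
    (R : H →L[ℂ] H) (hR : ∀ k j, y k j = R (x k j)) (f : trigSpace κ) :
    trigEval y f = R (trigEval x f) := by
  have h : (trigEval y : trigSpace κ → H) = fun f => R (trigEval x f) := by
    refine denseRange_formSymbolR.equalizer (trigEval y).continuous (by fun_prop) ?_
    funext c
    simp only [Function.comp_apply, trigEval_formSymbolR hx, trigEval_formSymbolR hy,
      formEval_apply, map_sum, map_smul, hR]
  exact congrFun h f

theorem trigMono_single_mem (k : κ) (j : ℤ) :
    trigMono j (lp.single 2 k (1 : ℂ)) ∈ trigSpace κ := by
  refine Submodule.le_topologicalClosure _ ⟨Finsupp.single (k, j) 1, ?_⟩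
  simp [formSymbol]

theorem hasSum_trigMono_single (j : ℤ) (a : lp (fun _ : κ => ℂ) 2) :
    HasSum (fun k => a k • trigMono j (lp.single 2 k (1 : ℂ))) (trigMono j a) := by
  have h := (lp.hasSum_single (by norm_num) a).mapL (trigMonoL j)
  refine h.congr_fun fun k => ?_
  rw [trigMonoL_apply, ← trigMono_smul, ← lp.single_smul]
  simp

theorem trigMono_mem (j : ℤ) (a : lp (fun _ : κ => ℂ) 2) : trigMono j a ∈ trigSpace κ :=
  (Submodule.isClosed_topologicalClosure _).mem_of_tendsto (hasSum_trigMono_single j a)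
    (Eventually.of_forall fun _ => Submodule.sum_mem _ fun k _ =>
      Submodule.smul_mem _ _ (trigMono_single_mem k j))

theorem trigEval_trigMono_single {x : κ → ℤ → H} (hx : IsStationary x) (k : κ) (j : ℤ) :
    trigEval x ⟨_, trigMono_single_mem k j⟩ = x k j := by
  have h := trigEval_formSymbolR hx (Finsupp.single (k, j) 1)
  have h2 : formSymbolR (Finsupp.single (k, j) (1 : ℂ)) = ⟨_, trigMono_single_mem k j⟩ := by
    apply Subtype.ext
    simp [formSymbolR, formSymbol]
  rw [h2] at h
  rw [h]
  simp [formEval]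

theorem hasSum_subtype_mk {E ι : Type*} [NormedAddCommGroup E] [NormedSpace ℂ E]
    (S : Submodule ℂ E) {f : ι → E} (hf : ∀ i, f i ∈ S) {F : E} (hF : F ∈ S) (h : HasSum f F) :
    HasSum (fun i => (⟨f i, hf i⟩ : S)) ⟨F, hF⟩ :=
  (Topology.IsInducing.hasSum_iff (g := S.subtype) Topology.IsInducing.subtypeVal _ _).1 h

theorem hasSum_trigEval_trigMono {x : κ → ℤ → H} (hx : IsStationary x) (j : ℤ)
    (a : lp (fun _ : κ => ℂ) 2) :
    HasSum (fun k => a k • x k j) (trigEval x ⟨_, trigMono_mem j a⟩) := by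
  have h : HasSum (fun k => a k • (⟨_, trigMono_single_mem k j⟩ : trigSpace κ))
      ⟨_, trigMono_mem j a⟩ :=
    hasSum_subtype_mk (trigSpace κ)
      (fun k => Submodule.smul_mem _ _ (trigMono_single_mem k j)) _ (hasSum_trigMono_single j a)
  refine (h.mapL (trigEval x)).congr_fun fun k => ?_
  rw [map_smul, trigEval_trigMono_single hx]

theorem symbol_mem_trigSpace {β : ℕ → lp (fun _ : κ => ℂ) 2} (hβ : IsSmoothSymbol β) :
    symbol β ∈ trigSpace κ :=
  (Submodule.isClosed_topologicalClosure _).mem_of_tendsto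
    (hasSum_trigMono (e := fun j : ℕ => (j : ℤ)) hβ.summable)
    (Eventually.of_forall fun _ => Submodule.sum_mem _ fun _ _ => trigMono_mem _ _)

theorem hasSum_trigEval_symbol {β : ℕ → lp (fun _ : κ => ℂ) 2} (hβ : IsSmoothSymbol β)
    (x : κ → ℤ → H) :
    HasSum (fun j : ℕ => trigEval x ⟨_, trigMono_mem (j : ℤ) (β j)⟩)
      (trigEval x ⟨_, symbol_mem_trigSpace hβ⟩) := by
  have h : HasSum (fun j : ℕ => (⟨_, trigMono_mem (j : ℤ) (β j)⟩ : trigSpace κ))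
      ⟨_, symbol_mem_trigSpace hβ⟩ :=
    hasSum_subtype_mk (trigSpace κ) (fun _ => trigMono_mem _ _) _
      (hasSum_trigMono (e := fun j : ℕ => (j : ℤ)) hβ.summable)
  exact h.mapL (trigEval x)

/-- Vector coefficients are sums of multiples of the standard basis vectors, so finite forms
supported at negative times are already dense. -/
theorem exists_seq_of_mem_negTrig {F : C(Circle, lp (fun _ : κ => ℂ) 2)}
    (hF : F ∈ negTrig (lp (fun _ : κ => ℂ) 2)) :
    ∃ c : ℕ → (κ × {j : ℤ // j < 0} →₀ ℂ), Tendsto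
      (fun n => formSymbol ((c n).mapDomain fun i => (i.1, (i.2 : ℤ)))) atTop (𝓝 F) := by
  let N : Submodule ℂ C(Circle, lp (fun _ : κ => ℂ) 2) :=
    LinearMap.range (formSymbol ∘ₗ Finsupp.lmapDomain ℂ ℂ
      (fun i : κ × {j : ℤ // j < 0} => (i.1, (i.2 : ℤ))))
  have hle : negTrig (lp (fun _ : κ => ℂ) 2) ≤ N.topologicalClosure := by
    refine Submodule.topologicalClosure_minimal _ ?_ (Submodule.isClosed_topologicalClosure _)
    rw [Submodule.span_le]
    rintro _ ⟨j, hj, a, rfl⟩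
    refine (Submodule.isClosed_topologicalClosure N).mem_of_tendsto (hasSum_trigMono_single j a)
      (Eventually.of_forall fun _ => Submodule.sum_mem _ fun k _ => Submodule.smul_mem _ _ ?_)
    refine Submodule.le_topologicalClosure _ ⟨Finsupp.single (k, ⟨j, hj⟩) 1, ?_⟩
    simp [formSymbol]
  have h := hle hF
  rw [← SetLike.mem_coe, Submodule.topologicalClosure_coe, mem_closure_iff_seq_limit] at h
  obtain ⟨f, hf, hlim⟩ := h
  choose c hc using hf
  refine ⟨c, ?_⟩
  have : (fun n => formSymbol ((c n).mapDomain fun i => (i.1, (i.2 : ℤ)))) = f := by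
    funext n; exact hc n
  rw [this]
  exact hlim

end Stationary

/-! ### The frequencies -/

theorem freq_one : freq 1 = 0 := by simp [freq]

theorem freq_injective : Function.Injective freq := by
  intro k n h
  apply PNat.coe_injective
  have hk := k.pos
  have hn := n.pos
  unfold freq at h
  rcases Nat.even_or_odd' (k : ℕ) with ⟨a, ha | ha⟩ <;>
    rcases Nat.even_or_odd' (n : ℕ) with ⟨c, hc | hc⟩ <;>
    rw [ha, hc] at h ⊢ <;>
    simp only [pow_add, pow_mul, neg_one_sq, one_pow, pow_one, one_mul] at h <;>
    omega

theorem freq_surjective : Function.Surjective freq := by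
  intro m
  rcases lt_trichotomy m 0 with h | h | h
  · refine ⟨⟨2 * m.natAbs + 1, by omega⟩, ?_⟩
    simp only [freq, PNat.mk_coe, pow_add, pow_mul, neg_one_sq, one_pow, pow_one, one_mul]
    omega
  · exact ⟨1, by rw [freq_one, h]⟩
  · refine ⟨⟨2 * m.natAbs, by omega⟩, ?_⟩
    simp only [freq, PNat.mk_coe, pow_mul, neg_one_sq, one_pow, one_mul]
    omega

/-- The frequencies enumerate the integers. -/
def freqEquiv : ℕ+ ≃ ℤ := Equiv.ofBijective freq ⟨freq_injective, freq_surjective⟩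

theorem swapIdx_involutive : Function.Involutive swapIdx := fun k =>
  freq_injective (by rw [freq_swapIdx, freq_swapIdx, neg_neg])

/-! ### The basis functions -/

theorem continuous_basisFun (T : ℝ) (k : ℕ+) : Continuous (basisFun T k) := by
  unfold basisFun; fun_prop

theorem conj_basisFun (T : ℝ) (k : ℕ+) (u : ℝ) :
    conj (basisFun T k u) = basisFun T (swapIdx k) u := by
  simp only [basisFun, map_mul, Complex.conj_ofReal, ← Complex.exp_conj, freq_swapIdx]
  congr 2
  simp only [map_mul, map_div₀, map_ofNat, Complex.conj_ofReal, Complex.conj_I, map_intCast]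
  push_cast; ring

theorem norm_basisFun (T : ℝ) (k : ℕ+) (u : ℝ) : ‖basisFun T k u‖ = (Real.sqrt T)⁻¹ := by
  rw [basisFun, norm_mul]
  have h : 2 * Real.pi * Complex.I * (freq k : ℂ) * u / T =
      ((2 * Real.pi * freq k * u / T : ℝ) : ℂ) * Complex.I := by push_cast; ring
  rw [h, Complex.norm_exp_ofReal_mul_I, mul_one, Complex.norm_real, Real.norm_eq_abs,
    abs_of_nonneg (by positivity)]

theorem integral_conj_basisFun_mul {T : ℝ} (hT : 0 < T) (k n : ℕ+) :
    ∫ u in (0 : ℝ)..T, conj (basisFun T k u) * basisFun T n u = if k = n then 1 else 0 := by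
  have hTc : (T : ℂ) ≠ 0 := by exact_mod_cast hT.ne'
  have h1 : ∀ u : ℝ, conj (basisFun T k u) * basisFun T n u =
      (T : ℂ)⁻¹ * Complex.exp ((2 * Real.pi * Complex.I * ((freq n - freq k : ℤ) : ℂ) / T) * u) := by
    intro u
    rw [conj_basisFun, basisFun, basisFun, freq_swapIdx, mul_mul_mul_comm, ← Complex.exp_add,
      ← Complex.ofReal_mul, ← mul_inv, Real.mul_self_sqrt hT.le, Complex.ofReal_inv]
    congr 2
    push_cast; ring
  simp only [h1]
  rw [intervalIntegral.integral_const_mul]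
  split_ifs with h
  · subst h
    simp [hTc]
  · have hf : ((freq n - freq k : ℤ) : ℂ) ≠ 0 := by
      rw [Int.cast_ne_zero, sub_ne_zero]
      exact fun h' => h (freq_injective h'.symm)
    have hc : 2 * Real.pi * Complex.I * ((freq n - freq k : ℤ) : ℂ) / T ≠ 0 := by
      have := Complex.two_pi_I_ne_zero
      positivity
    rw [integral_exp_mul_complex hc, div_mul_cancel₀ _ hTc]
    have h2 : Complex.exp (2 * Real.pi * Complex.I * ((freq n - freq k : ℤ) : ℂ)) = 1 := by
      rw [mul_comm]; exact Complex.exp_int_mul_two_pi_mul_I _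
    rw [h2]; simp

/-- Lebesgue measure on one period. -/
abbrev perMeasure (T : ℝ) : Measure ℝ := volume.restrict (Ioc 0 T)

section Fourier

variable {E : Type*} [NormedAddCommGroup E] [InnerProductSpace ℂ E] [CompleteSpace E]

theorem fourierCoef_eq {T : ℝ} (hT : 0 < T) (x : ℝ → E) (k : ℕ+) :
    fourierCoef T x k = ∫ v, conj (basisFun T k v) • x v ∂(perMeasure T) :=
  intervalIntegral.integral_of_le hT.le

theorem fourierCoef_congr {T : ℝ} (hT : 0 < T) {x y : ℝ → E} (h : x =ᵐ[perMeasure T] y) (k : ℕ+) :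
    fourierCoef T x k = fourierCoef T y k := by
  rw [fourierCoef_eq hT, fourierCoef_eq hT]
  exact integral_congr_ae (h.mono fun v hv => by simp only [hv])

theorem hasSum_sq_fourierCoef {T : ℝ} (hT : 0 < T) {f : ℝ → ℂ} (hf : MemLp f 2 (perMeasure T)) :
    HasSum (fun k => ‖fourierCoef T f k‖ ^ 2) (∫ v, ‖f v‖ ^ 2 ∂(perMeasure T)) := by
  have h := hasSum_sq_fourierCoeffOn hT hf
  rw [← freqEquiv.hasSum_iff] at h
  have h2 := h.mul_left T
  rw [sub_zero, smul_eq_mul, mul_inv_cancel_left₀ hT.ne', intervalIntegral.integral_of_le hT.le] at h2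
  refine h2.congr_fun fun k => ?_
  rw [Function.comp_apply, fourierCoeffOn_eq_integral, fourierCoef]
  have h3 : ∀ v : ℝ, conj (basisFun T k v) • f v = (((Real.sqrt T)⁻¹ : ℝ) : ℂ) *
      ((fourier (-freqEquiv k) (v : AddCircle (T - 0))) • f v) := by
    intro v
    rw [conj_basisFun, basisFun, freq_swapIdx, fourier_coe_apply, smul_eq_mul, smul_eq_mul,
      mul_assoc, sub_zero]
    rfl
  simp only [h3]
  rw [intervalIntegral.integral_const_mul, norm_mul, norm_smul, mul_pow, mul_pow, sub_zero,
    Complex.norm_real, Real.norm_eq_abs, sq_abs, Real.norm_eq_abs, sq_abs, inv_pow,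
    Real.sq_sqrt hT.le]
  field_simp

theorem memLp_basisFun_smul (T : ℝ) (k : ℕ+) (y : E) :
    MemLp (fun u => basisFun T k u • y) 2 (perMeasure T) := by
  refine MemLp.of_bound (by
    exact ((continuous_basisFun T k).smul continuous_const).aestronglyMeasurable)
    ((Real.sqrt T)⁻¹ * ‖y‖) (ae_of_all _ fun u => ?_)
  rw [norm_smul, norm_basisFun]

theorem inner_toLp_basisFun {T : ℝ} (hT : 0 < T) (k : ℕ+) (y : E) {x : ℝ → E}
    (hx : MemLp x 2 (perMeasure T)) :
    inner ℂ ((memLp_basisFun_smul T k y).toLp) (hx.toLp x) = inner ℂ y (fourierCoef T x k) := by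
  have hi : Integrable (fun v => conj (basisFun T k v) • x v) (perMeasure T) := by
    refine Integrable.bdd_smul (C := (Real.sqrt T)⁻¹) (hx.integrable (by norm_num)) ?_ ?_
    · exact (Complex.continuous_conj.comp (continuous_basisFun T k)).aestronglyMeasurable
    · exact ae_of_all _ fun u => by rw [RCLike.norm_conj, norm_basisFun]
  rw [L2.inner_def, fourierCoef_eq hT, ← integral_inner hi]
  refine integral_congr_ae ?_
  filter_upwards [(memLp_basisFun_smul T k y).coeFn_toLp, hx.coeFn_toLp] with v h1 h2
  rw [h1, h2, inner_smul_left, inner_smul_right]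

/-- Multiplication of the `k`-th basis function by a vector, as an isometry into `L²`. -/
def basisLp {T : ℝ} (hT : 0 < T) (k : ℕ+) : E →ₗᵢ[ℂ] Lp E 2 (perMeasure T) :=
  LinearMap.isometryOfInner
    { toFun := fun y => (memLp_basisFun_smul T k y).toLp
      map_add' := fun y z => by
        rw [← MemLp.toLp_add]
        refine MemLp.toLp_congr _ _ (ae_of_all _ fun u => ?_)
        simp only [Pi.add_apply, smul_add]
      map_smul' := fun c y => by
        rw [RingHom.id_apply, ← MemLp.toLp_const_smul]
        refine MemLp.toLp_congr _ _ (ae_of_all _ fun u => ?_)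
        simp only [Pi.smul_apply, smul_comm c] } (by
    intro y z
    change inner ℂ ((memLp_basisFun_smul T k y).toLp) ((memLp_basisFun_smul T k z).toLp) = _
    rw [inner_toLp_basisFun hT k y (memLp_basisFun_smul T k z)]
    congr 1
    unfold fourierCoef
    simp only [smul_smul]
    rw [intervalIntegral.integral_smul_const, integral_conj_basisFun_mul hT, if_pos rfl, one_smul])

theorem basisLp_apply {T : ℝ} (hT : 0 < T) (k : ℕ+) (y : E) :
    basisLp hT k y = (memLp_basisFun_smul T k y).toLp := rfl

theorem inner_basisLp {T : ℝ} (hT : 0 < T) (k : ℕ+) (y : E) (f : Lp E 2 (perMeasure T)) :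
    inner ℂ (basisLp hT k y) f = inner ℂ y (fourierCoef T f k) := by
  have h := inner_toLp_basisFun hT k y (Lp.memLp f)
  rwa [Lp.toLp_coeFn] at h

theorem orthogonalFamily_basisLp {T : ℝ} (hT : 0 < T) :
    OrthogonalFamily ℂ (fun _ : ℕ+ => E) (fun k => basisLp (E := E) hT k) := by
  intro k n hkn y z
  rw [basisLp_apply, basisLp_apply, inner_toLp_basisFun hT k y (memLp_basisFun_smul T n z)]
  unfold fourierCoef
  simp only [smul_smul]
  rw [intervalIntegral.integral_smul_const, integral_conj_basisFun_mul hT, if_neg hkn, zero_smul,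
    inner_zero_right]

/-- The sequence of Fourier coefficients of a square integrable function. -/
def fourierL {T : ℝ} (hT : 0 < T) : Lp E 2 (perMeasure T) →L[ℂ] lp (fun _ : ℕ+ => E) 2 :=
  (orthogonalFamily_basisLp (E := E) hT).linearIsometry.toContinuousLinearMap.adjoint

theorem fourierL_apply {T : ℝ} (hT : 0 < T) (f : Lp E 2 (perMeasure T)) (k : ℕ+) :
    fourierL hT f k = fourierCoef T f k := by
  refine ext_inner_left ℂ fun y => ?_
  have h : inner ℂ (lp.single 2 k y) (fourierL hT f) = inner ℂ y (fourierL hT f k) :=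
    lp.inner_single_left k y (fourierL hT f)
  rw [← inner_basisLp hT, ← h, fourierL, ContinuousLinearMap.adjoint_inner_right, LinearIsometry.coe_toContinuousLinearMap, OrthogonalFamily.linearIsometry_apply_single]

theorem norm_fourierL_le {T : ℝ} (hT : 0 < T) (f : Lp E 2 (perMeasure T)) :
    ‖fourierL hT f‖ ≤ ‖f‖ := by
  refine (ContinuousLinearMap.le_opNorm _ _).trans ?_
  refine mul_le_of_le_one_left (norm_nonneg _) ?_
  rw [fourierL, LinearIsometryEquiv.norm_map]
  exact LinearIsometry.norm_toContinuousLinearMap_le _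

theorem norm_sq_Lp_eq {T : ℝ} (f : Lp E 2 (perMeasure T)) :
    ‖f‖ ^ 2 = ∫ v, ‖f v‖ ^ 2 ∂(perMeasure T) := by
  apply Complex.ofReal_injective
  have h : inner ℂ f f = ((‖f‖ : ℂ)) ^ 2 := inner_self_eq_norm_sq_to_K f
  push_cast
  rw [← h, L2.inner_def, ← integral_complex_ofReal]
  refine integral_congr_ae (ae_of_all _ fun v => ?_)
  simp only [inner_self_eq_norm_sq_to_K]
  push_cast; rfl

/-- Scalar Parseval says that `f` and its projection onto the span of the basis have the same norm,
so they coincide. -/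
theorem hasSum_basisLp_fourierCoef {T : ℝ} (hT : 0 < T) (f : Lp ℂ 2 (perMeasure T)) :
    HasSum (fun k => basisLp hT k (fourierCoef T f k)) f := by
  set Ψ := (orthogonalFamily_basisLp (E := ℂ) hT).linearIsometry with hΨ
  have h1 : ‖fourierL hT f‖ ^ 2 = ‖f‖ ^ 2 := by
    rw [norm_sq_Lp_eq]
    refine (lp_two_hasSum_norm_sq (fourierL hT f)).unique ?_
    simp only [fourierL_apply]
    exact hasSum_sq_fourierCoef hT (Lp.memLp f)
  have h2 : inner ℂ (Ψ (fourierL hT f)) f = inner ℂ (fourierL hT f) (fourierL hT f) := by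
    conv_rhs => rw [fourierL]
    rw [ContinuousLinearMap.adjoint_inner_right]
    rfl
  have h3 : Ψ (fourierL hT f) = f := by
    rw [← sub_eq_zero, ← norm_eq_zero, ← sq_eq_zero_iff, @norm_sub_sq ℂ, h2, LinearIsometry.norm_map,
      inner_self_eq_norm_sq, h1]
    ring
  have h4 := (orthogonalFamily_basisLp (E := ℂ) hT).hasSum_linearIsometry (fourierL hT f)
  rw [← hΨ, h3] at h4
  exact h4.congr_fun fun k => by rw [fourierL_apply]

/-- Expansion of the scalar factor suffices; no completeness is needed for vector functions. The
pairing is bilinear, without conjugation, so the coefficient of frequency `-n` meets that of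
frequency `n`: hence `swapIdx`. -/
theorem hasSum_fourierCoef_smul {T : ℝ} (hT : 0 < T) {f : ℝ → ℂ} {x : ℝ → E}
    (hf : MemLp f 2 (perMeasure T)) (hx : MemLp x 2 (perMeasure T)) :
    HasSum (fun k => fourierCoef T f (swapIdx k) • fourierCoef T x k)
      (∫ v, f v • x v ∂(perMeasure T)) := by
  have hpair : ∀ g : ℝ → ℂ, ∀ hg : MemLp g 2 (perMeasure T),
      (ContinuousLinearMap.lpPairing (perMeasure T) 2 2 (ContinuousLinearMap.lsmul ℂ ℂ (E := E)))
        (hg.toLp g) (hx.toLp x) = ∫ v, g v • x v ∂(perMeasure T) := by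
    intro g hg
    rw [ContinuousLinearMap.lpPairing_eq_integral]
    refine integral_congr_ae ?_
    filter_upwards [hg.coeFn_toLp, hx.coeFn_toLp] with v h1 h2
    rw [h1, h2, ContinuousLinearMap.lsmul_apply]
  have h := (hasSum_basisLp_fourierCoef hT (hf.toLp f)).mapL
    ((ContinuousLinearMap.lpPairing (perMeasure T) 2 2
      (ContinuousLinearMap.lsmul ℂ ℂ (E := E))).flip (hx.toLp x))
  simp only [ContinuousLinearMap.flip_apply, basisLp_apply, hpair] at h
  rw [← (Equiv.ofBijective swapIdx swapIdx_involutive.bijective).hasSum_iff] at h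
  refine h.congr_fun fun k => ?_
  simp only [Function.comp_apply, Equiv.ofBijective_apply]
  rw [fourierCoef_congr hT hf.coeFn_toLp, fourierCoef_eq hT x, ← integral_smul]
  refine integral_congr_ae (ae_of_all _ fun v => ?_)
  simp only [conj_basisFun, smul_eq_mul, smul_smul]
  rw [mul_comm]

end Fourier

/-! ### Integrals over one period -/

section Period

variable {E : Type*} [NormedAddCommGroup E] [InnerProductSpace ℂ E] [CompleteSpace E]

theorem restrict_Ico_eq_perMeasure (T : ℝ) : volume.restrict (Ico 0 T) = perMeasure T :=
  Measure.restrict_congr_set Ico_ae_eq_Ioc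

theorem memLp_two_of_lintegral_lt_top {α F : Type*} [MeasurableSpace α] [NormedAddCommGroup F]
    {ν : Measure α} {x : α → F} (hx : AEStronglyMeasurable x ν) (h : ∫⁻ v, ‖x v‖ₑ ^ 2 ∂ν < ⊤) :
    MemLp x 2 ν := by
  refine ⟨hx, (eLpNorm_lt_top_iff_lintegral_rpow_enorm_lt_top (by norm_num) (by norm_num)).2 ?_⟩
  simpa using h

theorem lintegral_enorm_sq_eq {T : ℝ} {x : ℝ → E} (hx : MemLp x 2 (perMeasure T)) :
    ∫⁻ v, ‖x v‖ₑ ^ 2 ∂(perMeasure T) = ENNReal.ofReal (‖hx.toLp x‖ ^ 2) := by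
  have h1 : ‖hx.toLp x‖ ^ 2 = ∫ v, ‖x v‖ ^ 2 ∂(perMeasure T) := by
    rw [norm_sq_Lp_eq]
    exact integral_congr_ae (hx.coeFn_toLp.mono fun v hv => by simp only [hv])
  rw [h1, ofReal_integral_eq_lintegral_ofReal]
  · refine lintegral_congr fun v => ?_
    rw [ENNReal.ofReal_pow (norm_nonneg _), ofReal_norm]
  · exact (memLp_two_iff_integrable_sq_norm hx.1).1 hx
  · exact ae_of_all _ fun v => sq_nonneg _

/-- Both integrals are taken out of the inner product one after the other, so no measurability on
the product space is required. -/
theorem inner_integral_integral_congr {α : Type*} [MeasurableSpace α] {ν : Measure α}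
    {f g f' g' : α → E} (hf : Integrable f ν) (hg : Integrable g ν) (hf' : Integrable f' ν)
    (hg' : Integrable g' ν) (h : ∀ u v, inner ℂ (f u) (g v) = inner ℂ (f' u) (g' v)) :
    inner ℂ (∫ u, f u ∂ν) (∫ v, g v ∂ν) = inner ℂ (∫ u, f' u ∂ν) (∫ v, g' v ∂ν) := by
  rw [← integral_inner hg, ← integral_inner hg']
  refine integral_congr_ae (ae_of_all _ fun v => ?_)
  simp only
  rw [← inner_conj_symm, ← integral_inner hf, ← inner_conj_symm _ (g' v), ← integral_inner hf']
  congr 1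
  refine integral_congr_ae (ae_of_all _ fun u => ?_)
  simp only
  rw [← inner_conj_symm, h, inner_conj_symm]

theorem integrable_conj_basisFun_smul {T : ℝ} {x : ℝ → E} (hx : MemLp x 2 (perMeasure T))
    (k : ℕ+) : Integrable (fun v => conj (basisFun T k v) • x v) (perMeasure T) := by
  refine Integrable.bdd_smul (hx.integrable (by norm_num)) (Real.sqrt T)⁻¹ ?_ ?_
  · exact (Complex.continuous_conj.comp (continuous_basisFun T k)).aestronglyMeasurable
  · exact ae_of_all _ fun u => by rw [RCLike.norm_conj, norm_basisFun]

theorem inner_fourierCoef_congr {T : ℝ} (hT : 0 < T) {x y x' y' : ℝ → E}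
    (hx : MemLp x 2 (perMeasure T)) (hy : MemLp y 2 (perMeasure T))
    (hx' : MemLp x' 2 (perMeasure T)) (hy' : MemLp y' 2 (perMeasure T))
    (h : ∀ u v, inner ℂ (x u) (y v) = inner ℂ (x' u) (y' v)) (k n : ℕ+) :
    inner ℂ (fourierCoef T x k) (fourierCoef T y n) =
      inner ℂ (fourierCoef T x' k) (fourierCoef T y' n) := by
  rw [fourierCoef_eq hT, fourierCoef_eq hT, fourierCoef_eq hT, fourierCoef_eq hT]
  refine inner_integral_integral_congr (integrable_conj_basisFun_smul hx k)
    (integrable_conj_basisFun_smul hy n) (integrable_conj_basisFun_smul hx' k)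
    (integrable_conj_basisFun_smul hy' n) fun u v => ?_
  simp only [inner_smul_left, inner_smul_right, h]

theorem rpow_integral_norm_eq {F : Type*} [NormedAddCommGroup F] [InnerProductSpace ℂ F]
    [CompleteSpace F] {T : ℝ} {y : ℝ → F} (hy : MemLp y 2 (perMeasure T)) :
    (∫ v, ‖‖y v‖‖ ^ (2 : ℝ) ∂(perMeasure T)) ^ (1 / (2 : ℝ)) = ‖hy.toLp y‖ := by
  have h2 : ‖hy.toLp y‖ ^ 2 = ∫ v, ‖‖y v‖‖ ^ (2 : ℝ) ∂(perMeasure T) := by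
    rw [norm_sq_Lp_eq]
    exact integral_congr_ae (hy.coeFn_toLp.mono fun v hv => by simp [hv])
  rw [← h2, ← Real.sqrt_eq_rpow, Real.sqrt_sq (norm_nonneg _)]

theorem integral_norm_mul_norm_le {T : ℝ} {f : ℝ → ℂ} {x : ℝ → E} (hf : MemLp f 2 (perMeasure T))
    (hx : MemLp x 2 (perMeasure T)) :
    ∫ v, ‖f v‖ * ‖x v‖ ∂(perMeasure T) ≤ ‖hf.toLp f‖ * ‖hx.toLp x‖ := by
  have h := integral_mul_norm_le_Lp_mul_Lq (μ := perMeasure T) (p := 2) (q := 2)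
    (f := fun v => ‖f v‖) (g := fun v => ‖x v‖) (by norm_num [Real.holderConjugate_iff])
    (by simpa using hf.norm) (by simpa using hx.norm)
  rw [rpow_integral_norm_eq hf, rpow_integral_norm_eq hx] at h
  simpa only [norm_norm] using h

end Period

/-! ### The generated sequence -/

section Generated

variable {Ω : Type*} [MeasurableSpace Ω] {μ : Measure Ω} {d τ : ℕ} {T P : ℝ}
  {ξ : ℝ → Lp ℂ 2 μ}

theorem MemY.inner_add_int (hξ : MemY d τ T P ξ) (s t : ℝ) (j : ℤ) :
    inner ℂ (increment d (τ * T) ξ (s + j * T)) (increment d (τ * T) ξ (t + j * T)) =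
      inner ℂ (increment d (τ * T) ξ s) (increment d (τ * T) ξ t) := by
  have h : ∀ (m : ℕ) (s t : ℝ),
      inner ℂ (increment d (τ * T) ξ (s + m * T)) (increment d (τ * T) ξ (t + m * T)) =
      inner ℂ (increment d (τ * T) ξ s) (increment d (τ * T) ξ t) := by
    intro m
    induction m with
    | zero => simp
    | succ m ih =>
      intro s t
      rw [← ih s t, Nat.cast_succ, add_mul, one_mul, ← add_assoc, ← add_assoc]
      exact hξ.periodic _ _
  obtain ⟨m, rfl | rfl⟩ := j.eq_nat_or_neg
  · exact_mod_cast h m s t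
  · have := h m (s + (-(m : ℤ) : ℤ) * T) (t + (-(m : ℤ) : ℤ) * T)
    rw [← this]
    push_cast
    simp only [neg_mul, neg_add_cancel_right]

theorem MemY.norm_add_int (hξ : MemY d τ T P ξ) (s : ℝ) (j : ℤ) :
    ‖increment d (τ * T) ξ (s + j * T)‖ = ‖increment d (τ * T) ξ s‖ := by
  have h := hξ.inner_add_int s s j
  rw [inner_self_eq_norm_sq_to_K, inner_self_eq_norm_sq_to_K] at h
  have h2 : ‖increment d (τ * T) ξ (s + j * T)‖ ^ 2 = ‖increment d (τ * T) ξ s‖ ^ 2 := by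
    apply Complex.ofReal_injective; push_cast; exact h
  exact (pow_left_inj₀ (norm_nonneg _) (norm_nonneg _) two_ne_zero).1 h2

/-- The restriction of the increment process to a period. -/
def periodPart (d τ : ℕ) (T : ℝ) (ξ : ℝ → Lp ℂ 2 μ) (j : ℤ) (u : ℝ) : Lp ℂ 2 μ :=
  increment d (τ * T) ξ (u + j * T)

theorem gen_eq (k : ℕ+) (j : ℤ) : gen d τ T ξ k j = fourierCoef T (periodPart d τ T ξ j) k := rfl

theorem MemY.memLp_periodPart (hξ : MemY d τ T P ξ) (j : ℤ) :
    MemLp (periodPart d τ T ξ j) 2 (perMeasure T) := by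
  refine memLp_two_of_lintegral_lt_top ?_ ?_
  · have h := hξ.aesm.comp_quasiMeasurePreserving
      (measurePreserving_add_right volume ((j : ℝ) * T)).quasiMeasurePreserving
    exact h.restrict
  · have h : ∀ v, ‖periodPart d τ T ξ j v‖ₑ = ‖increment d (τ * T) ξ v‖ₑ := fun v => by
      rw [← ofReal_norm, ← ofReal_norm, periodPart, hξ.norm_add_int]
    simp only [h]
    rw [← restrict_Ico_eq_perMeasure]
    exact hξ.bound.trans_lt ENNReal.ofReal_lt_top

theorem MemY.norm_toLp_periodPart_sq_le (hξ : MemY d τ T P ξ) (hP : 0 ≤ P) (j : ℤ) :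
    ‖(hξ.memLp_periodPart j).toLp _‖ ^ 2 ≤ P := by
  have h : ∀ v, ‖periodPart d τ T ξ j v‖ₑ = ‖increment d (τ * T) ξ v‖ₑ := fun v => by
    rw [← ofReal_norm, ← ofReal_norm, periodPart, hξ.norm_add_int]
  rw [← ENNReal.ofReal_le_ofReal_iff hP, ← lintegral_enorm_sq_eq]
  simp only [h]
  rw [← restrict_Ico_eq_perMeasure]
  exact hξ.bound

theorem MemY.fourierL_periodPart (hT : 0 < T) (hξ : MemY d τ T P ξ) (k : ℕ+) (j : ℤ) :
    fourierL hT ((hξ.memLp_periodPart j).toLp _) k = gen d τ T ξ k j := by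
  rw [fourierL_apply, gen_eq]
  exact fourierCoef_congr hT (hξ.memLp_periodPart j).coeFn_toLp k

/-- Periodic correlation gives equal inner products at all pairs of points of the two periods, and
this is inherited by Fourier coefficients. -/
theorem MemY.isStationary_gen (hT : 0 < T) (hξ : MemY d τ T P ξ) :
    IsStationary (gen d τ T ξ) where
  inner_succ k n j l := by
    simp only [gen_eq]
    refine inner_fourierCoef_congr hT (hξ.memLp_periodPart _) (hξ.memLp_periodPart _)
      (hξ.memLp_periodPart _) (hξ.memLp_periodPart _) (fun u v => ?_) k n
    simp only [periodPart]
    rw [Int.cast_add, Int.cast_add, Int.cast_one, add_mul, one_mul, add_mul, one_mul, ← add_assoc,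
      ← add_assoc]
    exact hξ.periodic _ _
  summable := by
    have h := (lp_two_hasSum_norm_sq (fourierL hT ((hξ.memLp_periodPart 0).toLp _))).summable
    simpa only [hξ.fourierL_periodPart hT] using h

/-- Bessel's inequality for functions with values in a Hilbert space. -/
theorem MemY.power_gen_le (hT : 0 < T) (hP : 0 ≤ P) (hξ : MemY d τ T P ξ) :
    power (gen d τ T ξ) ≤ P := by
  have h := (lp_two_hasSum_norm_sq (fourierL hT ((hξ.memLp_periodPart 0).toLp _))).tsum_eq
  simp only [hξ.fourierL_periodPart hT] at h
  rw [power, h]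
  exact (pow_le_pow_left₀ (norm_nonneg _) (norm_fourierL_le hT _) 2).trans
    (hξ.norm_toLp_periodPart_sq_le hP 0)

/-! ### The functional -/

variable {b : ℝ → ℂ}

/-- The coefficient vectors of the weight function as elements of `ℓ²`. -/
def coefSeq (hcoef : CoefCondition T b) (j : ℕ) : lp (fun _ : ℕ+ => ℂ) 2 :=
  lpTwoMk (bVec T b j) (hcoef.sq_summable j)

theorem norm_coefSeq (hcoef : CoefCondition T b) (j : ℕ) : ‖coefSeq hcoef j‖ = bNorm T b j := by
  have h := (lp_two_hasSum_norm_sq (coefSeq hcoef j)).tsum_eq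
  rw [bNorm, ← Real.sqrt_sq (norm_nonneg (coefSeq hcoef j)), ← h]
  rfl

theorem isSmoothSymbol_coefSeq (hcoef : CoefCondition T b) : IsSmoothSymbol (coefSeq hcoef) := by
  have h := hcoef.weighted_summable
  simpa only [IsSmoothSymbol, norm_coefSeq] using h

/-- The restriction of the weight function to a period. -/
def weightPart (T : ℝ) (b : ℝ → ℂ) (j : ℕ) (u : ℝ) : ℂ := b (u + j * T)

/-- Parseval; the permutation of the indices in `bVec` does not affect the sum of squares. -/
theorem norm_toLp_weightPart (hT : 0 < T) (hcoef : CoefCondition T b) {j : ℕ}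
    (hb : MemLp (weightPart T b j) 2 (perMeasure T)) : ‖hb.toLp _‖ = bNorm T b j := by
  have h1 := hasSum_sq_fourierCoef hT hb
  rw [← (Equiv.ofBijective swapIdx swapIdx_involutive.bijective).hasSum_iff] at h1
  have h2 : ‖hb.toLp _‖ ^ 2 = ∫ v, ‖weightPart T b j v‖ ^ 2 ∂(perMeasure T) := by
    rw [norm_sq_Lp_eq]
    exact integral_congr_ae (hb.coeFn_toLp.mono fun v hv => by simp only [hv])
  rw [← norm_coefSeq hcoef]
  refine (pow_left_inj₀ (norm_nonneg _) (norm_nonneg _) two_ne_zero).1 ?_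
  rw [h2]
  exact h1.unique (lp_two_hasSum_norm_sq (coefSeq hcoef j))

theorem monotone_natCast_mul (hT : 0 < T) : Monotone fun n : ℕ => (n : ℝ) * T := fun _ _ h =>
  mul_le_mul_of_nonneg_right (Nat.cast_le.2 h) hT.le

theorem iUnion_Ioc_eq_Ioi (hT : 0 < T) :
    ⋃ j : ℕ, Ioc ((j : ℝ) * T) (((Order.succ j : ℕ) : ℝ) * T) = Ioi 0 := by
  have h := iUnion_Ioc_map_succ_eq_Ioi (f := fun n : ℕ => (n : ℝ) * T)
    (fun n => monotone_natCast_mul hT bot_le) ?_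
  · simpa using h
  · rintro ⟨C, hC⟩
    obtain ⟨n, hn⟩ := exists_nat_gt (C / T)
    have h1 := hC ⟨n, rfl⟩
    rw [div_lt_iff₀ hT] at hn
    simp only at h1
    linarith

theorem setIntegral_Ioc_eq {E : Type*} [NormedAddCommGroup E] [NormedSpace ℝ E] (hT : 0 < T)
    (f : ℝ → E) (j : ℕ) :
    ∫ t in Ioc ((j : ℝ) * T) (((Order.succ j : ℕ) : ℝ) * T), f t =
      ∫ u, f (u + j * T) ∂(perMeasure T) := by
  rw [← intervalIntegral.integral_of_le (monotone_natCast_mul hT (Order.le_succ j)),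
    ← intervalIntegral.integral_of_le hT.le, intervalIntegral.integral_comp_add_right]
  congr 1
  · simp
  · simp; ring

theorem MemY.integrable_weight_smul (hξ : MemY d τ T P ξ) {j : ℕ}
    (hb : MemLp (weightPart T b j) 2 (perMeasure T)) :
    Integrable (fun u => b (u + j * T) • increment d (τ * T) ξ (u + j * T)) (perMeasure T) := by
  have h : MemLp (weightPart T b j • periodPart d τ T ξ j) 1 (perMeasure T) :=
    MemLp.smul (hξ.memLp_periodPart j) hb
  have h1 := memLp_one_iff_integrable.1 h
  refine h1.congr (ae_of_all _ fun u => ?_)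
  simp [weightPart, periodPart]

theorem MemY.integrableOn_Ioc (hT : 0 < T) (hξ : MemY d τ T P ξ) {j : ℕ}
    (hb : MemLp (weightPart T b j) 2 (perMeasure T)) :
    IntegrableOn (fun t => b t • increment d (τ * T) ξ t)
      (Ioc ((j : ℝ) * T) (((Order.succ j : ℕ) : ℝ) * T)) := by
  rw [← intervalIntegrable_iff_integrableOn_Ioc_of_le (monotone_natCast_mul hT (Order.le_succ j))]
  have h := (intervalIntegrable_iff_integrableOn_Ioc_of_le hT.le).2 (hξ.integrable_weight_smul hb)
  have h1 := (IntervalIntegrable.comp_add_right_iff (c := (j : ℝ) * T)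
    (f := fun t => b t • increment d (τ * T) ξ t)).1 h
  convert h1 using 1
  · simp
  · simp; ring

/-- Cauchy-Schwarz bounds the integral of the norm over the `j`-th period by `‖b⃗_j‖ √P`, which is
summable in `j`. -/
theorem MemY.integrableOn_Ioi (hT : 0 < T) (hP : 0 ≤ P) (hξ : MemY d τ T P ξ)
    (hb : ∀ j, MemLp (weightPart T b j) 2 (perMeasure T)) (hcoef : CoefCondition T b) :
    IntegrableOn (fun t => b t • increment d (τ * T) ξ t) (Ioi 0) := by
  rw [← iUnion_Ioc_eq_Ioi hT]
  refine integrableOn_iUnion_of_summable_integral_norm (fun j => hξ.integrableOn_Ioc hT (hb j)) ?_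
  refine Summable.of_nonneg_of_le (fun j => integral_nonneg fun _ => norm_nonneg _) (fun j => ?_)
    (hcoef.summable.mul_right (Real.sqrt P))
  rw [setIntegral_Ioc_eq hT]
  simp only [norm_smul]
  refine (integral_norm_mul_norm_le (hb j) (hξ.memLp_periodPart j)).trans ?_
  rw [norm_toLp_weightPart hT hcoef]
  refine mul_le_mul_of_nonneg_left ?_ (Real.sqrt_nonneg _)
  exact Real.le_sqrt_of_sq_le (hξ.norm_toLp_periodPart_sq_le hP j)

/-- Period by period, the integral is the bilinear Fourier pairing, that is, the `j`-th term of the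
symbol evaluated at the generated array. -/
theorem MemY.functionalB_eq (hT : 0 < T) (hP : 0 ≤ P) (hξ : MemY d τ T P ξ)
    (hb : ∀ j, MemLp (weightPart T b j) 2 (perMeasure T)) (hcoef : CoefCondition T b) :
    functionalB d τ T b ξ = trigEval (gen d τ T ξ)
      ⟨_, symbol_mem_trigSpace (isSmoothSymbol_coefSeq hcoef)⟩ := by
  have hint := hξ.integrableOn_Ioi hT hP hb hcoef
  rw [← iUnion_Ioc_eq_Ioi hT] at hint
  have h := hasSum_integral_iUnion (fun j : ℕ => measurableSet_Ioc)
    (monotone_natCast_mul hT).pairwise_disjoint_on_Ioc_succ hint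
  rw [iUnion_Ioc_eq_Ioi hT] at h
  refine h.unique ((hasSum_trigEval_symbol (isSmoothSymbol_coefSeq hcoef) _).congr_fun fun j => ?_)
  rw [setIntegral_Ioc_eq hT]
  have h1 := hasSum_fourierCoef_smul hT (hb j) (hξ.memLp_periodPart j)
  have h2 := hasSum_trigEval_trigMono (hξ.isStationary_gen hT) (j : ℤ) (coefSeq hcoef j)
  exact h1.unique h2

end Generated

/-! ### Linear estimates -/

section Estimates

variable {Ω : Type*} [MeasurableSpace Ω] {μ : Measure Ω} {d τ : ℕ} {T P : ℝ}
  {ξ : ℝ → Lp ℂ 2 μ} {b : ℝ → ℂ}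

theorem gen_mem_pastSpace (ξ : ℝ → Lp ℂ 2 μ) (k : ℕ+) {l j : ℤ} (h : l ≤ j) :
    gen d τ T ξ k l ∈ pastSpace d τ T ξ j :=
  Submodule.le_topologicalClosure _ (Submodule.subset_span ⟨k, l, h, rfl⟩)

theorem isClosed_pastSpace (ξ : ℝ → Lp ℂ 2 μ) (j : ℤ) :
    IsClosed (pastSpace d τ T ξ j : Set (Lp ℂ 2 μ)) :=
  Submodule.isClosed_topologicalClosure _

instance (ξ : ℝ → Lp ℂ 2 μ) (j : ℤ) : CompleteSpace (pastSpace d τ T ξ j) :=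
  (isClosed_pastSpace ξ j).completeSpace_coe

theorem FiniteRule.apply_mem (c : FiniteRule) (ξ : ℝ → Lp ℂ 2 μ) :
    FiniteRule.apply d τ T c ξ ∈ pastSpace d τ T ξ (-1) :=
  Submodule.sum_mem _ fun i _ => Submodule.smul_mem _ _
    (gen_mem_pastSpace ξ i.1 (Int.le_sub_one_of_lt i.2.2))

theorem LinearEstimate.IsValue.mem {h : LinearEstimate} {Z : Lp ℂ 2 μ}
    (hZ : LinearEstimate.IsValue d τ T h ξ Z) : Z ∈ pastSpace d τ T ξ (-1) :=
  (isClosed_pastSpace ξ (-1)).mem_of_tendsto hZ (Eventually.of_forall fun n => (h n).apply_mem ξ)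

theorem LinearEstimate.IsValue.mse_eq {h : LinearEstimate} {Z : Lp ℂ 2 μ}
    (hZ : LinearEstimate.IsValue d τ T h ξ Z) :
    mse d τ T b ξ h = ‖functionalB d τ T b ξ - Z‖ₑ ^ 2 := by
  refine le_antisymm (iInf₂_le Z hZ) (le_iInf₂ fun Z' hZ' => ?_)
  rw [tendsto_nhds_unique hZ hZ']

theorem exists_isValue_of_mem {Z : Lp ℂ 2 μ} (hZ : Z ∈ pastSpace d τ T ξ (-1)) :
    ∃ h : LinearEstimate, LinearEstimate.IsValue d τ T h ξ Z := by
  have hle : Submodule.span ℂ {x | ∃ (k : ℕ+) (l : ℤ), l ≤ -1 ∧ x = gen d τ T ξ k l} ≤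
      LinearMap.range (Finsupp.linearCombination ℂ
        (fun i : ℕ+ × {j : ℤ // j < 0} => gen d τ T ξ i.1 i.2)) := by
    refine Submodule.span_le.2 ?_
    rintro x ⟨k, l, hl, rfl⟩
    exact ⟨Finsupp.single (k, ⟨l, by omega⟩) 1, by simp⟩
  obtain ⟨z, hz, hlim⟩ := mem_closure_iff_seq_limit.1
    (show Z ∈ closure (Submodule.span ℂ
      {x | ∃ (k : ℕ+) (l : ℤ), l ≤ -1 ∧ x = gen d τ T ξ k l} : Set (Lp ℂ 2 μ)) from hZ)
  choose c hc using fun n => hle (hz n)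
  refine ⟨c, ?_⟩
  rw [LinearEstimate.IsValue]
  convert hlim using 2 with n
  rw [← hc n, Finsupp.linearCombination_apply]
  rfl

/-- The error of the optimal linear estimate. -/
def predErr (d τ : ℕ) (T : ℝ) (b : ℝ → ℂ) (ξ : ℝ → Lp ℂ 2 μ) : Lp ℂ 2 μ :=
  functionalB d τ T b ξ - (pastSpace d τ T ξ (-1)).starProjection (functionalB d τ T b ξ)

theorem norm_predErr_le {Z : Lp ℂ 2 μ} (hZ : Z ∈ pastSpace d τ T ξ (-1)) :
    ‖predErr d τ T b ξ‖ ≤ ‖functionalB d τ T b ξ - Z‖ := by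
  rw [predErr, Submodule.starProjection_minimal]
  exact ciInf_le ⟨0, by rintro _ ⟨z, rfl⟩; exact norm_nonneg _⟩
    (⟨Z, hZ⟩ : pastSpace d τ T ξ (-1))

theorem enorm_predErr_sq_le_mse (h : LinearEstimate) :
    ‖predErr d τ T b ξ‖ₑ ^ 2 ≤ mse d τ T b ξ h := by
  refine le_iInf₂ fun Z hZ => pow_le_pow_left₀ (zero_le) ?_ 2
  rw [← ofReal_norm, ← ofReal_norm]
  exact ENNReal.ofReal_le_ofReal (norm_predErr_le hZ.mem)

theorem exists_mse_eq_enorm_predErr_sq :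
    ∃ h : LinearEstimate, mse d τ T b ξ h = ‖predErr d τ T b ξ‖ₑ ^ 2 := by
  obtain ⟨h, hh⟩ := exists_isValue_of_mem (d := d) (τ := τ) (T := T) (ξ := ξ)
    (Submodule.starProjection_apply_mem (pastSpace d τ T ξ (-1)) (functionalB d τ T b ξ))
  exact ⟨h, hh.mse_eq⟩

theorem minMse_eq (d τ : ℕ) (T : ℝ) (b : ℝ → ℂ) (ξ : ℝ → Lp ℂ 2 μ) :
    minMse d τ T b ξ = ‖predErr d τ T b ξ‖ₑ ^ 2 := by
  obtain ⟨h, hh⟩ := exists_mse_eq_enorm_predErr_sq (d := d) (τ := τ) (T := T) (ξ := ξ) (b := b)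
  exact le_antisymm ((iInf_le _ h).trans hh.le) (le_iInf enorm_predErr_sq_le_mse)

theorem exists_mse_eq_minMse (d τ : ℕ) (T : ℝ) (b : ℝ → ℂ) (ξ : ℝ → Lp ℂ 2 μ) :
    ∃ h : LinearEstimate, mse d τ T b ξ h = minMse d τ T b ξ := by
  rw [minMse_eq]; exact exists_mse_eq_enorm_predErr_sq

theorem minMse_le_mse (ξ : ℝ → Lp ℂ 2 μ) (h : LinearEstimate) :
    minMse d τ T b ξ ≤ mse d τ T b ξ h := iInf_le _ h

theorem FiniteRule.apply_eq_formEval (c : FiniteRule) (ξ : ℝ → Lp ℂ 2 μ) :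
    FiniteRule.apply d τ T c ξ =
      formEval (gen d τ T ξ) (c.mapDomain fun i => (i.1, (i.2 : ℤ))) := by
  rw [formEval, Finsupp.linearCombination_mapDomain, Finsupp.linearCombination_apply]
  rfl

/-- A single estimate which is good for all stationary generated sequences. -/
theorem exists_uniform_estimate (hT : 0 < T) (hcoef : CoefCondition T b) :
    ∃ (h₀ : LinearEstimate) (F : trigSpace ℕ+),
      ‖(⟨_, symbol_mem_trigSpace (isSmoothSymbol_coefSeq hcoef)⟩ : trigSpace ℕ+) - F‖ ≤
        ‖hankel (coefSeq hcoef)‖ ∧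
      ∀ {Ω : Type*} [MeasurableSpace Ω] {μ : Measure Ω} {d τ : ℕ} {P : ℝ} {ξ : ℝ → Lp ℂ 2 μ},
        MemY d τ T P ξ → LinearEstimate.IsValue d τ T h₀ ξ (trigEval (gen d τ T ξ) F) := by
  obtain ⟨F, hF, hle⟩ := exists_negTrig_norm_sub_le (isSmoothSymbol_coefSeq hcoef)
  obtain ⟨c, hc⟩ := exists_seq_of_mem_negTrig hF
  have hFm : F ∈ trigSpace ℕ+ := (Submodule.isClosed_topologicalClosure _).mem_of_tendsto hc
    (Eventually.of_forall fun n => (formSymbolR _).2)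
  refine ⟨c, ⟨F, hFm⟩, ?_, fun {Ω _ μ d τ P ξ} hξ => ?_⟩
  · exact (ContinuousMap.norm_le (symbol (coefSeq hcoef) - F)
      (norm_nonneg (hankel (coefSeq hcoef)))).2 hle
  · have h1 : Tendsto (fun n => formSymbolR ((c n).mapDomain fun i => (i.1, (i.2 : ℤ)))) atTop
        (𝓝 (⟨F, hFm⟩ : trigSpace ℕ+)) := tendsto_subtype_rng.2 hc
    have h2 := ((trigEval (gen d τ T ξ)).continuous.tendsto _).comp h1
    refine h2.congr fun n => ?_
    rw [Function.comp_apply, trigEval_formSymbolR (hξ.isStationary_gen hT),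
      FiniteRule.apply_eq_formEval]

/-- The least bound for the optimal error over the class, provided by the norm of the Hankel
operator. -/
theorem exists_mse_le (hT : 0 < T) (hP : 0 ≤ P)
    (hb : ∀ j, MemLp (weightPart T b j) 2 (perMeasure T)) (hcoef : CoefCondition T b) :
    ∃ h₀ : LinearEstimate, ∀ {Ω : Type*} [MeasurableSpace Ω] {μ : Measure Ω} {d τ : ℕ}
      {ξ : ℝ → Lp ℂ 2 μ}, MemY d τ T P ξ →
        mse d τ T b ξ h₀ ≤ ENNReal.ofReal (P * ‖hankel (coefSeq hcoef)‖ ^ 2) := by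
  obtain ⟨h₀, F, hF, hval⟩ := exists_uniform_estimate hT hcoef
  refine ⟨h₀, fun {Ω _ μ d τ ξ} hξ => ?_⟩
  rw [(hval hξ).mse_eq, hξ.functionalB_eq hT hP hb hcoef, ← map_sub, ← ofReal_norm,
    ← ENNReal.ofReal_pow (norm_nonneg _)]
  refine ENNReal.ofReal_le_ofReal ?_
  have h1 := norm_trigEval_le (hξ.isStationary_gen hT)
    (⟨_, symbol_mem_trigSpace (isSmoothSymbol_coefSeq hcoef)⟩ - F)
  -- The error is the evaluation of `symbol - F`: squared supremum norm at most `ν²`, power at most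
  -- `P`.
  refine (pow_le_pow_left₀ (norm_nonneg _) h1 2).trans ?_
  rw [mul_pow, Real.sq_sqrt (power_nonneg _)]
  exact mul_le_mul (hξ.power_gen_le hT hP) (pow_le_pow_left₀ (norm_nonneg _) hF 2) (sq_nonneg _) hP

end Estimates

/-! ### Eigenvalues of `A A†` -/

section Eigen

variable {E F : Type*} [NormedAddCommGroup E] [InnerProductSpace ℂ E] [CompleteSpace E]
  [NormedAddCommGroup F] [InnerProductSpace ℂ F] [CompleteSpace F]

theorem isSelfAdjoint_comp_adjoint (A : E →L[ℂ] F) : IsSelfAdjoint (A ∘L A.adjoint) := by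
  rw [ContinuousLinearMap.isSelfAdjoint_iff', ContinuousLinearMap.adjoint_comp,
    ContinuousLinearMap.adjoint_adjoint]

theorem comp_adjoint_apply_eq_iff (A : E →L[ℂ] F) (y : F) :
    (A ∘L A.adjoint) y = ((‖A‖ ^ 2 : ℝ) : ℂ) • y ↔ ‖A.adjoint y‖ = ‖A‖ * ‖y‖ := by
  have hn : ‖A.adjoint‖ = ‖A‖ := LinearIsometryEquiv.norm_map _ _
  constructor
  · intro h
    refine norm_eq_of_adjoint_apply_eq A.adjoint (norm_nonneg _) ?_
    rw [ContinuousLinearMap.adjoint_adjoint]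
    simpa using h
  · intro h
    rw [← hn] at h
    have h1 := adjoint_apply_eq_of_norm_eq A.adjoint h
    rw [ContinuousLinearMap.adjoint_adjoint, hn] at h1
    simpa using h1

/-- Compactness provides a maximizing vector of `A†`, which is an eigenvector for `‖A‖²`; no
eigenvalue exceeds this since `x ‖u‖² = ‖A† u‖²`. For `A = 0` any nonzero vector serves. -/
theorem isGreatest_eigenvalue_comp_adjoint [Nontrivial F] (A : E →L[ℂ] F)
    (hc : IsCompactOperator (A ∘L A.adjoint)) :
    IsGreatest {x : ℝ | Module.End.HasEigenvalue ((A ∘L A.adjoint : F →L[ℂ] F) : F →ₗ[ℂ] F) (x : ℂ)}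
      (‖A‖ ^ 2) := by
  constructor
  · obtain ⟨u, hu, h⟩ : ∃ u : F, u ≠ 0 ∧ ‖A.adjoint u‖ = ‖A‖ * ‖u‖ := by
      by_cases hA : A = 0
      · obtain ⟨u, hu⟩ := exists_ne (0 : F)
        exact ⟨u, hu, by simp [hA]⟩
      · have hn : ‖A.adjoint‖ = ‖A‖ := LinearIsometryEquiv.norm_map _ _
        rw [← hn]
        refine exists_norm_eq_of_isCompactOperator A.adjoint ?_ ?_
        · rw [← norm_ne_zero_iff, hn]; exact norm_ne_zero_iff.2 hA
        · rwa [ContinuousLinearMap.adjoint_adjoint]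
    exact Module.End.hasEigenvalue_of_hasEigenvector
      (Module.End.hasEigenvector_iff.2
        ⟨Module.End.mem_eigenspace_iff.2 ((comp_adjoint_apply_eq_iff A u).2 h), hu⟩)
  · rintro x hx
    obtain ⟨u, hu⟩ := hx.exists_hasEigenvector
    have h1 : A (A.adjoint u) = (x : ℂ) • u := hu.apply_eq_smul
    have h2 : inner ℂ u (A (A.adjoint u)) = inner ℂ (A.adjoint u) (A.adjoint u) :=
      (ContinuousLinearMap.adjoint_inner_left _ _ _).symm
    rw [h1, inner_smul_right, inner_self_eq_norm_sq_to_K, inner_self_eq_norm_sq_to_K] at h2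
    have h3 : x * ‖u‖ ^ 2 = ‖A.adjoint u‖ ^ 2 := by
      apply Complex.ofReal_injective; push_cast; exact h2
    have h4 : 0 < ‖u‖ := norm_pos_iff.2 hu.2
    have h5 : ‖A.adjoint u‖ ≤ ‖A‖ * ‖u‖ := by
      have := A.adjoint.le_opNorm u
      rwa [LinearIsometryEquiv.norm_map] at this
    have h6 := pow_le_pow_left₀ (norm_nonneg _) h5 2
    rw [← h3, mul_pow] at h6
    exact le_of_mul_le_mul_right h6 (pow_pos h4 2)

end Eigen

/-! ### The block matrix operator -/

theorem orthonormal_single_single : Orthonormal ℂ (fun i : ℕ × ℕ+ =>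
    (lp.single 2 i.1 (lp.single 2 i.2 (1 : ℂ) : lp (fun _ : ℕ+ => ℂ) 2) :
      lp (fun _ : ℕ => lp (fun _ : ℕ+ => ℂ) 2) 2)) := by
  rw [orthonormal_iff_ite]
  rintro ⟨p, k⟩ ⟨q, n⟩
  have h : ∀ f : lp (fun _ : ℕ => lp (fun _ : ℕ+ => ℂ) 2) 2,
      inner ℂ (lp.single 2 p (lp.single 2 k (1 : ℂ) : lp (fun _ : ℕ+ => ℂ) 2)) f = f p k := by
    intro f
    rw [lp.inner_single_left, lp.inner_single_left]
    simp
  rw [h]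
  by_cases hpq : p = q
  · subst hpq
    by_cases hkn : k = n
    · subst hkn; simp
    · simp [hkn]
  · simp [hpq]

theorem inner_single_single (p : ℕ) (k : ℕ+) (f : lp (fun _ : ℕ => lp (fun _ : ℕ+ => ℂ) 2) 2) :
    inner ℂ (lp.single 2 p (lp.single 2 k (1 : ℂ) : lp (fun _ : ℕ+ => ℂ) 2)) f = f p k := by
  rw [lp.inner_single_left, lp.inner_single_left]
  simp

/-- The standard basis of the vector valued sequence space. -/
def blockBasis : HilbertBasis (ℕ × ℕ+) ℂ (lp (fun _ : ℕ => lp (fun _ : ℕ+ => ℂ) 2) 2) :=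
  HilbertBasis.mkOfOrthogonalEqBot orthonormal_single_single (by
    refine (Submodule.eq_bot_iff _).2 fun f hf => ?_
    apply lp.ext
    funext p
    apply lp.ext
    funext k
    have h := (Submodule.mem_orthogonal _ _).1 hf _ (Submodule.subset_span ⟨(p, k), rfl⟩)
    rwa [inner_single_single] at h)

theorem blockBasis_repr_apply (f : lp (fun _ : ℕ => lp (fun _ : ℕ+ => ℂ) 2) 2) (p : ℕ) (k : ℕ+) :
    blockBasis.repr f (p, k) = f p k := by
  rw [HilbertBasis.repr_apply_apply, blockBasis, HilbertBasis.coe_mkOfOrthogonalEqBot,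
    inner_single_single]

theorem blockBasis_repr_symm_apply (y : Ell2) (p : ℕ) (k : ℕ+) :
    blockBasis.repr.symm y p k = y (p, k) := by
  rw [← blockBasis_repr_apply, LinearIsometryEquiv.apply_symm_apply]

/-! ### The operator with the block matrix of the weight function -/

section Block

variable {T : ℝ} {b : ℝ → ℂ}

/-- The Hankel operator of the weight function, with values in families indexed by pairs. -/
def blockHankel (hcoef : CoefCondition T b) : SeqTwo →L[ℂ] Ell2 :=
  blockBasis.repr.toLinearIsometry.toContinuousLinearMap ∘L hankel (coefSeq hcoef)

theorem blockHankel_apply (hcoef : CoefCondition T b) (v : SeqTwo) :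
    blockHankel hcoef v = blockBasis.repr (hankel (coefSeq hcoef) v) := rfl

theorem norm_blockHankel (hcoef : CoefCondition T b) :
    ‖blockHankel hcoef‖ = ‖hankel (coefSeq hcoef)‖ :=
  LinearIsometry.norm_toContinuousLinearMap_comp _

theorem blockHankel_stdVec_apply (hcoef : CoefCondition T b) (s p : ℕ) (k : ℕ+) :
    blockHankel hcoef (stdVec s) (p, k) = bVec T b (s + p) k := by
  rw [blockHankel_apply, blockBasis_repr_apply, hankel_stdVec_apply (isSmoothSymbol_coefSeq hcoef)]
  rfl

theorem adjoint_blockHankel_apply (hcoef : CoefCondition T b) (y : Ell2) (s : ℕ) :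
    (blockHankel hcoef).adjoint y s = inner ℂ (blockHankel hcoef (stdVec s)) y := by
  rw [← inner_stdVec, ContinuousLinearMap.adjoint_inner_right]

/-- The operator with the block matrix of the weight function. -/
def blockOp (hcoef : CoefCondition T b) : Ell2 →L[ℂ] Ell2 :=
  blockHankel hcoef ∘L (blockHankel hcoef).adjoint

theorem hasBlockMatrix_blockOp (hcoef : CoefCondition T b) :
    HasBlockMatrix T b (blockOp hcoef) := by
  intro p q k n
  have hs : ∀ (i : ℕ × ℕ+) (y : Ell2), inner ℂ (lp.single 2 i (1 : ℂ) : Ell2) y = y i := by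
    intro i y
    rw [lp.inner_single_left]; simp
  have h := lp.hasSum_inner (𝕜 := ℂ) ((blockHankel hcoef).adjoint (lp.single 2 (p, k) (1 : ℂ)))
    ((blockHankel hcoef).adjoint (lp.single 2 (q, n) (1 : ℂ)))
  rw [ContinuousLinearMap.adjoint_inner_left, hs] at h
  have hA : ∀ (s p : ℕ) (k : ℕ+), (blockHankel hcoef).adjoint (lp.single 2 (p, k) (1 : ℂ)) s =
      conj (bVec T b (s + p) k) := fun s p k => by
    rw [adjoint_blockHankel_apply, ← inner_conj_symm, hs, blockHankel_stdVec_apply]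
  refine h.congr_fun fun s => ?_
  rw [hA, hA, RCLike.inner_apply, RCLike.conj_conj, mul_comm]

theorem isCompactOperator_blockOp (hcoef : CoefCondition T b) :
    IsCompactOperator (blockOp hcoef) :=
  ((hankel_isCompactOperator (isSmoothSymbol_coefSeq hcoef)).clm_comp
    blockBasis.repr.toLinearIsometry.toContinuousLinearMap).comp_clm (blockHankel hcoef).adjoint

theorem blockOp_apply_eq_iff (hcoef : CoefCondition T b) (y : Ell2) :
    blockOp hcoef y = ((‖hankel (coefSeq hcoef)‖ ^ 2 : ℝ) : ℂ) • y ↔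
      ‖(blockHankel hcoef).adjoint y‖ = ‖hankel (coefSeq hcoef)‖ * ‖y‖ := by
  rw [← norm_blockHankel]
  exact comp_adjoint_apply_eq_iff _ _

theorem isGreatest_eigenvalue_blockOp (hcoef : CoefCondition T b) :
    IsGreatest {x : ℝ | Module.End.HasEigenvalue (blockOp hcoef : Ell2 →ₗ[ℂ] Ell2) (x : ℂ)}
      (‖hankel (coefSeq hcoef)‖ ^ 2) := by
  have : Nontrivial Ell2 := by
    refine ⟨lp.single 2 (0, 1) (1 : ℂ), 0, fun h => ?_⟩
    have h1 := congrArg (fun f : Ell2 => f (0, 1)) h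
    simp at h1
  rw [← norm_blockHankel]
  exact isGreatest_eigenvalue_comp_adjoint _ (isCompactOperator_blockOp hcoef)

variable {H : Type*} [NormedAddCommGroup H] [InnerProductSpace ℂ H] [CompleteSpace H]

/-- The coefficient of the functional along a vector which is orthogonal to the values of the
array before the time `s`. -/
theorem inner_trigEval_symbol (hcoef : CoefCondition T b) {x : ℕ+ → ℤ → H} (hx : IsStationary x)
    {e : H} {s : ℕ} (g : Ell2) (h0 : ∀ (k : ℕ+) (j : ℕ), j < s → inner ℂ e (x k j) = 0)
    (h1 : ∀ (k : ℕ+) (p : ℕ), inner ℂ e (x k (s + p : ℕ)) = g (p, k)) :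
    inner ℂ e (trigEval x ⟨_, symbol_mem_trigSpace (isSmoothSymbol_coefSeq hcoef)⟩) =
      conj ((blockHankel hcoef).adjoint (star g) s) := by
  have hj : ∀ j : ℕ, HasSum (fun k => coefSeq hcoef j k * inner ℂ e (x k j))
      (inner ℂ e (trigEval x ⟨_, trigMono_mem (j : ℤ) (coefSeq hcoef j)⟩)) := fun j => by
    have h := (hasSum_trigEval_trigMono hx (j : ℤ) (coefSeq hcoef j)).mapL (innerSL ℂ e)
    simpa only [innerSL_apply_apply, inner_smul_right] using h
  have hS := (hasSum_trigEval_symbol (isSmoothSymbol_coefSeq hcoef) x).mapL (innerSL ℂ e)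
  simp only [innerSL_apply_apply] at hS
  -- The terms before time `s` vanish because `e` is orthogonal to the array there.
  rw [← hasSum_nat_add_iff' s] at hS
  have hz : ∑ j ∈ Finset.range s,
      inner ℂ e (trigEval x ⟨_, trigMono_mem (j : ℤ) (coefSeq hcoef j)⟩) = 0 := by
    refine Finset.sum_eq_zero fun j hjs => (hj j).unique ?_
    simp only [h0 _ j (Finset.mem_range.1 hjs), mul_zero]
    exact hasSum_zero
  rw [hz, sub_zero] at hS
  refine hS.unique ?_
  have hI := lp.hasSum_inner (𝕜 := ℂ) (hankel (coefSeq hcoef) (stdVec s))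
    (blockBasis.repr.symm (star g))
  have hI' : inner ℂ (hankel (coefSeq hcoef) (stdVec s)) (blockBasis.repr.symm (star g)) =
      (blockHankel hcoef).adjoint (star g) s := by
    rw [adjoint_blockHankel_apply, blockHankel_apply, ← LinearIsometryEquiv.inner_map_map
      blockBasis.repr, LinearIsometryEquiv.apply_symm_apply]
  rw [hI'] at hI
  refine (hI.mapL (Complex.conjCLE : ℂ →L[ℝ] ℂ)).congr_fun fun p => ?_
  have h2 := lp.hasSum_inner (𝕜 := ℂ) (hankel (coefSeq hcoef) (stdVec s) p)
    (blockBasis.repr.symm (star g) p)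
  refine (hj (p + s)).unique ((h2.mapL (Complex.conjCLE : ℂ →L[ℝ] ℂ)).congr_fun fun k => ?_)
  rw [hankel_stdVec_apply (isSmoothSymbol_coefSeq hcoef), blockBasis_repr_symm_apply, add_comm p s,
    h1]
  simp [mul_comm]

end Block

/-! ### The prediction error of moving averages -/

section MovingAverage

variable {Ω : Type*} [MeasurableSpace Ω] {μ : Measure Ω} {d τ : ℕ} {T P : ℝ}
  {ξ : ℝ → Lp ℂ 2 μ} {b : ℝ → ℂ} {M : ℕ} {g : Fin M → Ell2} {ε : ℤ → Fin M → Lp ℂ 2 μ}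

theorem inner_gen_of_lt (hε : Orthonormal ℂ (fun i : ℤ × Fin M => ε i.1 i.2))
    (hg : ∀ (k : ℕ+) (j : ℤ),
      HasSum (fun i : ℕ × Fin M => (g i.2 : ℕ × ℕ+ → ℂ) (i.1, k) • ε (j - i.1) i.2)
        (gen d τ T ξ k j)) (m : Fin M) (k : ℕ+) {s j : ℤ} (hj : j < s) :
    inner ℂ (ε s m) (gen d τ T ξ k j) = 0 := by
  have h := (hg k j).mapL (innerSL ℂ (ε s m))
  refine h.unique (hasSum_zero.congr_fun fun i => ?_)
  have h1 : inner ℂ (ε s m) (ε (j - i.1) i.2) = 0 :=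
    hε.2 (i := (s, m)) (j := (j - i.1, i.2)) (fun h => by
      have := congrArg Prod.fst h
      simp only at this
      omega)
  rw [innerSL_apply_apply, inner_smul_right, h1, mul_zero]

theorem inner_gen_add (hε : Orthonormal ℂ (fun i : ℤ × Fin M => ε i.1 i.2))
    (hg : ∀ (k : ℕ+) (j : ℤ),
      HasSum (fun i : ℕ × Fin M => (g i.2 : ℕ × ℕ+ → ℂ) (i.1, k) • ε (j - i.1) i.2)
        (gen d τ T ξ k j)) (m : Fin M) (k : ℕ+) (s : ℤ) (p : ℕ) :
    inner ℂ (ε s m) (gen d τ T ξ k (s + p)) = g m (p, k) := by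
  have h := (hg k (s + p)).mapL (innerSL ℂ (ε s m))
  have h1 : ∀ i : ℕ × Fin M, i ≠ (p, m) →
      innerSL ℂ (ε s m) ((g i.2 : ℕ × ℕ+ → ℂ) (i.1, k) • ε (s + p - i.1) i.2) = 0 := by
    intro i hi
    have h1 : inner ℂ (ε s m) (ε (s + p - i.1) i.2) = 0 :=
      hε.2 (i := (s, m)) (j := (s + p - i.1, i.2)) (fun h => hi (by
        have h1 := congrArg Prod.fst h
        have h2 := congrArg Prod.snd h
        simp only at h1 h2
        exact Prod.ext (by simp only; omega) h2.symm))
    rw [innerSL_apply_apply, inner_smul_right, h1, mul_zero]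
  have h2 := hε.1 (s, m)
  simp only at h2
  have h3 := h.unique (hasSum_single (p, m) h1)
  rw [innerSL_apply_apply, innerSL_apply_apply, inner_smul_right, add_sub_cancel_right,
    inner_self_eq_norm_sq_to_K, h2] at h3
  simpa using h3

theorem inner_pastSpace_eq_zero {e : Lp ℂ 2 μ} {j : ℤ}
    (h : ∀ (k : ℕ+) (l : ℤ), l ≤ j → inner ℂ e (gen d τ T ξ k l) = 0) {Z : Lp ℂ 2 μ}
    (hZ : Z ∈ pastSpace d τ T ξ j) : inner ℂ e Z = 0 := by
  have h1 : pastSpace d τ T ξ j ≤ (innerSL ℂ e).ker := by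
    refine Submodule.topologicalClosure_minimal _ (Submodule.span_le.2 ?_)
      (innerSL ℂ e).isClosed_ker
    rintro x ⟨k, l, hl, rfl⟩
    exact h k l hl
  exact h1 hZ

/-- The estimates lie in the past, to which the innovations at times `s ≥ 0` are orthogonal, so
these see the prediction error and the functional alike. Bessel's inequality sums their
contributions. -/
theorem MemY.sum_norm_sq_le (hT : 0 < T) (hP : 0 ≤ P) (hξ : MemY d τ T P ξ)
    (hb : ∀ j, MemLp (weightPart T b j) 2 (perMeasure T)) (hcoef : CoefCondition T b)
    (hε : Orthonormal ℂ (fun i : ℤ × Fin M => ε i.1 i.2))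
    (hg : ∀ (k : ℕ+) (j : ℤ),
      HasSum (fun i : ℕ × Fin M => (g i.2 : ℕ × ℕ+ → ℂ) (i.1, k) • ε (j - i.1) i.2)
        (gen d τ T ξ k j)) :
    ∑ m, ‖(blockHankel hcoef).adjoint (star (g m))‖ ^ 2 ≤ ‖predErr d τ T b ξ‖ ^ 2 := by
  have h1 : ∀ (s : ℕ) (m : Fin M), inner ℂ (ε s m) (predErr d τ T b ξ) =
      conj ((blockHankel hcoef).adjoint (star (g m)) s) := by
    intro s m
    rw [predErr, inner_sub_right, hξ.functionalB_eq hT hP hb hcoef,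
      inner_trigEval_symbol hcoef (hξ.isStationary_gen hT) (g m)
        (fun k j hj => inner_gen_of_lt hε hg m k (by exact_mod_cast hj))
        (fun k p => by push_cast; exact inner_gen_add hε hg m k s p),
      inner_pastSpace_eq_zero (fun k l hl => inner_gen_of_lt hε hg m k (by omega))
        (Submodule.starProjection_apply_mem _ _), sub_zero]
  have h2 := hasSum_sum (s := Finset.univ) (f := fun (m : Fin M) (s : ℕ) =>
    ‖(blockHankel hcoef).adjoint (star (g m)) s‖ ^ 2) fun m _ => lp_two_hasSum_norm_sq _
  refine hasSum_le_of_sum_le h2 fun S => ?_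
  have h3 := hε.sum_inner_products_le (predErr d τ T b ξ)
    (s := (S.map (⟨Nat.cast, Nat.cast_injective⟩ : ℕ ↪ ℤ)) ×ˢ Finset.univ)
  rw [Finset.sum_product, Finset.sum_map] at h3
  refine le_trans (le_of_eq ?_) h3
  refine Finset.sum_congr rfl fun s _ => Finset.sum_congr rfl fun m _ => ?_
  simp only [Function.Embedding.coeFn_mk]
  rw [h1, RCLike.norm_conj]

theorem IsEigenMovingAverage.le_minMse (hT : 0 < T) (hP : 0 ≤ P) (hξ : MemY d τ T P ξ)
    (hb : ∀ j, MemLp (weightPart T b j) 2 (perMeasure T)) (hcoef : CoefCondition T b)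
    (h : IsEigenMovingAverage d τ T P (blockOp hcoef) (‖hankel (coefSeq hcoef)‖ ^ 2) M ξ) :
    ENNReal.ofReal (P * ‖hankel (coefSeq hcoef)‖ ^ 2) ≤ minMse d τ T b ξ := by
  obtain ⟨g, ε, hQ, hgP, hε, -, hg⟩ := h
  rw [minMse_eq, ← ofReal_norm, ← ENNReal.ofReal_pow (norm_nonneg _)]
  refine ENNReal.ofReal_le_ofReal (le_trans (le_of_eq ?_)
    (hξ.sum_norm_sq_le hT hP hb hcoef hε hg))
  rw [← hgP, Finset.sum_mul]
  refine Finset.sum_congr rfl fun m _ => ?_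
  -- An eigenvector of `Γ Γ†` for `ν²` is maximizing for `Γ†`.
  rw [(blockOp_apply_eq_iff hcoef _).1 (hQ m), norm_star, mul_pow, mul_comm]

end MovingAverage

/-! ### Solving the difference equation -/

theorem exists_int_sub_eq {G : Type*} [AddCommGroup G] (a : ℤ → G) :
    ∃ S : ℤ → G, ∀ n, S (n + 1) - S n = a n := by
  refine ⟨fun n => Int.casesOn n (fun n => ∑ i ∈ Finset.range n, a i)
    (fun n => -∑ i ∈ Finset.range (n + 1), a (Int.negSucc i)), fun n => ?_⟩
  rcases n with n | n
  · change (∑ i ∈ Finset.range (n + 1), a i) - (∑ i ∈ Finset.range n, a i) = a n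
    rw [Finset.sum_range_succ, add_sub_cancel_left]
  · rcases n with _ | n
    · change (∑ i ∈ Finset.range 0, a i) - -(∑ i ∈ Finset.range (0 + 1), a (Int.negSucc i)) = _
      simp
    · change -(∑ i ∈ Finset.range (n + 1), a (Int.negSucc i)) -
        -(∑ i ∈ Finset.range (n + 1 + 1), a (Int.negSucc i)) = _
      rw [Finset.sum_range_succ _ (n + 1)]
      abel

/-- The line splits into cosets `h (r + ℤ)` with `0 ≤ r < 1`, and the equation is solved on each
independently. No regularity of the solution is claimed: only its increments matter. -/
theorem fwdDiff_surjective {G : Type*} [AddCommGroup G] {h : ℝ} (hh : h ≠ 0) :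
    Function.Surjective (fwdDiff h : (ℝ → G) → ℝ → G) := by
  intro η
  choose S hS using fun r : ℝ => exists_int_sub_eq fun n : ℤ => η (h * (r + n))
  refine ⟨fun t => S (Int.fract (t / h)) ⌊t / h⌋, funext fun t => ?_⟩
  have h1 : (t + h) / h = t / h + 1 := by field_simp
  rw [fwdDiff, h1, Int.fract_add_one, Int.floor_add_one, hS, Int.fract_add_floor,
    mul_div_cancel₀ _ hh]

/-! ### Paths as increments of processes, and centred innovations -/

section Increment

variable {Ω : Type*} [MeasurableSpace Ω] {μ : Measure Ω}

theorem increment_eq_fwdDiff_iterate (d : ℕ) (s : ℝ) (ξ : ℝ → Lp ℂ 2 μ) :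
    increment d s ξ = ((-1 : ℂ) ^ d) • ((fwdDiff (-s))^[d] ξ) := by
  funext t
  rw [Pi.smul_apply, fwdDiff_iter_eq_sum_shift, Finset.smul_sum, increment]
  refine Finset.sum_congr rfl fun l hl => ?_
  have hl' : l ≤ d := Nat.lt_succ_iff.1 (Finset.mem_range.1 hl)
  have h1 : ((-1 : ℂ) ^ d * ((-1) ^ (d - l) * (d.choose l : ℂ))) = (-1) ^ l * (d.choose l : ℂ) := by
    rw [← mul_assoc, ← pow_add]
    congr 1
    obtain ⟨m, rfl⟩ := Nat.exists_eq_add_of_le hl'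
    rw [Nat.add_sub_cancel_left, add_assoc, pow_add, ← two_mul, pow_mul]
    simp
  have h2 : t + l • -s = t - l * s := by rw [nsmul_eq_mul]; ring
  rw [h2, ← h1, ← Int.cast_smul_eq_zsmul ℂ, smul_smul]
  push_cast
  rfl

theorem increment_surjective (d : ℕ) {s : ℝ} (hs : s ≠ 0) :
    Function.Surjective (increment d s : (ℝ → Lp ℂ 2 μ) → ℝ → Lp ℂ 2 μ) := by
  intro η
  obtain ⟨ξ, hξ⟩ := (fwdDiff_surjective (G := Lp ℂ 2 μ) (neg_ne_zero.2 hs)).iterate d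
    (((-1 : ℂ) ^ d) • η)
  refine ⟨ξ, ?_⟩
  rw [increment_eq_fwdDiff_iterate, hξ, smul_smul, ← mul_pow]
  simp

/-! ### Mean zero orthonormal families -/

/-- The constant function `1` in `L²`. -/
def oneLp (μ : Measure Ω) [IsFiniteMeasure μ] : Lp ℂ 2 μ :=
  indicatorConstLp 2 MeasurableSet.univ (measure_ne_top μ univ) (1 : ℂ)

theorem inner_oneLp [IsFiniteMeasure μ] (f : Lp ℂ 2 μ) :
    inner ℂ (oneLp μ) f = ∫ ω, (f : Ω → ℂ) ω ∂μ := by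
  rw [oneLp, L2.inner_indicatorConstLp_one, Measure.restrict_univ]

theorem exists_orthonormal_of_not_finiteDimensional {E : Type*} [NormedAddCommGroup E]
    [InnerProductSpace ℂ E] (hE : ¬ FiniteDimensional ℂ E) :
    ∃ e : ℕ → E, Orthonormal ℂ e := by
  let B := Module.Basis.ofVectorSpace ℂ E
  have : Infinite (Module.Basis.ofVectorSpaceIndex ℂ E) := by
    by_contra hfin
    rw [not_infinite_iff_finite] at hfin
    exact hE (Module.Finite.of_basis B)
  exact ⟨_, InnerProductSpace.gramSchmidtNormed_orthonormal
    (B.linearIndependent.comp _ (Infinite.natEmbedding _).injective)⟩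

/-- Mean zero is orthogonality to the constants, a single linear condition, so the space of centred
variables is still infinite dimensional. -/
theorem exists_orthonormal_mean_zero [IsFiniteMeasure μ]
    (hΩ : ¬ FiniteDimensional ℂ (Lp ℂ 2 μ)) :
    ∃ ε : ℤ → Lp ℂ 2 μ, Orthonormal ℂ ε ∧ ∀ s, ∫ ω, (ε s : Ω → ℂ) ω ∂μ = 0 := by
  have hV : ¬ FiniteDimensional ℂ ((ℂ ∙ oneLp μ)ᗮ : Submodule ℂ (Lp ℂ 2 μ)) := by
    intro hfin
    have h1 : (ℂ ∙ oneLp μ) ⊔ (ℂ ∙ oneLp μ)ᗮ = ⊤ := Submodule.sup_orthogonal_of_hasOrthogonalProjection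
    have h2 : FiniteDimensional ℂ ((ℂ ∙ oneLp μ) ⊔ (ℂ ∙ oneLp μ)ᗮ : Submodule ℂ (Lp ℂ 2 μ)) :=
      Submodule.finiteDimensional_sup _ _
    rw [h1] at h2
    exact hΩ (Module.finite_def.2
      ((Module.Finite.iff_fg (N := (⊤ : Submodule ℂ (Lp ℂ 2 μ)))).1 h2))
  obtain ⟨e, he⟩ := exists_orthonormal_of_not_finiteDimensional hV
  refine ⟨fun s => (e (Equiv.intEquivNat s) : Lp ℂ 2 μ), ?_, fun s => ?_⟩
  · exact (he.comp_linearIsometry (Submodule.subtypeₗᵢ _)).comp _ Equiv.intEquivNat.injective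
  · rw [← inner_oneLp]
    exact Submodule.mem_orthogonal_singleton_iff_inner_right.1 (e (Equiv.intEquivNat s)).2

end Increment

/-! ### Synthesis of moving averages -/

section Innov

variable {H : Type*} [NormedAddCommGroup H] [InnerProductSpace ℂ H] [CompleteSpace H]

/-- The isometry `a ↦ ∑_p a_p ε(j - p)`. -/
def innovMap {ε : ℤ → H} (hε : Orthonormal ℂ ε) (j : ℤ) : SeqTwo →ₗᵢ[ℂ] H :=
  (hε.comp (fun p : ℕ => j - p) (fun p q h => by simpa using h)).orthogonalFamily.linearIsometry

variable {ε : ℤ → H} (hε : Orthonormal ℂ ε)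

theorem hasSum_innovMap (j : ℤ) (a : SeqTwo) :
    HasSum (fun p : ℕ => a p • ε (j - p)) (innovMap hε j a) :=
  OrthogonalFamily.hasSum_linearIsometry _ a

theorem inner_innovMap_of_lt {s j : ℤ} (h : j < s) (a : SeqTwo) :
    inner ℂ (ε s) (innovMap hε j a) = 0 := by
  have h1 := (hasSum_innovMap hε j a).mapL (innerSL ℂ (ε s))
  refine h1.unique (hasSum_zero.congr_fun fun p => ?_)
  rw [innerSL_apply_apply, inner_smul_right, hε.2 (by omega), mul_zero]

theorem inner_innovMap_add (s : ℤ) (p : ℕ) (a : SeqTwo) :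
    inner ℂ (ε s) (innovMap hε (s + p) a) = a p := by
  have h1 := (hasSum_innovMap hε (s + p) a).mapL (innerSL ℂ (ε s))
  have h2 := h1.unique (hasSum_single p fun q hq => by
    rw [innerSL_apply_apply, inner_smul_right, hε.2 (by omega), mul_zero])
  rw [innerSL_apply_apply, innerSL_apply_apply, inner_smul_right, add_sub_cancel_right,
    inner_self_eq_norm_sq_to_K, hε.1] at h2
  simpa using h2

theorem inner_innovMap_succ (s j : ℤ) (a : SeqTwo) :
    inner ℂ (ε (s + 1)) (innovMap hε (j + 1) a) = inner ℂ (ε s) (innovMap hε j a) := by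
  rcases lt_or_ge j s with h | h
  · rw [inner_innovMap_of_lt hε h, inner_innovMap_of_lt hε (by omega)]
  · obtain ⟨p, rfl⟩ := Int.le.dest h
    rw [inner_innovMap_add, add_right_comm, inner_innovMap_add]

theorem inner_innovMap_innovMap_succ (j l : ℤ) (a c : SeqTwo) :
    inner ℂ (innovMap hε (j + 1) a) (innovMap hε (l + 1) c) =
      inner ℂ (innovMap hε j a) (innovMap hε l c) := by
  rw [← inner_conj_symm, ← inner_conj_symm (innovMap hε j a)]
  congr 1
  have h1 := (hasSum_innovMap hε (j + 1) a).mapL (innerSL ℂ (innovMap hε (l + 1) c))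
  have h2 := (hasSum_innovMap hε j a).mapL (innerSL ℂ (innovMap hε l c))
  simp only [innerSL_apply_apply, inner_smul_right] at h1 h2
  refine h1.unique (h2.congr_fun fun p => ?_)
  rw [← inner_conj_symm, add_sub_right_comm, inner_innovMap_succ, inner_conj_symm]

end Innov

section Synth

variable {E : Type*} [NormedAddCommGroup E] [InnerProductSpace ℂ E] [CompleteSpace E] {T : ℝ}

/-- The function with given Fourier coefficients. -/
def synthL (hT : 0 < T) : lp (fun _ : ℕ+ => E) 2 →ₗᵢ[ℂ] Lp E 2 (perMeasure T) :=
  (orthogonalFamily_basisLp (E := E) hT).linearIsometry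

theorem synthL_single (hT : 0 < T) (k : ℕ+) (a : E) :
    synthL hT (lp.single 2 k a) = basisLp hT k a :=
  (orthogonalFamily_basisLp (E := E) hT).linearIsometry_apply_single (i := k) a

theorem fourierL_synthL (hT : 0 < T) (y : lp (fun _ : ℕ+ => E) 2) :
    fourierL hT (synthL hT y) = y := by
  refine ext_inner_left ℂ fun z => ?_
  rw [fourierL, ContinuousLinearMap.adjoint_inner_right, LinearIsometry.coe_toContinuousLinearMap]
  exact LinearIsometry.inner_map_map _ _ _

/-- The finite combinations of differences of basis vectors. -/
def diffSpace (E : Type*) [NormedAddCommGroup E] [InnerProductSpace ℂ E] :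
    Submodule ℂ (lp (fun _ : ℕ+ => E) 2) :=
  Submodule.span ℂ {y | ∃ (k n : ℕ+) (a : E), y = lp.single 2 k a - lp.single 2 n a}

/-- A family orthogonal to all these differences is constant in `k`, and a square summable constant
family is zero. -/
theorem dense_diffSpace : Dense (diffSpace E : Set (lp (fun _ : ℕ+ => E) 2)) := by
  rw [Submodule.dense_iff_topologicalClosure_eq_top, Submodule.topologicalClosure_eq_top_iff,
    Submodule.eq_bot_iff]
  intro z hz
  have h1 : ∀ k n, z k = z n := fun k n => by
    refine ext_inner_left ℂ fun a => ?_
    have h := (Submodule.mem_orthogonal _ _).1 hz _ (Submodule.subset_span ⟨k, n, a, rfl⟩)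
    have h2 : ∀ k, inner ℂ (lp.single 2 k a) z = inner ℂ a (z k) := fun k =>
      lp.inner_single_left k a z
    rw [inner_sub_left, h2, h2, sub_eq_zero] at h
    exact h
  have h2 := (lp_two_hasSum_norm_sq z).summable
  have h3 : (fun k => ‖z k‖ ^ 2) = fun _ => ‖z 1‖ ^ 2 := funext fun k => by rw [h1 k 1]
  rw [h3, summable_const_iff] at h2
  apply lp.ext
  funext k
  rw [h1 k 1]
  simpa using h2

/-- All basis functions have the common value `T^{-1/2}` at `0` and at `T`, so differences vanish at
both ends of the period. -/
theorem exists_continuous_of_mem_diffSpace (hT : 0 < T) {y : lp (fun _ : ℕ+ => E) 2}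
    (hy : y ∈ diffSpace E) :
    ∃ f : ℝ → E, Continuous f ∧ f 0 = 0 ∧ f T = 0 ∧ f =ᵐ[perMeasure T] synthL hT y := by
  have hz : ∀ k, basisFun T k 0 = basisFun T 1 0 := fun k => by simp [basisFun]
  have hT' : ∀ k, basisFun T k T = basisFun T 1 0 := fun k => by
    have hTc : (T : ℂ) ≠ 0 := by exact_mod_cast hT.ne'
    have h1 : 2 * Real.pi * Complex.I * (freq k : ℂ) * T / T =
        (freq k : ℂ) * (2 * Real.pi * Complex.I) := by field_simp
    rw [basisFun, h1, Complex.exp_int_mul_two_pi_mul_I]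
    simp [basisFun]
  induction hy using Submodule.span_induction with
  | mem y hy =>
    obtain ⟨k, n, a, rfl⟩ := hy
    refine ⟨fun u => basisFun T k u • a - basisFun T n u • a, ?_, ?_, ?_, ?_⟩
    · exact ((continuous_basisFun T k).smul continuous_const).sub
        ((continuous_basisFun T n).smul continuous_const)
    · simp only [hz k, hz n, sub_self]
    · simp only [hT' k, hT' n, sub_self]
    · rw [map_sub, synthL_single, synthL_single, basisLp_apply, basisLp_apply, ← MemLp.toLp_sub]
      exact (MemLp.coeFn_toLp _).symm
  | zero =>
    refine ⟨0, continuous_zero, rfl, rfl, ?_⟩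
    rw [map_zero]
    exact (Lp.coeFn_zero _ _ _).symm
  | add x y _ _ hx hy =>
    obtain ⟨f, hf, hf0, hfT, hfx⟩ := hx
    obtain ⟨g, hg, hg0, hgT, hgy⟩ := hy
    refine ⟨f + g, hf.add hg, by simp [hf0, hg0], by simp [hfT, hgT], ?_⟩
    rw [map_add]
    exact (hfx.add hgy).trans (Lp.coeFn_add _ _).symm
  | smul c x _ hx =>
    obtain ⟨f, hf, hf0, hfT, hfx⟩ := hx
    refine ⟨c • f, hf.const_smul c, by simp [hf0], by simp [hfT], ?_⟩
    rw [map_smul]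
    exact (hfx.const_smul c).trans (Lp.coeFn_smul _ _).symm

end Synth

/-! ### Processes with a given moving average as generated sequence -/

section Wave

variable {H : Type*} [NormedAddCommGroup H] [InnerProductSpace ℂ H] [CompleteSpace H]
  {ε : ℤ → H} (hε : Orthonormal ℂ ε) {T : ℝ}

/-- The process whose part on the `j`-th period is the image of a fixed function under the `j`-th
synthesis map. -/
def wavePath (T : ℝ) (f : ℝ → SeqTwo) (t : ℝ) : H :=
  innovMap hε ⌊t / T⌋ (f (t - ⌊t / T⌋ * T))

theorem wavePath_add (hT : 0 < T) (f : ℝ → SeqTwo) (t : ℝ) :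
    wavePath hε T f (t + T) = innovMap hε (⌊t / T⌋ + 1) (f (t - ⌊t / T⌋ * T)) := by
  have h1 : (t + T) / T = t / T + 1 := by field_simp
  rw [wavePath, h1, Int.floor_add_one]
  congr 2
  push_cast; ring

theorem floor_add_mul_div (hT : 0 < T) (j : ℤ) {u : ℝ} (hu : u ∈ Ico 0 T) :
    ⌊(u + j * T) / T⌋ = j := by
  have h1 : (u + j * T) / T = u / T + j := by field_simp
  rw [h1, Int.floor_add_intCast, Int.floor_eq_zero_iff.2, zero_add]
  exact ⟨div_nonneg hu.1 hT.le, (div_lt_one hT).2 hu.2⟩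

theorem wavePath_add_mul (hT : 0 < T) (f : ℝ → SeqTwo) (j : ℤ) {u : ℝ} (hu : u ∈ Ico 0 T) :
    wavePath hε T f (u + j * T) = innovMap hε j (f u) := by
  rw [wavePath, floor_add_mul_div hT j hu, add_sub_cancel_right]

theorem inner_wavePath_add (hT : 0 < T) (f : ℝ → SeqTwo) (s t : ℝ) :
    inner ℂ (wavePath hε T f (s + T)) (wavePath hε T f (t + T)) =
      inner ℂ (wavePath hε T f s) (wavePath hε T f t) := by
  rw [wavePath_add hε hT, wavePath_add hε hT, inner_innovMap_innovMap_succ]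
  rfl

theorem exists_mem_Ico_eq_add_mul (hT : 0 < T) (t : ℝ) :
    ∃ (j : ℤ) (u : ℝ), u ∈ Ico 0 T ∧ t = u + j * T := by
  refine ⟨⌊t / T⌋, t - ⌊t / T⌋ * T, ⟨?_, ?_⟩, by ring⟩
  · have := (le_div_iff₀ hT).1 (Int.floor_le (t / T)); linarith
  · have := (div_lt_iff₀ hT).1 (Int.lt_floor_add_one (t / T)); linarith

theorem aestronglyMeasurable_wavePath (hT : 0 < T) {f : ℝ → SeqTwo} (hf : StronglyMeasurable f) :
    AEStronglyMeasurable (wavePath hε T f) volume := by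
  have hU : ⋃ j : ℤ, Ico (j * T) ((j + 1) * T) = univ := by
    refine eq_univ_of_forall fun t => ?_
    obtain ⟨j, u, hu, rfl⟩ := exists_mem_Ico_eq_add_mul hT t
    exact mem_iUnion.2 ⟨j, by constructor <;> nlinarith [hu.1, hu.2]⟩
  rw [← Measure.restrict_univ (μ := volume), ← hU, aestronglyMeasurable_iUnion_iff]
  intro j
  have h1 : StronglyMeasurable fun t : ℝ => innovMap hε j (f (t - j * T)) :=
    (innovMap hε j).continuous.comp_stronglyMeasurable
      (hf.comp_measurable (measurable_id.sub_const _))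
  refine h1.aestronglyMeasurable.congr ?_
  refine (ae_restrict_mem measurableSet_Ico).mono fun t ht => ?_
  have h2 := wavePath_add_mul hε hT f j (u := t - j * T)
    ⟨by linarith [ht.1], by linarith [ht.2]⟩
  rw [sub_add_cancel] at h2
  exact h2.symm

theorem continuous_wavePath (hT : 0 < T) {f : ℝ → SeqTwo} (hf : Continuous f) (h0 : f 0 = 0)
    (h1 : f T = 0) : Continuous (wavePath hε T f) := by
  -- Clamping the argument extends `f` continuously by zero outside `[0, T]`. Near any point the
  -- path is then a sum of the pieces of two adjacent periods.
  set F : ℝ → SeqTwo := fun u => f (max 0 (min T u)) with hF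
  have hFc : Continuous F := by fun_prop
  have hF0 : ∀ u, u ≤ 0 → F u = 0 := fun u hu => by
    rw [hF]; simp only; rw [min_eq_right (hu.trans hT.le), max_eq_left hu, h0]
  have hF1 : ∀ u, T ≤ u → F u = 0 := fun u hu => by
    rw [hF]; simp only; rw [min_eq_left hu, max_eq_right hT.le, h1]
  have hFe : ∀ u ∈ Ico 0 T, F u = f u := fun u hu => by
    rw [hF]; simp only; rw [min_eq_right hu.2.le, max_eq_right hu.1]
  refine continuous_iff_continuousAt.2 fun t => ?_
  obtain ⟨j, u, hu, rfl⟩ := exists_mem_Ico_eq_add_mul hT t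
  have hc : ContinuousAt (fun s : ℝ => innovMap hε (j - 1) (F (s - (j - 1) * T)) +
      innovMap hε j (F (s - j * T))) (u + j * T) := by
    refine Continuous.continuousAt ?_
    exact ((innovMap hε (j - 1)).continuous.comp (hFc.comp (by fun_prop))).add
      ((innovMap hε j).continuous.comp (hFc.comp (by fun_prop)))
  refine hc.congr ?_
  have hmem : Ioo (((j : ℝ) - 1) * T) ((j + 1) * T) ∈ 𝓝 (u + j * T) :=
    Ioo_mem_nhds (by nlinarith [hu.1]) (by nlinarith [hu.2])
  filter_upwards [hmem] with s hs
  rcases lt_or_ge s (j * T) with h | h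
  · have hm : s - (j - 1) * T ∈ Ico 0 T := ⟨by linarith [hs.1], by linarith⟩
    have h2 := wavePath_add_mul hε hT f (j - 1) hm
    push_cast at h2
    rw [sub_add_cancel] at h2
    rw [h2, hFe _ hm, hF0 (s - j * T) (by linarith), map_zero, add_zero]
  · have hm : s - j * T ∈ Ico 0 T := ⟨by linarith, by linarith [hs.2]⟩
    have h2 := wavePath_add_mul hε hT f j hm
    rw [sub_add_cancel] at h2
    rw [h2, hFe _ hm, hF1 (s - (j - 1) * T) (by linarith), map_zero, zero_add]

end Wave

/-! ### Construction of processes with prescribed generated sequence -/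

section Generated

variable {Ω : Type*} [MeasurableSpace Ω] {μ : Measure Ω} {d τ : ℕ} {T P : ℝ}

theorem exists_wavePath [IsFiniteMeasure μ] (hτ : 1 ≤ τ) (hT : 0 < T)
    {ε : ℤ → Lp ℂ 2 μ} (hε : Orthonormal ℂ ε) (hε0 : ∀ s, ∫ ω, (ε s : Ω → ℂ) ω ∂μ = 0)
    {y : lp (fun _ : ℕ+ => SeqTwo) 2} (hy : ‖y‖ ^ 2 ≤ P) {f : ℝ → SeqTwo}
    (hf : StronglyMeasurable f) (hfy : f =ᵐ[perMeasure T] synthL hT y) :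
    ∃ ξ : ℝ → Lp ℂ 2 μ, increment d (τ * T) ξ = wavePath hε T f ∧ MemY d τ T P ξ ∧
      ∀ (k : ℕ+) (j : ℤ), gen d τ T ξ k j = innovMap hε j (y k) := by
  have hs : (τ * T : ℝ) ≠ 0 := mul_ne_zero (Nat.cast_ne_zero.2 (by omega)) hT.ne'
  obtain ⟨ξ, hξ⟩ := increment_surjective d hs (wavePath hε T f)
  have hfm : MemLp f 2 (perMeasure T) := (memLp_congr_ae hfy).2 (Lp.memLp _)
  have hfn : ‖hfm.toLp f‖ = ‖y‖ := by
    rw [← LinearIsometry.norm_map (synthL hT) y]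
    congr 1
    exact Lp.ext (hfm.coeFn_toLp.trans hfy)
  refine ⟨ξ, hξ, ⟨?_, fun t => ?_, fun t s => ?_, ?_⟩, fun k j => ?_⟩
  · rw [hξ]; exact aestronglyMeasurable_wavePath hε hT hf
  · rw [hξ, ← inner_oneLp, wavePath]
    have h := (hasSum_innovMap hε ⌊t / T⌋ (f (t - ⌊t / T⌋ * T))).mapL (innerSL ℂ (oneLp μ))
    refine h.unique (hasSum_zero.congr_fun fun p => ?_)
    rw [innerSL_apply_apply, inner_smul_right, inner_oneLp, hε0, mul_zero]
  · rw [hξ]; exact inner_wavePath_add hε hT f s t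
  · rw [hξ]
    have h1 : ∀ u ∈ Ico 0 T, ‖wavePath hε T f u‖ₑ ^ 2 = ‖f u‖ₑ ^ 2 := fun u hu => by
      have h := wavePath_add_mul hε hT f 0 hu
      rw [Int.cast_zero, zero_mul, add_zero] at h
      rw [h, ← ofReal_norm, LinearIsometry.norm_map, ofReal_norm]
    rw [setLIntegral_congr_fun measurableSet_Ico h1, restrict_Ico_eq_perMeasure,
      lintegral_enorm_sq_eq hfm, hfn]
    exact ENNReal.ofReal_le_ofReal hy
  · have h1 : periodPart d τ T ξ j =ᵐ[perMeasure T] fun u => innovMap hε j (f u) := by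
      have h2 : ∀ᵐ u ∂(perMeasure T), u ∈ Ico 0 T := by
        rw [← restrict_Ico_eq_perMeasure]; exact ae_restrict_mem measurableSet_Ico
      refine h2.mono fun u hu => ?_
      rw [periodPart, hξ, wavePath_add_mul hε hT f j hu]
    rw [gen_eq, fourierCoef_congr hT h1, fourierCoef_eq hT]
    have h3 : ∀ u, conj (basisFun T k u) • innovMap hε j (f u) =
        innovMap hε j (conj (basisFun T k u) • f u) := fun u => (map_smul _ _ _).symm
    simp only [h3]
    have h4 : fourierCoef T f k = y k := by
      rw [fourierCoef_congr hT hfy, ← fourierL_apply hT, fourierL_synthL]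
    rw [LinearIsometry.integral_comp_comm, ← h4]
    exact congrArg _ (fourierCoef_eq hT f k).symm

/-- A vector of the remote past is orthogonal to every `ε s`, hence to the whole array built from
them, while lying in its closed span. -/
theorem isRegular_of_gen_eq {ε : ℤ → Lp ℂ 2 μ} (hε : Orthonormal ℂ ε) {ξ : ℝ → Lp ℂ 2 μ}
    {y : ℕ+ → SeqTwo} (hg : ∀ (k : ℕ+) (j : ℤ), gen d τ T ξ k j = innovMap hε j (y k)) :
    IsRegular d τ T ξ := by
  rw [IsRegular, Submodule.eq_bot_iff]
  intro x hx
  have hx' : ∀ j, x ∈ pastSpace d τ T ξ j := fun j => (Submodule.mem_iInf _).1 hx j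
  have h1 : ∀ s, inner ℂ (ε s) x = 0 := fun s =>
    inner_pastSpace_eq_zero (fun k l hl => by
      rw [hg]; exact inner_innovMap_of_lt hε (by omega) _) (hx' (s - 1))
  have h2 : inner ℂ x x = (0 : ℂ) := by
    refine inner_pastSpace_eq_zero (fun k l _ => ?_) (hx' 0)
    rw [hg]
    have h := (hasSum_innovMap hε l (y k)).mapL (innerSL ℂ x)
    refine h.unique (hasSum_zero.congr_fun fun p => ?_)
    rw [innerSL_apply_apply, inner_smul_right, ← inner_conj_symm, h1, map_zero, mul_zero]
  exact inner_self_eq_zero.1 h2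

/-- The coefficients of a moving average as a family indexed by pairs. -/
def pairFamily (y : lp (fun _ : ℕ+ => SeqTwo) 2) : Ell2 :=
  lpTwoMk (fun i => y i.2 i.1) (by
    have h := (lp_two_hasSum_norm_sq y).summable
    rw [← (Equiv.prodComm ℕ ℕ+).symm.summable_iff]
    refine (summable_prod_of_nonneg fun _ => sq_nonneg _).2 ⟨fun k => ?_, ?_⟩
    · exact (lp_two_hasSum_norm_sq (y k)).summable
    · refine h.congr fun k => ?_
      exact (lp_two_hasSum_norm_sq (y k)).tsum_eq.symm)

theorem norm_pairFamily (y : lp (fun _ : ℕ+ => SeqTwo) 2) : ‖pairFamily y‖ = ‖y‖ := by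
  refine (pow_left_inj₀ (norm_nonneg _) (norm_nonneg _) two_ne_zero).1 ?_
  have h1 := lp_two_hasSum_norm_sq (pairFamily y)
  rw [← (Equiv.prodComm ℕ ℕ+).symm.hasSum_iff] at h1
  exact (h1.prod_fiberwise fun k => lp_two_hasSum_norm_sq (y k)).unique (lp_two_hasSum_norm_sq y)

theorem pairFamily_sub (y z : lp (fun _ : ℕ+ => SeqTwo) 2) :
    pairFamily (y - z) = pairFamily y - pairFamily z := by
  apply lp.ext; funext i; rfl

theorem pairFamily_surjective : Function.Surjective pairFamily := by
  intro g
  have h := (lp_two_hasSum_norm_sq g).summable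
  rw [← (Equiv.prodComm ℕ ℕ+).symm.summable_iff] at h
  have h1 := (summable_prod_of_nonneg fun _ => sq_nonneg _).1 h
  refine ⟨lpTwoMk (fun k => lpTwoMk (fun p => g (p, k)) (h1.1 k)) (h1.2.congr fun k => ?_), ?_⟩
  · exact (lp_two_hasSum_norm_sq (lpTwoMk (fun p => g (p, k)) (h1.1 k))).tsum_eq
  · apply lp.ext; funext i; rfl

theorem continuous_pairFamily : Continuous pairFamily := by
  refine (Isometry.of_dist_eq fun y z => ?_).continuous
  rw [dist_eq_norm, dist_eq_norm, ← pairFamily_sub, norm_pairFamily]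

/-- The generated sequence in the form required of moving averages. -/
theorem hasSum_gen_of_eq {ε : ℤ → Lp ℂ 2 μ} (hε : Orthonormal ℂ ε) {ξ : ℝ → Lp ℂ 2 μ}
    {y : lp (fun _ : ℕ+ => SeqTwo) 2}
    (hg : ∀ (k : ℕ+) (j : ℤ), gen d τ T ξ k j = innovMap hε j (y k)) (k : ℕ+) (j : ℤ) :
    HasSum (fun i : ℕ × Fin 1 => (pairFamily y : ℕ × ℕ+ → ℂ) (i.1, k) • ε (j - i.1))
      (gen d τ T ξ k j) := by
  rw [hg, ← (Equiv.prodUnique ℕ (Fin 1)).symm.hasSum_iff]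
  exact hasSum_innovMap hε j (y k)

theorem orthonormal_prod_fin_one {ε : ℤ → Lp ℂ 2 μ} (hε : Orthonormal ℂ ε) :
    Orthonormal ℂ (fun i : ℤ × Fin 1 => ε i.1) :=
  hε.comp _ (Equiv.prodUnique ℤ (Fin 1)).injective

end Generated

/-! ### Least favorable processes -/

section Existence

variable {Ω : Type*} [MeasurableSpace Ω] {μ : Measure Ω} {d τ : ℕ} {T P : ℝ} {b : ℝ → ℂ}

theorem exists_eigenvector_blockOp (hP : 0 ≤ P) (hcoef : CoefCondition T b) :
    ∃ y : lp (fun _ : ℕ+ => SeqTwo) 2, ‖y‖ ^ 2 = P ∧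
      blockOp hcoef (star (pairFamily y)) =
        ((‖hankel (coefSeq hcoef)‖ ^ 2 : ℝ) : ℂ) • star (pairFamily y) := by
  obtain ⟨u, hu⟩ := (isGreatest_eigenvalue_blockOp hcoef).1.exists_hasEigenvector
  have h1 : blockOp hcoef u = ((‖hankel (coefSeq hcoef)‖ ^ 2 : ℝ) : ℂ) • u := hu.apply_eq_smul
  have hun : ‖u‖ ≠ 0 := norm_ne_zero_iff.2 hu.2
  -- The eigenvector is scaled to norm `√P` and conjugated, since the condition concerns `star g`.
  obtain ⟨y, hy⟩ := pairFamily_surjective (star (((Real.sqrt P / ‖u‖ : ℝ) : ℂ) • u))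
  refine ⟨y, ?_, ?_⟩
  · rw [← norm_pairFamily, hy, norm_star, norm_smul, Complex.norm_real, Real.norm_eq_abs, abs_div,
      abs_norm, div_mul_cancel₀ _ hun, sq_abs, Real.sq_sqrt hP]
  · rw [hy, star_star, map_smul, h1, smul_comm]

theorem exists_eigenMovingAverage [IsFiniteMeasure μ] (hΩ : ¬ FiniteDimensional ℂ (Lp ℂ 2 μ))
    (hτ : 1 ≤ τ) (hT : 0 < T) (hP : 0 ≤ P) (hcoef : CoefCondition T b) :
    ∃ ξ ∈ classYR μ d τ T P, IsEigenMovingAverage d τ T P (blockOp hcoef)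
      (‖hankel (coefSeq hcoef)‖ ^ 2) 1 ξ := by
  obtain ⟨ε, hε, hε0⟩ := exists_orthonormal_mean_zero hΩ
  obtain ⟨y, hy, hQ⟩ := exists_eigenvector_blockOp hP hcoef
  obtain ⟨ξ, -, hξ, hg⟩ := exists_wavePath (d := d) hτ hT hε hε0 hy.le
    (Lp.stronglyMeasurable (synthL hT y)) (ae_eq_refl _)
  refine ⟨ξ, ⟨hξ, isRegular_of_gen_eq hε hg⟩, fun _ => pairFamily y, fun s _ => ε s, fun _ => hQ,
    ?_, orthonormal_prod_fin_one hε, fun s _ => hε0 s, fun k j => hasSum_gen_of_eq hε hg k j⟩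
  rw [Fin.sum_univ_one, norm_pairFamily, hy]

/-- The lower bound `‖Γ† (star g)‖²` is continuous in the coefficients, so an optimal family may be
replaced by a nearby one that admits a continuous path. -/
theorem exists_continuous_lt_minMse [IsFiniteMeasure μ] (hΩ : ¬ FiniteDimensional ℂ (Lp ℂ 2 μ))
    (hτ : 1 ≤ τ) (hT : 0 < T) (hP : 0 ≤ P)
    (hb : ∀ j, MemLp (weightPart T b j) 2 (perMeasure T)) (hcoef : CoefCondition T b) {c : ℝ≥0∞}
    (hc : c < ENNReal.ofReal (P * ‖hankel (coefSeq hcoef)‖ ^ 2)) :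
    ∃ ξ ∈ classYC μ d τ T P, c < minMse d τ T b ξ := by
  have hP0 : 0 < P := hP.lt_of_ne' fun h => by simp [h] at hc
  obtain ⟨ε, hε, hε0⟩ := exists_orthonormal_mean_zero hΩ
  obtain ⟨y₀, hy₀, hQ⟩ := exists_eigenvector_blockOp hP hcoef
  set φ : lp (fun _ : ℕ+ => SeqTwo) 2 → ℝ := fun y =>
    ‖(blockHankel hcoef).adjoint (star (pairFamily y))‖ ^ 2 with hφ
  have hφc : Continuous φ :=
    (((blockHankel hcoef).adjoint.continuous.comp (continuous_pairFamily.star)).norm).pow 2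
  have hφ0 : φ y₀ = P * ‖hankel (coefSeq hcoef)‖ ^ 2 := by
    rw [hφ]
    simp only
    rw [(blockOp_apply_eq_iff hcoef _).1 hQ, norm_star, norm_pairFamily, mul_pow, hy₀, mul_comm]
  have hopen : IsOpen {y | c < ENNReal.ofReal (φ y)} :=
    isOpen_lt continuous_const (ENNReal.continuous_ofReal.comp hφc)
  -- The optimal family lies on the sphere of radius `√P`. Approximating from the open ball keeps
  -- the power constraint.
  have hcl : y₀ ∈ closure (Metric.ball 0 (Real.sqrt P) ∩
      (diffSpace SeqTwo : Set (lp (fun _ : ℕ+ => SeqTwo) 2))) := by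
    have h1 : y₀ ∈ closure (Metric.ball (0 : lp (fun _ : ℕ+ => SeqTwo) 2) (Real.sqrt P)) := by
      rw [closure_ball _ (Real.sqrt_pos.2 hP0).ne', mem_closedBall_zero_iff]
      exact Real.le_sqrt_of_sq_le hy₀.le
    exact closure_minimal (dense_diffSpace.open_subset_closure_inter Metric.isOpen_ball)
      isClosed_closure h1
  obtain ⟨y, hyc, hyb, hyd⟩ := mem_closure_iff.1 hcl _ hopen (by
    rw [mem_ofPred_eq, hφ0]; exact hc)
  have hyP : ‖y‖ ^ 2 ≤ P := by
    rw [← Real.sq_sqrt hP]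
    exact pow_le_pow_left₀ (norm_nonneg _) (mem_ball_zero_iff.1 hyb).le 2
  obtain ⟨f, hf, hf0, hfT, hfy⟩ := exists_continuous_of_mem_diffSpace hT hyd
  obtain ⟨ξ, hinc, hξ, hg⟩ := exists_wavePath (d := d) hτ hT hε hε0 hyP
    hf.stronglyMeasurable hfy
  refine ⟨ξ, ⟨hξ, ?_⟩, ?_⟩
  · rw [hinc]; exact continuous_wavePath hε hT hf hf0 hfT
  · refine lt_of_lt_of_le hyc ?_
    rw [minMse_eq, ← ofReal_norm, ← ENNReal.ofReal_pow (norm_nonneg _)]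
    refine ENNReal.ofReal_le_ofReal ?_
    have h := hξ.sum_norm_sq_le hT hP hb hcoef (g := fun _ : Fin 1 => pairFamily y)
      (ε := fun s _ => ε s) (orthonormal_prod_fin_one hε) (hasSum_gen_of_eq hε hg)
    rwa [Fin.sum_univ_one] at h

end Existence

/-! ### Wold decomposition of stationary arrays -/

section Wold

variable {H : Type*} [NormedAddCommGroup H] [InnerProductSpace ℂ H] [CompleteSpace H]

/-! ### The projection onto the closed span of an orthonormal family -/

/-- The orthogonal projection onto the closed span of an orthonormal family. -/
def spanProj {ι : Type*} {ε : ι → H} (hε : Orthonormal ℂ ε) : H →L[ℂ] H :=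
  hε.orthogonalFamily.linearIsometry.toContinuousLinearMap ∘L
    hε.orthogonalFamily.linearIsometry.toContinuousLinearMap.adjoint

section Proj

variable {ι : Type*} {ε : ι → H} (hε : Orthonormal ℂ ε)

theorem adjoint_linearIsometry_apply (v : H) (i : ι) :
    hε.orthogonalFamily.linearIsometry.toContinuousLinearMap.adjoint v i = inner ℂ (ε i) v := by
  classical
  have h : ∀ f : lp (fun _ : ι => ℂ) 2, inner ℂ (lp.single 2 i (1 : ℂ)) f = f i := fun f => by
    rw [lp.inner_single_left]; simp
  rw [← h, ContinuousLinearMap.adjoint_inner_right, LinearIsometry.coe_toContinuousLinearMap,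
    OrthogonalFamily.linearIsometry_apply_single, LinearIsometry.toSpanSingleton_apply, one_smul]

theorem hasSum_spanProj (v : H) : HasSum (fun i => inner ℂ (ε i) v • ε i) (spanProj hε v) := by
  have h := hε.orthogonalFamily.hasSum_linearIsometry
    (hε.orthogonalFamily.linearIsometry.toContinuousLinearMap.adjoint v)
  refine h.congr_fun fun i => ?_
  rw [adjoint_linearIsometry_apply hε, LinearIsometry.toSpanSingleton_apply]

theorem inner_spanProj_eq (v w : H) :
    inner ℂ (spanProj hε v) (spanProj hε w) = inner ℂ (spanProj hε v) w := by
  set J := hε.orthogonalFamily.linearIsometry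
  have h1 : inner ℂ (spanProj hε v) (spanProj hε w) = inner ℂ
    (J.toContinuousLinearMap.adjoint v) (J.toContinuousLinearMap.adjoint w) := J.inner_map_map _ _
  rw [h1, ContinuousLinearMap.adjoint_inner_right]
  rfl

theorem hasSum_inner_spanProj (v w : H) :
    HasSum (fun i => inner ℂ v (ε i) * inner ℂ (ε i) w)
      (inner ℂ (spanProj hε v) (spanProj hε w)) := by
  set J := hε.orthogonalFamily.linearIsometry
  have h1 : inner ℂ (spanProj hε v) (spanProj hε w) = inner ℂ
    (J.toContinuousLinearMap.adjoint v) (J.toContinuousLinearMap.adjoint w) := J.inner_map_map _ _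
  rw [h1]
  refine (lp.hasSum_inner (𝕜 := ℂ) _ _).congr_fun fun i => ?_
  rw [adjoint_linearIsometry_apply hε, adjoint_linearIsometry_apply hε, RCLike.inner_apply,
    inner_conj_symm, mul_comm]

theorem hasSum_norm_sq_spanProj (v : H) :
    HasSum (fun i => ‖inner ℂ (ε i) v‖ ^ 2) (‖spanProj hε v‖ ^ 2) := by
  have h1 : ‖spanProj hε v‖ =
      ‖hε.orthogonalFamily.linearIsometry.toContinuousLinearMap.adjoint v‖ :=
    hε.orthogonalFamily.linearIsometry.norm_map _
  rw [h1]
  refine (lp_two_hasSum_norm_sq _).congr_fun fun i => ?_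
  rw [adjoint_linearIsometry_apply hε]

theorem inner_sub_spanProj (v w : H) :
    inner ℂ (v - spanProj hε v) (w - spanProj hε w) =
      inner ℂ v w - inner ℂ (spanProj hε v) (spanProj hε w) := by
  have h1 := inner_spanProj_eq hε v w
  have h2 := inner_spanProj_eq hε w v
  rw [← inner_conj_symm, ← inner_conj_symm _ v] at h2
  have h3 := (RingHom.injective (starRingEnd ℂ)) h2
  rw [inner_sub_left, inner_sub_right, inner_sub_right, ← h1, ← h3]
  ring

theorem norm_sq_eq_add_spanProj (v : H) :
    ‖v‖ ^ 2 = ‖spanProj hε v‖ ^ 2 + ‖v - spanProj hε v‖ ^ 2 := by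
  have h := inner_sub_spanProj hε v v
  simp only [inner_self_eq_norm_sq_to_K] at h
  have h2 : ‖v - spanProj hε v‖ ^ 2 = ‖v‖ ^ 2 - ‖spanProj hε v‖ ^ 2 := by
    apply Complex.ofReal_injective; push_cast; exact h
  linarith

theorem spanProj_mem {S : Submodule ℂ H} (hS : IsClosed (S : Set H)) (h : ∀ i, ε i ∈ S) (v : H) :
    spanProj hε v ∈ S :=
  hS.mem_of_tendsto (hasSum_spanProj hε v) (Eventually.of_forall fun _ =>
    Submodule.sum_mem _ fun i _ => S.smul_mem _ (h i))

theorem inner_spanProj_of_forall {y v : H} (h : ∀ i, inner ℂ y (ε i) = 0 ∨ inner ℂ (ε i) v = 0) :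
    inner ℂ y (spanProj hε v) = 0 := by
  have h1 := (hasSum_spanProj hε v).mapL (innerSL ℂ y)
  refine h1.unique (hasSum_zero.congr_fun fun i => ?_)
  rw [innerSL_apply_apply, inner_smul_right]
  rcases h i with h | h <;> simp [h]

theorem inner_spanProj_self (v : H) (i : ι) :
    inner ℂ (ε i) (spanProj hε v) = inner ℂ (ε i) v := by
  have h1 := (hasSum_spanProj hε v).mapL (innerSL ℂ (ε i))
  have h2 := h1.unique (hasSum_single i fun j hj => by
    rw [innerSL_apply_apply, inner_smul_right, hε.2 hj.symm, mul_zero])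
  rw [innerSL_apply_apply, innerSL_apply_apply, inner_smul_right, inner_self_eq_norm_sq_to_K,
    hε.1] at h2
  simpa using h2

end Proj

/-! ### The shift of a stationary array -/

variable {κ : Type*}

/-- The closed linear span of the past of an array. -/
def pastSpan (x : κ → ℤ → H) (j : ℤ) : Submodule ℂ H :=
  (Submodule.span ℂ {v | ∃ (k : κ) (l : ℤ), l ≤ j ∧ v = x k l}).topologicalClosure

/-- The closed linear span of an array. -/
def totalSpan (x : κ → ℤ → H) : Submodule ℂ H :=
  (Submodule.span ℂ {v | ∃ (k : κ) (l : ℤ), v = x k l}).topologicalClosure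

theorem isClosed_pastSpan (x : κ → ℤ → H) (j : ℤ) : IsClosed (pastSpan x j : Set H) :=
  Submodule.isClosed_topologicalClosure _

theorem isClosed_totalSpan (x : κ → ℤ → H) : IsClosed (totalSpan x : Set H) :=
  Submodule.isClosed_topologicalClosure _

instance (x : κ → ℤ → H) : CompleteSpace (totalSpan x) := (isClosed_totalSpan x).completeSpace_coe

instance (x : κ → ℤ → H) (j : ℤ) : CompleteSpace (pastSpan x j) :=
  (isClosed_pastSpan x j).completeSpace_coe

theorem mem_pastSpan (x : κ → ℤ → H) (k : κ) {l j : ℤ} (h : l ≤ j) : x k l ∈ pastSpan x j :=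
  Submodule.le_topologicalClosure _ (Submodule.subset_span ⟨k, l, h, rfl⟩)

theorem mem_totalSpan (x : κ → ℤ → H) (k : κ) (l : ℤ) : x k l ∈ totalSpan x :=
  Submodule.le_topologicalClosure _ (Submodule.subset_span ⟨k, l, rfl⟩)

theorem pastSpan_le_totalSpan (x : κ → ℤ → H) (j : ℤ) : pastSpan x j ≤ totalSpan x := by
  refine Submodule.topologicalClosure_mono (Submodule.span_mono ?_)
  rintro v ⟨k, l, -, rfl⟩
  exact ⟨k, l, rfl⟩

theorem pastSpan_mono (x : κ → ℤ → H) {i j : ℤ} (h : i ≤ j) : pastSpan x i ≤ pastSpan x j := by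
  refine Submodule.topologicalClosure_mono (Submodule.span_mono ?_)
  rintro v ⟨k, l, hl, rfl⟩
  exact ⟨k, l, hl.trans h, rfl⟩

theorem inner_eq_zero_of_mem_totalSpan {x : κ → ℤ → H} {e : H}
    (h : ∀ k l, inner ℂ e (x k l) = 0) {v : H} (hv : v ∈ totalSpan x) : inner ℂ e v = 0 := by
  have h1 : totalSpan x ≤ (innerSL ℂ e).ker := by
    refine Submodule.topologicalClosure_minimal _ (Submodule.span_le.2 ?_)
      (innerSL ℂ e).isClosed_ker
    rintro x ⟨k, l, rfl⟩
    exact h k l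
  exact h1 hv

theorem formEval_mem_totalSpan (x : κ → ℤ → H) (c : κ × ℤ →₀ ℂ) : formEval x c ∈ totalSpan x := by
  rw [formEval_apply]
  exact Submodule.sum_mem _ fun i _ => Submodule.smul_mem _ _ (mem_totalSpan x _ _)

/-- Evaluation of linear forms with values in the closed span. -/
def formEvalR (x : κ → ℤ → H) : (κ × ℤ →₀ ℂ) →ₗ[ℂ] totalSpan x :=
  (formEval x).codRestrict _ (formEval_mem_totalSpan x)

theorem denseRange_formEvalR (x : κ → ℤ → H) : DenseRange (formEvalR x) := by
  intro f
  rw [closure_subtype]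
  have h : (f : H) ∈ closure (Submodule.span ℂ {v | ∃ (k : κ) (l : ℤ), v = x k l} : Set H) := f.2
  refine closure_mono ?_ h
  have hle : Submodule.span ℂ {v | ∃ (k : κ) (l : ℤ), v = x k l} ≤
      LinearMap.range (formEval x) := by
    refine Submodule.span_le.2 ?_
    rintro v ⟨k, l, rfl⟩
    exact ⟨Finsupp.single (k, l) 1, by simp [formEval]⟩
  intro v hv
  obtain ⟨c, rfl⟩ := hle hv
  exact ⟨formEvalR x c, ⟨c, rfl⟩, rfl⟩

/-- The shift by `n` steps on the closed span of a stationary array, extended by zero. -/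
def shiftOp (x : κ → ℤ → H) (n : ℤ) : H →L[ℂ] H :=
  (formEval fun k j => x k (j + n)).extendOfNorm (formEvalR x) ∘L
    (totalSpan x).orthogonalProjectionOnto

theorem shiftOp_apply {x : κ → ℤ → H} (hx : IsStationary x) (n : ℤ) (k : κ) (j : ℤ) : shiftOp x n (x k j) = x k (j + n) := by
  have hb : ∀ c, ‖(formEval fun k j => x k (j + n)) c‖ ≤ 1 * ‖formEvalR x c‖ := fun c => by
    rw [one_mul, formEval_apply, norm_formEval_shift hx]
    rfl
  have h1 := LinearMap.extendOfNorm_eq (denseRange_formEvalR x) ⟨_, hb⟩ (Finsupp.single (k, j) 1)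
  have h2 : (totalSpan x).orthogonalProjectionOnto (x k j) =
      formEvalR x (Finsupp.single (k, j) 1) := by
    have h3 : x k j = (formEvalR x (Finsupp.single (k, j) 1) : H) := by
      simp [formEvalR, formEval]
    conv_lhs => rw [h3]
    exact Submodule.orthogonalProjectionOnto_mem_subspace_eq_self _
  rw [shiftOp, ContinuousLinearMap.comp_apply, h2, h1]
  simp [formEval]


theorem mapsTo_topologicalClosure_span {F : Type*} [NormedAddCommGroup F] [NormedSpace ℂ F]
    {s : Set H} {S : Submodule ℂ F} (hS : IsClosed (S : Set F)) (f : H →L[ℂ] F)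
    (h : ∀ v ∈ s, f v ∈ S) {v : H} (hv : v ∈ (Submodule.span ℂ s).topologicalClosure) :
    f v ∈ S := by
  have h1 : (Submodule.span ℂ s).topologicalClosure ≤ S.comap (f : H →ₗ[ℂ] F) :=
    Submodule.topologicalClosure_minimal _ (Submodule.span_le.2 h) (hS.preimage f.continuous)
  exact h1 hv

theorem eq_of_mem_totalSpan {F : Type*} [NormedAddCommGroup F] [NormedSpace ℂ F] {x : κ → ℤ → H}
    {f g : H →L[ℂ] F} (h : ∀ k j, f (x k j) = g (x k j)) {v : H} (hv : v ∈ totalSpan x) :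
    f v = g v := by
  refine ContinuousLinearMap.eqOn_closure_span ?_ hv
  rintro _ ⟨k, l, rfl⟩
  exact h k l

section Shift

variable {x : κ → ℤ → H}

theorem shiftOp_mem_pastSpan (hx : IsStationary x) (n : ℤ) {j : ℤ} {v : H} (hv : v ∈ pastSpan x j) :
    shiftOp x n v ∈ pastSpan x (j + n) := by
  refine mapsTo_topologicalClosure_span (isClosed_pastSpan x (j + n)) (shiftOp x n) ?_ hv
  rintro _ ⟨k, l, hl, rfl⟩
  rw [shiftOp_apply hx]
  exact mem_pastSpan x k (by omega)

theorem shiftOp_mem_totalSpan (hx : IsStationary x) (n : ℤ) {v : H} (hv : v ∈ totalSpan x) :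
    shiftOp x n v ∈ totalSpan x := by
  refine mapsTo_topologicalClosure_span (isClosed_totalSpan x) (shiftOp x n) ?_ hv
  rintro _ ⟨k, l, rfl⟩
  rw [shiftOp_apply hx]
  exact mem_totalSpan x k _

/-- Stationarity gives this on the generators; it extends to the closed span one argument at a time.
-/
theorem inner_shiftOp (hx : IsStationary x) (n : ℤ) {v w : H} (hv : v ∈ totalSpan x) (hw : w ∈ totalSpan x) :
    inner ℂ (shiftOp x n v) (shiftOp x n w) = inner ℂ v w := by
  have h1 : ∀ k j, inner ℂ (x k j) (shiftOp x (-n) (shiftOp x n w)) = inner ℂ (x k j) w ∧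
      inner ℂ (x k (j + n)) (shiftOp x n w) = inner ℂ (x k j) w := by
    intro k j
    refine ⟨?_, ?_⟩
    · refine eq_of_mem_totalSpan (x := x)
        (f := innerSL ℂ (x k j) ∘L shiftOp x (-n) ∘L shiftOp x n) (g := innerSL ℂ (x k j))
        (fun k' l => ?_) hw
      simp [shiftOp_apply hx]
    · refine eq_of_mem_totalSpan (x := x)
        (f := innerSL ℂ (x k (j + n)) ∘L shiftOp x n) (g := innerSL ℂ (x k j)) (fun k' l => ?_) hw
      simp [shiftOp_apply hx, hx.inner_add]
  rw [← inner_conj_symm, ← inner_conj_symm v]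
  congr 1
  refine eq_of_mem_totalSpan (x := x)
    (f := innerSL ℂ (shiftOp x n w) ∘L shiftOp x n) (g := innerSL ℂ w) (fun k j => ?_) hv
  rw [ContinuousLinearMap.comp_apply, shiftOp_apply hx, innerSL_apply_apply, innerSL_apply_apply,
    ← inner_conj_symm, (h1 k j).2, inner_conj_symm]

theorem shiftOp_shiftOp (hx : IsStationary x) (n m : ℤ) {v : H} (hv : v ∈ totalSpan x) :
    shiftOp x n (shiftOp x m v) = shiftOp x (m + n) v := by
  refine eq_of_mem_totalSpan (x := x) (f := shiftOp x n ∘L shiftOp x m) (g := shiftOp x (m + n))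
    (fun k j => ?_) hv
  rw [ContinuousLinearMap.comp_apply, shiftOp_apply hx, shiftOp_apply hx, shiftOp_apply hx,
    add_assoc]

theorem shiftOp_zero (hx : IsStationary x) {v : H} (hv : v ∈ totalSpan x) : shiftOp x 0 v = v := by
  refine eq_of_mem_totalSpan (x := x) (f := shiftOp x 0) (g := ContinuousLinearMap.id ℂ H)
    (fun k j => ?_) hv
  rw [shiftOp_apply hx, add_zero]
  rfl

/-! ### The innovation space -/

/-- The part of the present orthogonal to the past. -/
def innovSpace (x : κ → ℤ → H) : Submodule ℂ H := pastSpan x 0 ⊓ (pastSpan x (-1))ᗮ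

theorem innovSpace_le_totalSpan : innovSpace x ≤ totalSpan x :=
  inf_le_left.trans (pastSpan_le_totalSpan x 0)

theorem inner_shiftOp_apply (hx : IsStationary x) (n : ℤ) {e : H} (he : e ∈ totalSpan x) (k : κ) (j : ℤ) :
    inner ℂ (shiftOp x n e) (x k (j + n)) = inner ℂ e (x k j) := by
  rw [← shiftOp_apply hx, inner_shiftOp hx n he (mem_totalSpan x k j)]

theorem shiftOp_mem_of_mem_innovSpace (hx : IsStationary x) {e : H} (he : e ∈ innovSpace x) (n : ℤ) :
    shiftOp x n e ∈ pastSpan x n := by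
  have h := shiftOp_mem_pastSpan hx n he.1
  rwa [zero_add] at h

theorem inner_shiftOp_pastSpan (hx : IsStationary x) {e : H} (he : e ∈ innovSpace x) {s j : ℤ} (hj : j < s) {v : H}
    (hv : v ∈ pastSpan x j) : inner ℂ (shiftOp x s e) v = 0 := by
  have hvt := pastSpan_le_totalSpan x j hv
  have het := innovSpace_le_totalSpan he
  have h1 : shiftOp x s (shiftOp x (-s) v) = v := by
    rw [shiftOp_shiftOp hx _ _ hvt, neg_add_cancel, shiftOp_zero hx hvt]
  rw [← h1, inner_shiftOp hx s het (shiftOp_mem_totalSpan hx _ hvt)]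
  refine Submodule.inner_left_of_mem_orthogonal ?_ he.2
  exact pastSpan_mono x (by omega) (shiftOp_mem_pastSpan hx (-s) hv)

theorem orthonormal_shiftOp (hx : IsStationary x) {ι : Type*} {e : ι → H} (he : Orthonormal ℂ e)
    (hm : ∀ i, e i ∈ innovSpace x) :
    Orthonormal ℂ (fun i : ℤ × ι => shiftOp x i.1 (e i.2)) := by
  have hlt : ∀ (s r : ℤ) (m n : ι), r < s →
      inner ℂ (shiftOp x s (e m)) (shiftOp x r (e n)) = 0 := fun s r m n h =>
    inner_shiftOp_pastSpan hx (hm m) h (shiftOp_mem_of_mem_innovSpace hx (hm n) r)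
  have heq : ∀ (s : ℤ) (m n : ι),
      inner ℂ (shiftOp x s (e m)) (shiftOp x s (e n)) = inner ℂ (e m) (e n) := fun s m n =>
    inner_shiftOp hx s (innovSpace_le_totalSpan (hm m)) (innovSpace_le_totalSpan (hm n))
  constructor
  · rintro ⟨s, m⟩
    have h := heq s m m
    rw [inner_self_eq_norm_sq_to_K, inner_self_eq_norm_sq_to_K, he.1] at h
    have h2 : ‖shiftOp x s (e m)‖ ^ 2 = 1 := by
      apply Complex.ofReal_injective; push_cast; simpa using h
    exact (pow_eq_one_iff_of_nonneg (norm_nonneg _) two_ne_zero).1 h2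
  · rintro ⟨s, m⟩ ⟨r, n⟩ hne
    simp only
    rcases lt_trichotomy s r with h | h | h
    · rw [← inner_conj_symm, hlt r s n m h, map_zero]
    · subst h
      rw [heq, he.2 fun hmn => hne (by rw [hmn])]
    · exact hlt s r m n h

/-- A vector of the closed span which is orthogonal to the past and to all innovations vanishes. -/
theorem eq_zero_of_orthogonal_innovations (hx : IsStationary x) {v : H} (hv : v ∈ totalSpan x)
    (h0 : ∀ y ∈ pastSpan x (-1), inner ℂ v y = 0)
    (h1 : ∀ e ∈ innovSpace x, ∀ s : ℤ, inner ℂ v (shiftOp x s e) = 0) : v = 0 := by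
  -- Induction on the past up to time `n - 1`. The residual of a vector of the past up to `n`, after
  -- projection onto the past up to `n - 1`, is the `n`-th shift of an innovation.
  have key : ∀ n : ℕ, ∀ y ∈ pastSpan x ((n : ℤ) - 1), inner ℂ v y = 0 := by
    intro n
    induction n with
    | zero => simpa using h0
    | succ n ih =>
      intro y hy
      rw [Nat.cast_succ, add_sub_cancel_right] at hy
      set z := (pastSpan x ((n : ℤ) - 1)).starProjection y with hz
      have hzm : z ∈ pastSpan x ((n : ℤ) - 1) := Submodule.starProjection_apply_mem _ _
      have hyz : y - z ∈ pastSpan x n :=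
        Submodule.sub_mem _ hy (pastSpan_mono x (by omega) hzm)
      have hyzt := pastSpan_le_totalSpan x _ hyz
      have horth : y - z ∈ (pastSpan x ((n : ℤ) - 1))ᗮ :=
        Submodule.sub_starProjection_mem_orthogonal _
      have he : shiftOp x (-n) (y - z) ∈ innovSpace x := by
        refine ⟨?_, ?_⟩
        · have := shiftOp_mem_pastSpan hx (-n) hyz
          rwa [add_neg_cancel] at this
        · refine (Submodule.mem_orthogonal' _ _).2 fun w hw => ?_
          have hwt := pastSpan_le_totalSpan x _ hw
          have h3 : shiftOp x (-n) (shiftOp x n w) = w := by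
            rw [shiftOp_shiftOp hx _ _ hwt, add_neg_cancel, shiftOp_zero hx hwt]
          rw [← h3, inner_shiftOp hx (-n) hyzt (shiftOp_mem_totalSpan hx _ hwt)]
          refine Submodule.inner_left_of_mem_orthogonal ?_ horth
          have := shiftOp_mem_pastSpan hx n hw
          rwa [neg_add_eq_sub] at this
      have h4 := h1 _ he n
      rw [shiftOp_shiftOp hx _ _ hyzt, neg_add_cancel, shiftOp_zero hx hyzt, inner_sub_right,
        ih z hzm, sub_zero] at h4
      exact h4
  have hall : ∀ k l, inner ℂ v (x k l) = 0 := fun k l =>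
    key (l + 1).toNat _ (mem_pastSpan x k (by omega))
  exact inner_self_eq_zero.1 (inner_eq_zero_of_mem_totalSpan hall hv)

/-! ### Stationarity of the projections -/

/-- Moving both arguments by one step permutes the orthonormal family of shifted innovations. -/
theorem isStationary_spanProj (hx : IsStationary x) {ι : Type*} {e : ι → H} (he : Orthonormal ℂ e)
    (hm : ∀ i, e i ∈ innovSpace x) :
    IsStationary fun k j => spanProj (orthonormal_shiftOp hx he hm) (x k j) where
  inner_succ k n j l := by
    have h1 := hasSum_inner_spanProj (orthonormal_shiftOp hx he hm) (x k j) (x n l)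
    have h2 := hasSum_inner_spanProj (orthonormal_shiftOp hx he hm) (x k (j + 1)) (x n (l + 1))
    rw [← ((Equiv.addRight (1 : ℤ)).prodCongr (Equiv.refl ι)).hasSum_iff] at h2
    refine h2.unique (h1.congr_fun fun i => ?_)
    have h3 : ∀ k j, inner ℂ (shiftOp x (i.1 + 1) (e i.2)) (x k (j + 1)) =
        inner ℂ (shiftOp x i.1 (e i.2)) (x k j) := fun k j => by
      have het := innovSpace_le_totalSpan (hm i.2)
      rw [← shiftOp_shiftOp hx 1 i.1 het]
      exact inner_shiftOp_apply hx 1 (shiftOp_mem_totalSpan hx _ het) k j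
    simp only [Function.comp_apply, Equiv.prodCongr_apply, Prod.map_fst, Prod.map_snd,
      Equiv.coe_addRight, Equiv.refl_apply]
    rw [h3, ← inner_conj_symm, h3, inner_conj_symm]
  summable := hx.summable.of_nonneg_of_le (fun _ => sq_nonneg _) fun k => by
    rw [norm_sq_eq_add_spanProj (orthonormal_shiftOp hx he hm) (x k 0)]
    exact le_add_of_nonneg_right (sq_nonneg _)

theorem isStationary_sub_spanProj (hx : IsStationary x) {ι : Type*} {e : ι → H} (he : Orthonormal ℂ e)
    (hm : ∀ i, e i ∈ innovSpace x) :
    IsStationary fun k j => x k j - spanProj (orthonormal_shiftOp hx he hm) (x k j) where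
  inner_succ k n j l := by
    rw [inner_sub_spanProj, inner_sub_spanProj, hx.inner_succ,
      (isStationary_spanProj hx he hm).inner_succ]
  summable := hx.summable.of_nonneg_of_le (fun _ => sq_nonneg _) fun k => by
    rw [norm_sq_eq_add_spanProj (orthonormal_shiftOp hx he hm) (x k 0)]
    exact le_add_of_nonneg_left (sq_nonneg _)

theorem power_eq_add_spanProj (hx : IsStationary x) {ι : Type*} {e : ι → H} (he : Orthonormal ℂ e)
    (hm : ∀ i, e i ∈ innovSpace x) :
    power x = power (fun k j => spanProj (orthonormal_shiftOp hx he hm) (x k j)) +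
      power (fun k j => x k j - spanProj (orthonormal_shiftOp hx he hm) (x k j)) := by
  rw [power, power, power, ← (isStationary_spanProj hx he hm).summable.tsum_add
    (isStationary_sub_spanProj hx he hm).summable]
  exact tsum_congr fun k => norm_sq_eq_add_spanProj (orthonormal_shiftOp hx he hm) (x k 0)

end Shift

end Wold

/-! ### Arrays attaining the error bound -/

section Extremal

variable {H : Type*} [NormedAddCommGroup H] [InnerProductSpace ℂ H] [CompleteSpace H]

/-! ### Coefficients along the innovations -/

section Coef

variable {κ : Type*} {x : κ → ℤ → H}

theorem inner_shiftOp_sub (hx : IsStationary x) {e : H} (he : e ∈ innovSpace x) (s : ℤ) (k : κ)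
    (j : ℤ) : inner ℂ (shiftOp x s e) (x k j) = inner ℂ e (x k (j - s)) := by
  have h := inner_shiftOp_apply hx s (innovSpace_le_totalSpan he) k (j - s)
  rwa [sub_add_cancel] at h

theorem inner_shiftOp_of_lt (hx : IsStationary x) {e : H} (he : e ∈ innovSpace x) {s j : ℤ}
    (h : j < s) (k : κ) : inner ℂ (shiftOp x s e) (x k j) = 0 :=
  inner_shiftOp_pastSpan hx he h (mem_pastSpan x k le_rfl)

theorem hasSum_norm_sq_inner_innov (hx : IsStationary x) {ι : Type*} {e : ι → H}
    (he : Orthonormal ℂ e) (hm : ∀ i, e i ∈ innovSpace x) (k : κ) :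
    HasSum (fun i : ι × ℕ => ‖inner ℂ (x k i.2) (e i.1)‖ ^ 2)
      (‖spanProj (orthonormal_shiftOp hx he hm) (x k 0)‖ ^ 2) := by
  have h1 := hasSum_norm_sq_spanProj (orthonormal_shiftOp hx he hm) (x k 0)
  -- Innovations at positive times do not contribute at time `0`; the one at time `-p` gives the
  -- coefficient with lag `p`.
  have hinj : Function.Injective fun i : ι × ℕ => (-(i.2 : ℤ), i.1) := fun i j h => by
    simp only [Prod.mk.injEq, neg_inj, Nat.cast_inj] at h
    exact Prod.ext h.2 h.1
  rw [← hinj.hasSum_iff] at h1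
  · refine h1.congr_fun fun i => ?_
    rw [Function.comp_apply, inner_shiftOp_sub hx (hm _), zero_sub, neg_neg, norm_inner_symm]
  · rintro ⟨s, i⟩ hs
    have h2 : 0 < s := by
      by_contra hcon
      exact hs ⟨(i, (-s).toNat), Prod.ext (by simp only; omega) rfl⟩
    rw [inner_shiftOp_of_lt hx (hm i) h2, norm_zero, zero_pow two_ne_zero]

theorem hasSum_norm_sq_inner_innov_power (hx : IsStationary x) {ι : Type*} {e : ι → H}
    (he : Orthonormal ℂ e) (hm : ∀ i, e i ∈ innovSpace x) :
    HasSum (fun i : ι × (ℕ × κ) => ‖inner ℂ (x i.2.2 i.2.1) (e i.1)‖ ^ 2)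
      (power fun k j => spanProj (orthonormal_shiftOp hx he hm) (x k j)) := by
  have h1 := hasSum_norm_sq_inner_innov hx he hm
  have h2 : Summable fun i : κ × (ι × ℕ) => ‖inner ℂ (x i.1 i.2.2) (e i.2.1)‖ ^ 2 := by
    refine (summable_prod_of_nonneg fun _ => sq_nonneg _).2 ⟨fun k => (h1 k).summable, ?_⟩
    exact (isStationary_spanProj hx he hm).summable.congr fun k => (h1 k).tsum_eq.symm
  have h3 : ∑' i : κ × (ι × ℕ), ‖inner ℂ (x i.1 i.2.2) (e i.2.1)‖ ^ 2 =
      power fun k j => spanProj (orthonormal_shiftOp hx he hm) (x k j) := by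
    rw [h2.tsum_prod]
    exact tsum_congr fun k => (h1 k).tsum_eq
  have h4 := h2.hasSum
  rw [h3, ← ((Equiv.prodAssoc ι ℕ κ).symm.trans (Equiv.prodComm _ _)).hasSum_iff] at h4
  exact h4

theorem summable_norm_sq_inner_innov (hx : IsStationary x) {e : H} (he : e ∈ innovSpace x) :
    Summable fun i : ℕ × κ => ‖inner ℂ (x i.2 i.1) e‖ ^ 2 := by
  by_cases h0 : e = 0
  · simp [h0]
  · have hn : ‖e‖ ≠ 0 := norm_ne_zero_iff.2 h0
    have h1 : Orthonormal ℂ fun _ : Unit => ((‖e‖ : ℂ)⁻¹) • e := by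
      refine ⟨fun _ => ?_, fun i j h => absurd (Subsingleton.elim i j) h⟩
      rw [norm_smul, norm_inv, Complex.norm_real, norm_norm, inv_mul_cancel₀ hn]
    have h2 := (hasSum_norm_sq_inner_innov_power hx h1
      fun _ => (innovSpace x).smul_mem _ he).summable
    rw [← (Equiv.punitProd (ℕ × κ)).symm.summable_iff] at h2
    refine (h2.mul_left (‖e‖ ^ 2)).congr fun i => ?_
    simp only [Function.comp_apply, Equiv.punitProd_symm_apply, inner_smul_right, norm_mul,
      norm_inv, Complex.norm_real, norm_norm]
    field_simp

end Coef

variable {x : ℕ+ → ℤ → H}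

/-- The conjugated coefficients of a stationary array along an innovation. -/
def innovCoef (hx : IsStationary x) : innovSpace x →ₗ[ℂ] Ell2 where
  toFun e := lpTwoMk (fun i => inner ℂ (x i.2 i.1) (e : H)) (summable_norm_sq_inner_innov hx e.2)
  map_add' e f := by apply lp.ext; funext i; exact inner_add_right _ _ _
  map_smul' c e := by apply lp.ext; funext i; exact inner_smul_right _ _ _

theorem innovCoef_apply (hx : IsStationary x) (e : innovSpace x) (p : ℕ) (k : ℕ+) :
    innovCoef hx e (p, k) = inner ℂ (x k p) (e : H) := rfl

/-- An innovation is orthogonal to the past. If its coefficients vanish, it is orthogonal to the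
rest of the array too, and it lies in the closed span. -/
theorem injective_innovCoef (hx : IsStationary x) : Function.Injective (innovCoef hx) := by
  refine (injective_iff_map_eq_zero _).2 fun e he => Subtype.ext ?_
  have hall : ∀ k l, inner ℂ (e : H) (x k l) = 0 := by
    intro k l
    rcases lt_or_ge l 0 with h | h
    · exact Submodule.inner_left_of_mem_orthogonal (mem_pastSpan x k (by omega)) e.2.2
    · obtain ⟨p, rfl⟩ := Int.eq_ofNat_of_zero_le h
      rw [← inner_conj_symm, ← innovCoef_apply hx, he]
      simp
  exact inner_self_eq_zero.1
    (inner_eq_zero_of_mem_totalSpan hall (innovSpace_le_totalSpan e.2))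

theorem sum_norm_sq_innovCoef (hx : IsStationary x) {ι : Type*} [Fintype ι]
    {e : ι → innovSpace x} (he : Orthonormal ℂ fun i => (e i : H)) :
    ∑ i, ‖innovCoef hx (e i)‖ ^ 2 =
      power fun k j => spanProj (orthonormal_shiftOp hx he fun i => (e i).2) (x k j) := by
  have h1 := (hasSum_norm_sq_inner_innov_power hx he fun i => (e i).2).prod_fiberwise
    fun i => lp_two_hasSum_norm_sq (innovCoef hx (e i))
  exact (hasSum_fintype _).unique h1

/-! ### Extremal arrays -/

variable {T : ℝ} {b : ℝ → ℂ}

/-- The stationary array `x` attains the bound for the prediction error given by the symbol `G`. -/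
structure IsExtremal (hcoef : CoefCondition T b) (x : ℕ+ → ℤ → H) (G : trigSpace ℕ+) : Prop where
  stationary : IsStationary x
  norm_le : ‖G‖ ≤ ‖hankel (coefSeq hcoef)‖
  sub_mem : trigEval x ⟨_, symbol_mem_trigSpace (isSmoothSymbol_coefSeq hcoef)⟩ - trigEval x G ∈
    pastSpan x (-1)
  orthogonal : ∀ y ∈ pastSpan x (-1), inner ℂ (trigEval x G) y = 0
  le_norm : ‖hankel (coefSeq hcoef)‖ ^ 2 * power x ≤ ‖trigEval x G‖ ^ 2

variable {hcoef : CoefCondition T b} {G : trigSpace ℕ+}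

theorem norm_trigEval_sq_le {y : ℕ+ → ℤ → H} (hy : IsStationary y)
    (hG : ‖G‖ ≤ ‖hankel (coefSeq hcoef)‖) :
    ‖trigEval y G‖ ^ 2 ≤ ‖hankel (coefSeq hcoef)‖ ^ 2 * power y := by
  refine (pow_le_pow_left₀ (norm_nonneg _) (norm_trigEval_le hy G) 2).trans ?_
  rw [mul_pow, Real.sq_sqrt (power_nonneg _), mul_comm]
  exact mul_le_mul_of_nonneg_right (pow_le_pow_left₀ (norm_nonneg _) hG 2) (power_nonneg _)

/-- Both parts of the array are stationary, so each obeys the bound. Squared errors and powers add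
up by Pythagoras, so equality for the whole array forces equality for each part. -/
theorem IsExtremal.norm_sq_spanProj (h : IsExtremal hcoef x G) {ι : Type*} {e : ι → H}
    (he : Orthonormal ℂ e) (hm : ∀ i, e i ∈ innovSpace x) :
    ‖spanProj (orthonormal_shiftOp h.stationary he hm) (trigEval x G)‖ ^ 2 =
        ‖hankel (coefSeq hcoef)‖ ^ 2 *
          power (fun k j => spanProj (orthonormal_shiftOp h.stationary he hm) (x k j)) ∧
      ‖trigEval x G - spanProj (orthonormal_shiftOp h.stationary he hm) (trigEval x G)‖ ^ 2 =
        ‖hankel (coefSeq hcoef)‖ ^ 2 *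
          power (fun k j => x k j - spanProj (orthonormal_shiftOp h.stationary he hm) (x k j)) := by
  set R := spanProj (orthonormal_shiftOp h.stationary he hm) with hR
  have hs1 := isStationary_spanProj h.stationary he hm
  have hs2 := isStationary_sub_spanProj h.stationary he hm
  have h1 := norm_trigEval_sq_le hs1 h.norm_le
  have h2 := norm_trigEval_sq_le hs2 h.norm_le
  rw [trigEval_map h.stationary hs1 R fun _ _ => rfl] at h1
  rw [trigEval_map h.stationary hs2 (ContinuousLinearMap.id ℂ H - R) fun _ _ => rfl] at h2
  have h3 := h.le_norm
  rw [power_eq_add_spanProj h.stationary he hm,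
    norm_sq_eq_add_spanProj (orthonormal_shiftOp h.stationary he hm), mul_add] at h3
  simp only [sub_apply, ContinuousLinearMap.id_apply] at h2
  constructor <;> linarith

/-- At times `s ≥ 0` the estimate is invisible, so the functional itself is paired with the
innovation. -/
theorem IsExtremal.inner_shiftOp_natCast (h : IsExtremal hcoef x G) (e : innovSpace x) (s : ℕ) :
    inner ℂ (shiftOp x s e) (trigEval x G) =
      conj ((blockHankel hcoef).adjoint (innovCoef h.stationary e) s) := by
  have h1 := inner_trigEval_symbol hcoef h.stationary (e := shiftOp x s e) (s := s)
    (star (innovCoef h.stationary e))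
    (fun k j hj => inner_shiftOp_of_lt h.stationary e.2 (by exact_mod_cast hj) k)
    (fun k p => by
      rw [inner_shiftOp_sub h.stationary e.2, Nat.cast_add, add_sub_cancel_left,
        ← inner_conj_symm, ← innovCoef_apply h.stationary]
      rfl)
  rw [star_star] at h1
  rw [← h1, ← sub_eq_zero, ← inner_sub_right, ← neg_sub, inner_neg_right, neg_eq_zero]
  exact inner_shiftOp_pastSpan h.stationary e.2 (by omega) h.sub_mem

theorem IsExtremal.inner_shiftOp_neg (h : IsExtremal hcoef x G) (e : innovSpace x) {s : ℤ}
    (hs : s < 0) : inner ℂ (shiftOp x s e) (trigEval x G) = 0 := by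
  rw [← inner_conj_symm, h.orthogonal _ (pastSpan_mono x (by omega)
    (shiftOp_mem_of_mem_innovSpace h.stationary e.2 s)), map_zero]

theorem IsExtremal.sum_norm_sq_adjoint (h : IsExtremal hcoef x G) {ι : Type*} [Fintype ι]
    {e : ι → innovSpace x} (he : Orthonormal ℂ fun i => (e i : H)) :
    ∑ i, ‖(blockHankel hcoef).adjoint (innovCoef h.stationary (e i))‖ ^ 2 =
      ‖spanProj (orthonormal_shiftOp h.stationary he fun i => (e i).2) (trigEval x G)‖ ^ 2 := by
  have h1 := hasSum_norm_sq_spanProj (orthonormal_shiftOp h.stationary he fun i => (e i).2)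
    (trigEval x G)
  have hinj : Function.Injective fun i : ι × ℕ => ((i.2 : ℤ), i.1) := fun i j h => by
    simp only [Prod.mk.injEq, Nat.cast_inj] at h
    exact Prod.ext h.2 h.1
  rw [← hinj.hasSum_iff] at h1
  · refine (hasSum_fintype _).unique (h1.prod_fiberwise fun i => ?_)
    refine (lp_two_hasSum_norm_sq _).congr_fun fun s => ?_
    rw [Function.comp_apply, h.inner_shiftOp_natCast, RCLike.norm_conj]
  · rintro ⟨s, i⟩ hs
    have h2 : s < 0 := by
      by_contra hcon
      exact hs ⟨(i, s.toNat), Prod.ext (by simp only; omega) rfl⟩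
    rw [h.inner_shiftOp_neg (e i) h2, norm_zero, zero_pow two_ne_zero]

/-- Equality in the bound for the part generated by the single innovation `e` says that its
coefficient family is maximizing for `Γ†`. Normalization of `e` only supplies an orthonormal family.
-/
theorem IsExtremal.blockOp_innovCoef (h : IsExtremal hcoef x G) (e : innovSpace x) :
    blockOp hcoef (innovCoef h.stationary e) =
      ((‖hankel (coefSeq hcoef)‖ ^ 2 : ℝ) : ℂ) • innovCoef h.stationary e := by
  by_cases h0 : e = 0
  · simp [h0]
  have hn : ‖(e : H)‖ ≠ 0 := norm_ne_zero_iff.2 fun h => h0 (Subtype.ext h)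
  have hnc : ((‖(e : H)‖ : ℂ)⁻¹) ≠ 0 := inv_ne_zero (Complex.ofReal_ne_zero.2 hn)
  have h1 : Orthonormal ℂ fun _ : Unit => ((((‖(e : H)‖ : ℂ)⁻¹) • e : innovSpace x) : H) := by
    refine ⟨fun _ => ?_, fun i j h => absurd (Subsingleton.elim i j) h⟩
    rw [Submodule.coe_smul, norm_smul, norm_inv, Complex.norm_real, norm_norm, inv_mul_cancel₀ hn]
  have h2 := h.sum_norm_sq_adjoint h1
  rw [(h.norm_sq_spanProj h1 fun _ => (((‖(e : H)‖ : ℂ)⁻¹) • e).2).1, ← sum_norm_sq_innovCoef h.stationary h1] at h2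
  simp only [Finset.univ_unique, Finset.sum_singleton, ← mul_pow] at h2
  have h3 := (pow_left_inj₀ (norm_nonneg _)
    (mul_nonneg (norm_nonneg (hankel (coefSeq hcoef))) (norm_nonneg _)) two_ne_zero).1 h2
  have h4 := (blockOp_apply_eq_iff hcoef _).2 h3
  rw [map_smul, map_smul, smul_comm] at h4
  exact smul_right_injective _ hnc h4

/-- The innovation space embeds into the `ν²`-eigenspace of a compact operator, finite dimensional
because `ν ≠ 0`. -/
theorem IsExtremal.finiteDimensional (h : IsExtremal hcoef x G)
    (hν : ‖hankel (coefSeq hcoef)‖ ≠ 0) : FiniteDimensional ℂ (innovSpace x) := by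
  have hfin := ContinuousLinearMap.finite_dimensional_eigenspace
    (isCompactOperator_blockOp hcoef) ((‖hankel (coefSeq hcoef)‖ ^ 2 : ℝ) : ℂ)
    (Complex.ofReal_ne_zero.2 (pow_ne_zero 2 hν))
  let f := (innovCoef h.stationary).codRestrict
    (Module.End.eigenspace (blockOp hcoef).toLinearMap ((‖hankel (coefSeq hcoef)‖ ^ 2 : ℝ) : ℂ))
    fun e => Module.End.mem_eigenspace_iff.2 (h.blockOp_innovCoef e)
  refine Module.Finite.of_injective f fun e e' hee => ?_
  exact injective_innovCoef h.stationary (congrArg Subtype.val hee)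

theorem trigEval_mem_totalSpan (hx : IsStationary x) (f : trigSpace ℕ+) :
    trigEval x f ∈ totalSpan x := by
  refine denseRange_formSymbolR.induction_on (p := fun f => trigEval x f ∈ totalSpan x) f
    ((isClosed_totalSpan x).preimage (trigEval x).continuous) fun c => ?_
  rw [trigEval_formSymbolR hx]
  exact formEval_mem_totalSpan x c

/-- An extremal array is a finite moving average of its innovations. -/
theorem IsExtremal.exists_movingAverage (h : IsExtremal hcoef x G)
    (hν : ‖hankel (coefSeq hcoef)‖ ≠ 0) :
    ∃ (M : ℕ) (g : Fin M → Ell2) (ε : ℤ → Fin M → H),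
      (∀ m, blockOp hcoef (star (g m)) =
        ((‖hankel (coefSeq hcoef)‖ ^ 2 : ℝ) : ℂ) • star (g m)) ∧
      ∑ m, ‖g m‖ ^ 2 = power x ∧ Orthonormal ℂ (fun i : ℤ × Fin M => ε i.1 i.2) ∧
      (∀ s m, ε s m ∈ totalSpan x) ∧
      ∀ k j, HasSum (fun i : ℕ × Fin M => (g i.2 : ℕ × ℕ+ → ℂ) (i.1, k) • ε (j - i.1) i.2)
        (x k j) := by
  have hx := h.stationary
  have hfin := h.finiteDimensional hν
  set B := stdOrthonormalBasis ℂ (innovSpace x)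
  have he : Orthonormal ℂ fun i => (B i : H) :=
    B.orthonormal.comp_linearIsometry (innovSpace x).subtypeₗᵢ
  have hR := orthonormal_shiftOp hx he fun i => (B i).2
  have hmem : ∀ i : ℤ × Fin (Module.finrank ℂ (innovSpace x)),
      shiftOp x i.1 (B i.2 : H) ∈ totalSpan x := fun i =>
    shiftOp_mem_totalSpan hx i.1 (innovSpace_le_totalSpan (B i.2).2)
  have herr : trigEval x G ∈ totalSpan x := trigEval_mem_totalSpan hx G
  -- The error is orthogonal to the past, and so is its projection: only innovations at times `s ≥
  -- 0` enter it. The remainder is also orthogonal to all shifted innovations.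
  have hzero : trigEval x G - spanProj hR (trigEval x G) = 0 := by
    refine eq_zero_of_orthogonal_innovations hx
      (Submodule.sub_mem _ herr (spanProj_mem hR (isClosed_totalSpan x) hmem _)) ?_ ?_
    · intro y hy
      rw [inner_sub_left, h.orthogonal y hy, zero_sub, neg_eq_zero, ← inner_conj_symm,
        inner_spanProj_of_forall hR, map_zero]
      rintro ⟨s, i⟩
      rcases lt_or_ge s 0 with hs | hs
      · exact Or.inr (h.inner_shiftOp_neg (B i) hs)
      · refine Or.inl ?_
        rw [← inner_conj_symm, inner_shiftOp_pastSpan hx (B i).2 (by omega) hy, map_zero]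
    · intro e he' s
      have h1 : ∀ i, inner ℂ (trigEval x G - spanProj hR (trigEval x G))
          (shiftOp x s (B i : H)) = 0 := fun i => by
        rw [← inner_conj_symm, inner_sub_right, inner_spanProj_self hR _ (s, i), sub_self, map_zero]
      have h2 := congrArg (Submodule.subtype _) (B.sum_repr ⟨e, he'⟩)
      simp only [map_sum, map_smul, Submodule.subtype_apply] at h2
      rw [← h2, map_sum, inner_sum]
      refine Finset.sum_eq_zero fun i _ => ?_
      rw [map_smul, inner_smul_right, h1, mul_zero]
  -- The complementary part has zero error, and for it error equals `ν²` times power.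
  have hpow : power (fun k j => x k j - spanProj hR (x k j)) = 0 := by
    have h1 := (h.norm_sq_spanProj he fun i => (B i).2).2
    rw [hzero, norm_zero, zero_pow two_ne_zero, eq_comm] at h1
    exact (mul_eq_zero.1 h1).resolve_left (pow_ne_zero 2 hν)
  have hst := isStationary_sub_spanProj hx he fun i => (B i).2
  have hxR : ∀ k j, spanProj hR (x k j) = x k j := fun k j => by
    have h1 : ‖x k j - spanProj hR (x k j)‖ = ‖x k 0 - spanProj hR (x k 0)‖ := hst.norm_eq k j
    have h2 := hst.summable.hasSum
    rw [show ∑' k, ‖x k 0 - spanProj hR (x k 0)‖ ^ 2 = 0 from hpow,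
      hasSum_zero_iff_of_nonneg fun _ => sq_nonneg _] at h2
    have h3 : ‖x k 0 - spanProj hR (x k 0)‖ ^ 2 = 0 := congrFun h2 k
    rw [pow_eq_zero_iff two_ne_zero] at h3
    rw [h3, norm_eq_zero, sub_eq_zero] at h1
    exact h1.symm
  refine ⟨_, fun m => star (innovCoef hx (B m)), fun s m => shiftOp x s (B m : H), fun m => ?_, ?_,
    hR, fun s m => hmem (s, m), fun k j => ?_⟩
  · rw [star_star]; exact h.blockOp_innovCoef (B m)
  · simp only [norm_star]
    rw [sum_norm_sq_innovCoef hx he]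
    simp only [hxR]
  · have h1 := hasSum_spanProj hR (x k j)
    rw [hxR] at h1
    have hinj : Function.Injective fun i : ℕ × Fin (Module.finrank ℂ (innovSpace x)) =>
        (j - (i.1 : ℤ), i.2) := fun i i' h => by
      simp only [Prod.mk.injEq, sub_right_inj, Nat.cast_inj] at h
      exact Prod.ext h.1 h.2
    rw [← hinj.hasSum_iff] at h1
    · refine h1.congr_fun fun i => ?_
      rw [Function.comp_apply, inner_shiftOp_sub hx (B i.2).2, sub_sub_cancel, ← inner_conj_symm,
        ← innovCoef_apply hx]
      rfl
    · rintro ⟨s, i⟩ hs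
      have h2 : j < s := by
        by_contra hcon
        exact hs ⟨((j - s).toNat, i), Prod.ext (by simp only; omega) rfl⟩
      rw [inner_shiftOp_of_lt hx (B i).2 h2, zero_smul]

end Extremal

section Main

variable {Ω : Type*} [MeasurableSpace Ω] {μ : Measure Ω} {d τ : ℕ} {T P : ℝ}
  {ξ : ℝ → Lp ℂ 2 μ} {b : ℝ → ℂ}

/-! ### Least favorable processes are moving averages -/

/-- Orthogonality to the constant `1` passes from the increments to their Fourier coefficients and
to the closed span. -/
theorem MemY.integral_eq_zero_of_mem_totalSpan [IsFiniteMeasure μ] (hT : 0 < T)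
    (hξ : MemY d τ T P ξ) {v : Lp ℂ 2 μ} (hv : v ∈ totalSpan (gen d τ T ξ)) :
    ∫ ω, (v : Ω → ℂ) ω ∂μ = 0 := by
  rw [← inner_oneLp]
  refine inner_eq_zero_of_mem_totalSpan (fun k j => ?_) hv
  rw [gen_eq, fourierCoef_eq hT]
  refine (integral_inner (𝕜 := ℂ) (integrable_conj_basisFun_smul (hξ.memLp_periodPart j) k)
    (oneLp μ)).symm.trans ?_
  refine integral_eq_zero_of_ae (ae_of_all _ fun u => ?_)
  simp only [inner_smul_right, periodPart, inner_oneLp, hξ.mean_zero, mul_zero, Pi.zero_apply]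

theorem MemY.exists_eigenMovingAverage_of_le [IsFiniteMeasure μ] (hT : 0 < T) (hP : 0 ≤ P)
    (hξ : MemY d τ T P ξ) (hb : ∀ j, MemLp (weightPart T b j) 2 (perMeasure T))
    (hcoef : CoefCondition T b) (hν : ‖hankel (coefSeq hcoef)‖ ≠ 0)
    (hle : ENNReal.ofReal (P * ‖hankel (coefSeq hcoef)‖ ^ 2) ≤ minMse d τ T b ξ) :
    ∃ M, IsEigenMovingAverage d τ T P (blockOp hcoef) (‖hankel (coefSeq hcoef)‖ ^ 2) M ξ := by
  have hx := hξ.isStationary_gen hT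
  obtain ⟨h₀, F, hF, hval⟩ := exists_uniform_estimate hT hcoef
  have hZ := hval hξ
  set S : trigSpace ℕ+ := ⟨_, symbol_mem_trigSpace (isSmoothSymbol_coefSeq hcoef)⟩ with hS
  have hB : functionalB d τ T b ξ = trigEval (gen d τ T ξ) S := hξ.functionalB_eq hT hP hb hcoef
  have hG : trigEval (gen d τ T ξ) (S - F) =
      functionalB d τ T b ξ - trigEval (gen d τ T ξ) F := by rw [map_sub, hB]
  have hpow := hξ.power_gen_le hT hP
  have h1 : P * ‖hankel (coefSeq hcoef)‖ ^ 2 ≤ ‖predErr d τ T b ξ‖ ^ 2 := by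
    rw [minMse_eq, ← ofReal_norm, ← ENNReal.ofReal_pow (norm_nonneg _)] at hle
    exact (ENNReal.ofReal_le_ofReal_iff (sq_nonneg _)).1 hle
  have h2 := norm_trigEval_sq_le hx hF
  have h3 : ‖predErr d τ T b ξ‖ ^ 2 ≤ ‖trigEval (gen d τ T ξ) (S - F)‖ ^ 2 := by
    rw [hG]
    exact pow_le_pow_left₀ (norm_nonneg _) (norm_predErr_le hZ.mem) 2
  have hν2 : 0 < ‖hankel (coefSeq hcoef)‖ ^ 2 := pow_pos ((norm_nonneg _).lt_of_ne' hν) 2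
  -- The chain `P ν² ≤ ‖predErr‖² ≤ ν² power ≤ P ν²` collapses.
  have h4 : power (gen d τ T ξ) = P := by
    refine le_antisymm hpow (le_of_mul_le_mul_right ?_ hν2)
    linarith
  -- The error of the uniform estimate differs from the optimal error by a vector of the past,
  -- orthogonal to the latter. Having no larger norm, it coincides with it.
  have h5 : trigEval (gen d τ T ξ) (S - F) = predErr d τ T b ξ := by
    have hperp : predErr d τ T b ξ ∈ (pastSpace d τ T ξ (-1))ᗮ :=
      Submodule.sub_starProjection_mem_orthogonal _
    have hmem : trigEval (gen d τ T ξ) (S - F) - predErr d τ T b ξ ∈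
        pastSpace d τ T ξ (-1) := by
      rw [hG, predErr, sub_sub_sub_cancel_left]
      exact Submodule.sub_mem _ (Submodule.starProjection_apply_mem _ _) hZ.mem
    have h6 := norm_add_sq_eq_norm_sq_add_norm_sq_of_inner_eq_zero (𝕜 := ℂ) _ _
      (Submodule.inner_left_of_mem_orthogonal hmem hperp)
    rw [add_sub_cancel] at h6
    have h7 : ‖trigEval (gen d τ T ξ) (S - F) - predErr d τ T b ξ‖ = 0 := by
      refine mul_self_eq_zero.1 (le_antisymm ?_ (mul_self_nonneg _))
      rw [h4] at h2
      nlinarith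
    exact sub_eq_zero.1 (norm_eq_zero.1 h7)
  have hext : IsExtremal hcoef (gen d τ T ξ) (S - F) := by
    refine ⟨hx, hF, ?_, fun y hy => ?_, ?_⟩
    · rw [← hS, map_sub, sub_sub_cancel]
      exact hZ.mem
    · rw [h5]
      exact Submodule.inner_left_of_mem_orthogonal hy
        (Submodule.sub_starProjection_mem_orthogonal _)
    · rw [h4, mul_comm]
      exact h1.trans h3
  obtain ⟨M, g, ε, hg, hsum, hε, hεm, hgen⟩ := hext.exists_movingAverage hν
  exact ⟨M, g, ε, hg, hsum.trans h4, hε,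
    fun s m => hξ.integral_eq_zero_of_mem_totalSpan hT (hεm s m), hgen⟩

/-! ### Saddle points -/

theorem maxMse_le {Y : Set (ℝ → Lp ℂ 2 μ)} {h : LinearEstimate} {v : ℝ≥0∞}
    (hv : ∀ ξ ∈ Y, mse d τ T b ξ h ≤ v) : maxMse d τ T b Y h ≤ v :=
  iSup₂_le hv

theorem minMse_le_maxMse {Y : Set (ℝ → Lp ℂ 2 μ)} (h : LinearEstimate) (hξ : ξ ∈ Y) :
    minMse d τ T b ξ ≤ maxMse d τ T b Y h :=
  (minMse_le_mse ξ h).trans (le_iSup₂ (f := fun ξ (_ : ξ ∈ Y) => mse d τ T b ξ h) ξ hξ)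

/-- One estimate with error at most `v` on the whole class and one process with optimal error at
least `v` form a saddle point. -/
theorem hasSaddleValue_of_exists {Y : Set (ℝ → Lp ℂ 2 μ)} {v : ℝ≥0∞} {h₀ : LinearEstimate}
    (hv : ∀ ξ ∈ Y, mse d τ T b ξ h₀ ≤ v) {ξ₀ : ℝ → Lp ℂ 2 μ} (hξ₀ : ξ₀ ∈ Y)
    (hle : v ≤ minMse d τ T b ξ₀) : HasSaddleValue d τ T b Y v := by
  have h1 : mse d τ T b ξ₀ h₀ = v := le_antisymm (hv _ hξ₀) (hle.trans (minMse_le_mse _ _))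
  refine ⟨⟨ξ₀, hξ₀, h₀, h1, fun ξ hξ => ?_, fun h => ?_⟩,
    fun ξ _ => exists_mse_eq_minMse d τ T b ξ, ⟨⟨h₀, ?_⟩, ?_⟩, ⟨⟨ξ₀, hξ₀, ?_⟩, ?_⟩⟩
  · rw [h1]; exact hv ξ hξ
  · rw [h1]; exact hle.trans (minMse_le_mse _ _)
  · exact le_antisymm (maxMse_le hv) (hle.trans (minMse_le_maxMse h₀ hξ₀))
  · rintro _ ⟨h, rfl⟩
    exact hle.trans (minMse_le_maxMse h hξ₀)
  · exact le_antisymm ((minMse_le_mse _ h₀).trans (hv _ hξ₀)) hle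
  · rintro _ ⟨ξ, hξ, rfl⟩
    exact (minMse_le_mse _ h₀).trans (hv _ hξ)

/-- The variant without an extremal process: optimal errors arbitrarily close to `v` still exclude
any smaller worst error. -/
theorem isLeast_and_isLUB_of_exists {Y : Set (ℝ → Lp ℂ 2 μ)} {v : ℝ≥0∞} {h₀ : LinearEstimate}
    (hv : ∀ ξ ∈ Y, mse d τ T b ξ h₀ ≤ v)
    (hle : ∀ c < v, ∃ ξ ∈ Y, c < minMse d τ T b ξ) :
    IsLeast (range (maxMse d τ T b Y)) v ∧ IsLUB (minMse d τ T b '' Y) v := by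
  have h1 : ∀ h, v ≤ maxMse d τ T b Y h := fun h => le_of_forall_lt fun c hc => by
    obtain ⟨ξ, hξ, hcξ⟩ := hle c hc
    exact hcξ.trans_le (minMse_le_maxMse h hξ)
  refine ⟨⟨⟨h₀, le_antisymm (maxMse_le hv) (h1 h₀)⟩, ?_⟩, ?_, fun u hu => ?_⟩
  · rintro _ ⟨h, rfl⟩
    exact h1 h
  · rintro _ ⟨ξ, hξ, rfl⟩
    exact (minMse_le_mse _ h₀).trans (hv _ hξ)
  · refine le_of_forall_lt fun c hc => ?_
    obtain ⟨ξ, hξ, hcξ⟩ := hle c hc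
    exact hcξ.trans_le (hu ⟨ξ, hξ, rfl⟩)

end Main

end PCIncr

end

theorem mainTheorem4 {Ω : Type*} [MeasurableSpace Ω] (μ : Measure Ω) [IsProbabilityMeasure μ]
    (hΩ : ¬ FiniteDimensional ℂ (Lp ℂ 2 μ))
    (d τ : ℕ) (hτ : 1 ≤ τ) (T P : ℝ) (hT : 0 < T) (hP : 0 ≤ P) (b : ℝ → ℂ)
    (hb : ∀ j : ℕ, MemLp (fun u : ℝ => b (u + j * T)) 2 (volume.restrict (Ico (0 : ℝ) T)))
    (hcoef : PCIncr.CoefCondition T b) :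
    -- the functional is well defined on the class and has a finite second moment
    (∀ ξ ∈ PCIncr.classY μ d τ T P,
      IntegrableOn (fun t => b t • PCIncr.increment d (τ * T) ξ t) (Ioi (0 : ℝ))) ∧
    ∃ (Q : PCIncr.Ell2 →L[ℂ] PCIncr.Ell2) (ν : ℝ),
      -- the operator and its greatest eigenvalue
      PCIncr.HasBlockMatrix T b Q ∧ IsSelfAdjoint Q ∧ IsCompactOperator Q ∧
      IsGreatest {x : ℝ | Module.End.HasEigenvalue (Q : PCIncr.Ell2 →ₗ[ℂ] PCIncr.Ell2) (x : ℂ)}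
        (ν ^ 2) ∧
      -- saddle point, min max = max min
      PCIncr.HasSaddleValue d τ T b (PCIncr.classY μ d τ T P) (ENNReal.ofReal (P * ν ^ 2)) ∧
      PCIncr.HasSaddleValue d τ T b (PCIncr.classYR μ d τ T P) (ENNReal.ofReal (P * ν ^ 2)) ∧
      -- the same value for mean-square continuous increment processes
      IsLeast (range (PCIncr.maxMse d τ T b (PCIncr.classYC μ d τ T P)))
        (ENNReal.ofReal (P * ν ^ 2)) ∧
      IsLUB (PCIncr.minMse d τ T b '' PCIncr.classYC μ d τ T P) (ENNReal.ofReal (P * ν ^ 2)) ∧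
      -- the least favorable sequences
      (∃ ξ ∈ PCIncr.classYR μ d τ T P, PCIncr.IsEigenMovingAverage d τ T P Q (ν ^ 2) 1 ξ) ∧
      (∀ ξ ∈ PCIncr.classY μ d τ T P, ∀ M : ℕ,
        PCIncr.IsEigenMovingAverage d τ T P Q (ν ^ 2) M ξ →
          PCIncr.IsLeastFavorable d τ T b (PCIncr.classY μ d τ T P) ξ) ∧
      (ν ≠ 0 → ∀ ξ, PCIncr.IsLeastFavorable d τ T b (PCIncr.classY μ d τ T P) ξ →
        ∃ M : ℕ, PCIncr.IsEigenMovingAverage d τ T P Q (ν ^ 2) M ξ) := by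
  have hb' : ∀ j, MemLp (PCIncr.weightPart T b j) 2 (PCIncr.perMeasure T) := fun j => by
    rw [← PCIncr.restrict_Ico_eq_perMeasure]; exact hb j
  obtain ⟨h₀, hh₀⟩ := PCIncr.exists_mse_le hT hP hb' hcoef
  obtain ⟨ξ₀, hξ₀, hav⟩ :=
    PCIncr.exists_eigenMovingAverage (μ := μ) (d := d) hΩ hτ hT hP hcoef
  have hle := hav.le_minMse hT hP hξ₀.1 hb' hcoef
  obtain ⟨hC1, hC2⟩ := PCIncr.isLeast_and_isLUB_of_exists
    (Y := PCIncr.classYC μ d τ T P) (h₀ := h₀) (fun ξ hξ => hh₀ hξ.1)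
    fun c hc => PCIncr.exists_continuous_lt_minMse hΩ hτ hT hP hb' hcoef hc
  refine ⟨fun ξ hξ => PCIncr.MemY.integrableOn_Ioi hT hP hξ hb' hcoef, PCIncr.blockOp hcoef,
    ‖PCIncr.hankel (PCIncr.coefSeq hcoef)‖, PCIncr.hasBlockMatrix_blockOp hcoef,
    PCIncr.isSelfAdjoint_comp_adjoint _, PCIncr.isCompactOperator_blockOp hcoef,
    PCIncr.isGreatest_eigenvalue_blockOp hcoef,
    PCIncr.hasSaddleValue_of_exists (fun ξ hξ => hh₀ hξ) hξ₀.1 hle,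
    PCIncr.hasSaddleValue_of_exists (fun ξ hξ => hh₀ hξ.1) hξ₀ hle, hC1, hC2, ⟨ξ₀, hξ₀, hav⟩,
    fun ξ hξ M hM => ⟨hξ, fun ξ' hξ' => ?_⟩, fun hν ξ hξ => ?_⟩
  · exact ((PCIncr.minMse_le_mse ξ' h₀).trans (hh₀ hξ')).trans (hM.le_minMse hT hP hξ hb' hcoef)
  -- A least favorable process is at least as unfavorable as `ξ₀`, so its optimal error reaches `P
  -- ν²`.
  · exact PCIncr.MemY.exists_eigenMovingAverage_of_le hT hP hξ.1 hb' hcoef hν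
      (hle.trans (hξ.2 ξ₀ hξ₀.1))
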